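/- Let $M$ be a smooth surface. A Weylian metric $\Phi$ on $M$ is an equivalence class of pairs $(g,\varphi)$, with $g$ a Riemannian metric and $\varphi$ a $1$-form, under $(g,\varphi)\sim(\Omega^2g,\varphi-d\ln|\Omega|)$ for nowhere vanishing $\Omega\in C^\infty(M)$. It is flat if some representative $(g,\varphi)$ has $g$ flat. Its Weyl connection $D$ is the torsion-free connection with $Dg=-2\varphi\otimes g$. For a $(1,2)$-tensor field $\hat S$ and a representative $(g,\varphi)$ put $S_{ijk}=g_{ka}\hat S_{ij}{}^a$. Let $\nabla$, $\Delta$, $R$ be the Levi-Civita connection, Laplace--Beltrami operator and scalar curvature of $g$. Let $\Pi_{(ij)\circ}$, $\Pi_{(ijk)\circ}$ be the projections onto the totally symmetric trace-free part, and write $t_i=\nabla_it$, $|S|^2=S^{ijk}S_{ijk}$. For a function $t$ put $$\Xi_{ij}=\nabla^aS_{aij}+\tfrac23S_{ija}t^a,\qquad \beta_k=S_{kab}\Xi^{ab},$$ $$\tau_{ij}=\tfrac23\big(\nabla^2_{ij}t-\tfrac12\Delta t\,g_{ij}\big)-\tfrac23S_{ija}t^a+\tfrac13\Xi_{ij}-\tfrac89\big(t_it_j-\tfrac12t^at_a\,g_{ij}\big),$$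 $$\mathfrak z_{ijl}{}^k=g^{ka}\,\Pi_{(ija)\circ}(\Xi_{ij}g_{al}),\qquad \mathfrak b_{ijk}=\Pi_{(ij)\circ}(\beta_ig_{jk}),\qquad \mathcal L^{2D}=\Delta t-\tfrac32R .$$ The triple $(M,\Phi,\hat S)$ is called abundant if for every representative $(g,\varphi)$ there is a function $t\in C^\infty(M)$ with $dt=3\varphi$ such that $g$ is conformally flat (some $\Omega^2g$ is flat), $S$ is totally symmetric and trace-free, and \begin{align*} \nabla_lS_{ijk}&=\Pi_{(ijk)\circ}\big[-\tfrac23S_{ijk}t_l+2t_iS_{jkl}+\Xi_{ij}g_{kl}\big],\\ \nabla_k\Xi_{ij}&=\tfrac13S_{ijk}|S|^2+\tfrac43\Pi_{(ijk)\circ}\,\Xi_{jk}t_i+\tfrac43\Pi_{(ij)\circ}\,g_{jk}\beta_i,\\ \nabla^a\tau_{ak}&=-S_{kab}\tau^{ab}+\beta_k-\tfrac23\Xi_{ka}t^a-\tfrac49S_{kab}t^at^b-\tfrac59|S|^2t_k+\tfrac12\nabla_kR-Rt_k,\\ \nabla^2_{ij}t&=\tfrac32\big[\tau_{ij}+\tfrac23S_{ija}t^a+\tfrac89\Pi_{(ij)\circ}t_it_j-\tfrac13\Xi_{ij}\big]+\tfrac12g_{ij}\big[\tfrac13|S|^2+\tfrac32R\big].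 \end{align*} **Theorem.** Let $(M,\Phi)$ be a flat two-dimensional Weylian structure and $\hat S$ a smooth $(1,2)$-tensor field. 1. For every representative $(g,\varphi)\in\Phi$: $(M,\Phi,\hat S)$ is abundant if and only if there is $t\in C^\infty(M)$ with $dt=3\varphi$ such that, for all vector fields $X$, $$D_X\hat S=\mathfrak z(\cdot,\cdot,X),\qquad D_X\Xi=\tfrac{|S|^2}{3}S(X,\cdot,\cdot)+\tfrac43\,\mathfrak b(\cdot,\cdot,X),\qquad \mathcal L^{2D}=\tfrac13|S|^2 .$$ 2. Let $(g,\varphi)\in\Phi$, let $t\in C^\infty(M)$, and consider a conformal change $(g,\varphi,t)\mapsto(\Omega^2g,\varphi-d\ln|\Omega|,t-3\ln|\Omega|)$. Then $\mathcal L^{2D}\mapsto\Omega^{-2}\mathcal L^{2D}$, i.e. $\mathcal L^{2D}$ is a density of weight $-2$, and the third equation is invariant. If $S$ is totally symmetric and trace-free, the first two equations are each invariant as well. -/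

import Mathlib

open scoped Manifold ContDiff Topology Matrix

noncomputable section

namespace WeylAbundant

/-! ### Tensor calculus in local coordinates (dimension two)

Components are functions of the coordinate point `y`.  A metric is a matrix-valued function,
covariant tensors of rank 1, 2, 3 are families indexed by `Fin 2`.  In the components of a
covariant derivative the index `l` of the differentiation comes first. -/

/-- The model plane. -/
abbrev Plane : Type := EuclideanSpace ℝ (Fin 2)

/-- Components of a metric, of its inverse, of a connection, of a covector, ... at one point. -/
abbrev Mat2 : Type := Matrix (Fin 2) (Fin 2) ℝ
abbrev Vec : Type := Fin 2 → ℝ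
abbrev Ten2 : Type := Fin 2 → Fin 2 → ℝ
abbrev Ten3 : Type := Fin 2 → Fin 2 → Fin 2 → ℝ
abbrev Ten4 : Type := Fin 2 → Fin 2 → Fin 2 → Fin 2 → ℝ

/-- The partial derivative `∂_i f`. -/
def pd (i : Fin 2) (f : Plane → ℝ) (y : Plane) : ℝ :=
  fderiv ℝ f y (EuclideanSpace.single i 1)

/-! #### Pointwise algebra -/

/-- Projection `Π_{(ij)∘}` onto the symmetric trace-free part with respect to `G`. -/
def proj2 (G : Mat2) (T : Ten2) : Ten2 := fun i j =>
  (T i j + T j i) / 2 - 1 / 2 * G i j * ∑ a, ∑ b, G⁻¹ a b * T a b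

/-- Total symmetrisation of a rank three tensor. -/
def sym3 (T : Ten3) : Ten3 := fun i j k =>
  (T i j k + T j k i + T k i j + T j i k + T i k j + T k j i) / 6

/-- The trace of the total symmetrisation. -/
def sym3Trace (G : Mat2) (T : Ten3) : Vec := fun k => ∑ a, ∑ b, G⁻¹ a b * sym3 T a b k

/-- Projection `Π_{(ijk)∘}` onto the totally symmetric, totally trace-free part
(the coefficient is `1/(n+2)` with `n = 2`). -/
def proj3 (G : Mat2) (T : Ten3) : Ten3 := fun i j k =>
  sym3 T i j k - 1 / 4 *
    (G i j * sym3Trace G T k + G j k * sym3Trace G T i + G k i * sym3Trace G T j)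

/-- The squared norm `S^{ijk} S_{ijk}`. -/
def normSq3 (G : Mat2) (S : Ten3) : ℝ :=
  ∑ i, ∑ j, ∑ k, ∑ a, ∑ b, ∑ c, G⁻¹ i a * G⁻¹ j b * G⁻¹ k c * S i j k * S a b c

/-- `α ↦ α^a = g^{ab} α_b`. -/
def raise (G : Mat2) (α : Vec) : Vec := fun a => ∑ b, G⁻¹ a b * α b

/-- The contraction `S_{ija} α^a`. -/
def contr1 (G : Mat2) (S : Ten3) (α : Vec) : Ten2 := fun i j => ∑ a, S i j a * raise G α a

/-- The contraction `S_{kab} T^{ab}`. -/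
def contr2 (G : Mat2) (S : Ten3) (T : Ten2) : Vec := fun k =>
  ∑ a, ∑ b, ∑ c, ∑ d, S k a b * G⁻¹ a c * G⁻¹ b d * T c d

/-- `S_{ijk} = g_{ka} Ŝ_{ij}^a`. -/
def lower (G : Mat2) (Sh : Ten3) : Ten3 := fun i j k => ∑ a, G k a * Sh i j a

/-- Totally symmetric and trace-free. -/
def IsSymTraceFree3 (G : Mat2) (S : Ten3) : Prop :=
  (∀ i j k, S i j k = S j i k) ∧ (∀ i j k, S i j k = S i k j) ∧
    ∀ k, ∑ a, ∑ b, G⁻¹ a b * S a b k = 0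

/-! #### Connections and curvature -/

/-- Christoffel symbols `Γ^k_{ij}` of the Levi-Civita connection of `g`. -/
def christoffel (g : Plane → Mat2) (y : Plane) (k i j : Fin 2) : ℝ :=
  1 / 2 * ∑ l, (g y)⁻¹ k l *
    (pd i (fun z => g z j l) y + pd j (fun z => g z i l) y - pd l (fun z => g z i j) y)

/-- Connection coefficients of the Weyl connection of `(g, φ)`, the torsion-free connection `D`
with `D g = -2 φ ⊗ g` (see `weylConn_symm` and `weylConn_metric`):
`D_X Y = ∇_X Y + φ(X) Y + φ(Y) X - g(X, Y) φ^♯`. -/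
def weylConn (g : Plane → Mat2) (φ : Plane → Vec) (y : Plane) (k i j : Fin 2) : ℝ :=
  christoffel g y k i j + (if k = j then φ y i else 0) + (if k = i then φ y j else 0)
    - g y i j * raise (g y) (φ y) k

/-- `∇_l α_i`. -/
def cov1 (Γ : Plane → Ten3) (α : Plane → Vec) (y : Plane) (l i : Fin 2) : ℝ :=
  pd l (fun z => α z i) y - ∑ a, Γ y a l i * α y a

/-- `∇_l T_{ij}`. -/
def cov2 (Γ : Plane → Ten3) (T : Plane → Ten2) (y : Plane) (l i j : Fin 2) : ℝ :=
  pd l (fun z => T z i j) y - ∑ a, (Γ y a l i * T y a j + Γ y a l j * T y i a)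

/-- `∇_l S_{ijk}`. -/
def cov3 (Γ : Plane → Ten3) (S : Plane → Ten3) (y : Plane) (l i j k : Fin 2) : ℝ :=
  pd l (fun z => S z i j k) y
    - ∑ a, (Γ y a l i * S y a j k + Γ y a l j * S y i a k + Γ y a l k * S y i j a)

/-- `∇_l Ŝ_{ij}^k` for a tensor `Ŝ` with two lower indices and one upper index. -/
def cov12 (Γ : Plane → Ten3) (Sh : Plane → Ten3) (y : Plane) (l i j k : Fin 2) : ℝ :=
  pd l (fun z => Sh z i j k) y
    + ∑ a, (Γ y k l a * Sh y i j a - Γ y a l i * Sh y a j k - Γ y a l j * Sh y i a k)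

/-- Curvature components: `R(∂_i, ∂_j) ∂_k = ∑_l (curv Γ y l k i j) ∂_l`. -/
def curv (Γ : Plane → Ten3) (y : Plane) (l k i j : Fin 2) : ℝ :=
  pd i (fun z => Γ z l j k) y - pd j (fun z => Γ z l i k) y
    + ∑ a, (Γ y l i a * Γ y a j k - Γ y l j a * Γ y a i k)

/-- Ricci tensor `Ric(∂_j, ∂_k) = tr (R(·, ∂_j) ∂_k)`. -/
def ricci (g : Plane → Mat2) (y : Plane) (j k : Fin 2) : ℝ :=
  ∑ i, curv (christoffel g) y i k i j

/-- Scalar curvature `R`. -/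
def scal (g : Plane → Mat2) (y : Plane) : ℝ := ∑ j, ∑ k, (g y)⁻¹ j k * ricci g y j k

/-- The differential `t_i = ∂_i t`. -/
def diff (t : Plane → ℝ) (y : Plane) : Vec := fun i => pd i t y

/-- The Hessian `∇²_{ij} t`. -/
def hess (g : Plane → Mat2) (t : Plane → ℝ) (y : Plane) : Ten2 := fun i j =>
  cov1 (christoffel g) (diff t) y i j

/-- The Laplace-Beltrami operator. -/
def laplace (g : Plane → Mat2) (t : Plane → ℝ) (y : Plane) : ℝ :=
  ∑ a, ∑ b, (g y)⁻¹ a b * hess g t y a b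

/-! #### The tensors attached to `(g, S, t)` -/

/-- `Ξ_{ij} = ∇^a S_{aij} + (2/3) S_{ija} t^a`. -/
def Xi (g : Plane → Mat2) (S : Plane → Ten3) (t : Plane → ℝ) (y : Plane) : Ten2 := fun i j =>
  (∑ a, ∑ b, (g y)⁻¹ a b * cov3 (christoffel g) S y b a i j)
    + 2 / 3 * contr1 (g y) (S y) (diff t y) i j

/-- `β_k = S_{kab} Ξ^{ab}`. -/
def beta (g : Plane → Mat2) (S : Plane → Ten3) (t : Plane → ℝ) (y : Plane) : Vec :=
  contr2 (g y) (S y) (Xi g S t y)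

/-- `τ_{ij} = (2/3) (∇²_{ij} t - (1/2) Δt g_{ij}) - (2/3) S_{ija} t^a + (1/3) Ξ_{ij}
- (8/9) (t_i t_j - (1/2) t^a t_a g_{ij})`. -/
def tau (g : Plane → Mat2) (S : Plane → Ten3) (t : Plane → ℝ) (y : Plane) : Ten2 := fun i j =>
  2 / 3 * (hess g t y i j - 1 / 2 * laplace g t y * g y i j)
    - 2 / 3 * contr1 (g y) (S y) (diff t y) i j
    + 1 / 3 * Xi g S t y i j
    - 8 / 9 * (diff t y i * diff t y j
        - 1 / 2 * (∑ a, raise (g y) (diff t y) a * diff t y a) * g y i j)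

/-- `𝔷_{ijl}^k = g^{ka} Π_{(ija)∘} (Ξ_{ij} g_{al})`. -/
def zTensor (g : Plane → Mat2) (S : Plane → Ten3) (t : Plane → ℝ) (y : Plane) : Ten4 :=
  fun i j l k => ∑ a, (g y)⁻¹ k a *
    proj3 (g y) (fun i' j' a' => Xi g S t y i' j' * g y a' l) i j a

/-- `𝔟_{ijk} = Π_{(ij)∘} (β_i g_{jk})`. -/
def bTensor (g : Plane → Mat2) (S : Plane → Ten3) (t : Plane → ℝ) (y : Plane) : Ten3 :=
  fun i j k => proj2 (g y) (fun i' j' => beta g S t y i' * g y j' k) i j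

/-- `𝓛^{2D} = Δ t - (3/2) R`. -/
def L2D (g : Plane → Mat2) (t : Plane → ℝ) (y : Plane) : ℝ := laplace g t y - 3 / 2 * scal g y

/-- The structural equations of a two-dimensional abundant structure `(g, S, t)` at `y`. -/
structure StructuralEquations (g : Plane → Mat2) (S : Plane → Ten3) (t : Plane → ℝ)
    (y : Plane) : Prop where
  /-- the equation for `∇_l S_{ijk}` -/
  nabla_S : ∀ l i j k, cov3 (christoffel g) S y l i j k =
    proj3 (g y) (fun i j k => -(2 / 3) * S y i j k * diff t y l + 2 * diff t y i * S y j k l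
      + Xi g S t y i j * g y k l) i j k
  /-- the equation for `∇_k Ξ_{ij}` -/
  nabla_Xi : ∀ k i j, cov2 (christoffel g) (Xi g S t) y k i j =
    1 / 3 * S y i j k * normSq3 (g y) (S y)
      + 4 / 3 * proj3 (g y) (fun i j k => Xi g S t y j k * diff t y i) i j k
      + 4 / 3 * proj2 (g y) (fun i j => g y j k * beta g S t y i) i j
  /-- the equation for `∇^a τ_{ak}` -/
  div_tau : ∀ k, ∑ a, ∑ b, (g y)⁻¹ a b * cov2 (christoffel g) (tau g S t) y b a k =
    -contr2 (g y) (S y) (tau g S t y) k + beta g S t y k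
      - 2 / 3 * (∑ a, Xi g S t y k a * raise (g y) (diff t y) a)
      - 4 / 9 * (∑ a, ∑ b, S y k a b * raise (g y) (diff t y) a * raise (g y) (diff t y) b)
      - 5 / 9 * normSq3 (g y) (S y) * diff t y k
      + 1 / 2 * pd k (scal g) y - scal g y * diff t y k
  /-- the equation for `∇²_{ij} t` -/
  hess_t : ∀ i j, hess g t y i j =
    3 / 2 * (tau g S t y i j + 2 / 3 * contr1 (g y) (S y) (diff t y) i j
        + 8 / 9 * proj2 (g y) (fun i j => diff t y i * diff t y j) i j
        - 1 / 3 * Xi g S t y i j)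
      + 1 / 2 * g y i j * (1 / 3 * normSq3 (g y) (S y) + 3 / 2 * scal g y)

/-! #### The Weyl connection has the defining properties -/

theorem weylConn_symm (g : Plane → Mat2) (φ : Plane → Vec) (y : Plane)
    (hs : ∀ z i j, g z i j = g z j i) (k i j : Fin 2) :
    weylConn g φ y k i j = weylConn g φ y k j i := by
  have h1 : christoffel g y k i j = christoffel g y k j i := by
    unfold christoffel
    congr 1
    refine Finset.sum_congr rfl fun l _ => ?_
    have : (fun z => g z i j) = fun z => g z j i := funext fun z => hs z i j
    rw [this]; ring
  unfold weylConn
  rw [h1, hs y i j]; ring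

theorem weylConn_metric (g : Plane → Mat2) (φ : Plane → Vec) (y : Plane)
    (hs : ∀ z i j, g z i j = g z j i) (hd : IsUnit (g y).det) (l i j : Fin 2) :
    cov2 (weylConn g φ) (fun z i j => g z i j) y l i j = -2 * φ y l * g y i j := by
  have hinv : ∀ (v : Vec) (j : Fin 2), ∑ a, (∑ b, (g y)⁻¹ a b * v b) * g y a j = v j := by
    intro v j
    have h := congrFun (congrArg (fun A => A *ᵥ v) (Matrix.mul_nonsing_inv _ hd)) j
    simp only [← Matrix.mulVec_mulVec, Matrix.one_mulVec] at h
    rw [← h]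
    simp only [Matrix.mulVec, dotProduct]
    exact Finset.sum_congr rfl fun a _ => by rw [hs y a j]; ring
  have hchr : ∀ i j, ∑ a, christoffel g y a l i * g y a j =
      1 / 2 * (pd l (fun z => g z i j) y + pd i (fun z => g z l j) y
        - pd j (fun z => g z l i) y) := by
    intro i j
    rw [← hinv (fun j => 1 / 2 * (pd l (fun z => g z i j) y + pd i (fun z => g z l j) y
        - pd j (fun z => g z l i) y)) j]
    refine Finset.sum_congr rfl fun a _ => ?_
    unfold christoffel
    rw [Finset.mul_sum]
    congr 1
    exact Finset.sum_congr rfl fun b _ => by ring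
  have hφ : ∀ j, ∑ a, raise (g y) (φ y) a * g y a j = φ y j := fun j => hinv (φ y) j
  have hW : ∀ i j, ∑ a, weylConn g φ y a l i * g y a j =
      1 / 2 * (pd l (fun z => g z i j) y + pd i (fun z => g z l j) y
        - pd j (fun z => g z l i) y) + φ y l * g y i j + φ y i * g y l j
        - g y l i * φ y j := by
    intro i j
    rw [← hchr, ← hφ j, Finset.mul_sum]
    have : ∀ a, weylConn g φ y a l i * g y a j = christoffel g y a l i * g y a j
        + (if a = i then φ y l * g y a j else 0) + (if a = l then φ y i * g y a j else 0)
        - g y l i * (raise (g y) (φ y) a * g y a j) := by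
      intro a; unfold weylConn; split_ifs <;> ring
    simp only [this, Finset.sum_sub_distrib, Finset.sum_add_distrib, Finset.sum_ite_eq',
      Finset.mem_univ, if_true]
  unfold cov2
  have h2 : ∑ a, (weylConn g φ y a l i * g y a j + weylConn g φ y a l j * g y i a) =
      ∑ a, weylConn g φ y a l i * g y a j + ∑ a, weylConn g φ y a l j * g y a i := by
    rw [← Finset.sum_add_distrib]
    exact Finset.sum_congr rfl fun a _ => by rw [hs y i a]
  have h3 : (fun z => g z j i) = fun z => g z i j := funext fun z => hs z j i
  rw [h2, hW, hW, h3, hs y j i, hs y l i, hs y l j]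
  ring

/-! ### Tensor fields and Weylian metrics on a surface -/

section Manifold

variable (M : Type*) [TopologicalSpace M] [ChartedSpace Plane M] [IsManifold (𝓡 2) ∞ M]

/-- Smooth Riemannian metrics on `M`. -/
abbrev Metric : Type _ :=
  Bundle.ContMDiffRiemannianMetric (𝓡 2) ∞ Plane (fun x : M => TangentSpace (𝓡 2) x)

/-- Smooth 1-forms on `M`. -/
structure OneForm where
  /-- the value at a point -/
  toFun (x : M) : TangentSpace (𝓡 2) x →L[ℝ] ℝ
  contMDiff : ContMDiff (𝓡 2) ((𝓡 2).prod 𝓘(ℝ, Plane →L[ℝ] ℝ)) ∞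
    (fun x => Bundle.TotalSpace.mk' (Plane →L[ℝ] ℝ)
      (E := fun x => TangentSpace (𝓡 2) x →L[ℝ] ℝ) x (toFun x))

/-- Smooth (1,2)-tensor fields `(X, Y) ↦ Ŝ(X, Y)` on `M`. -/
structure Tensor12 where
  /-- the value at a point -/
  toFun (x : M) : TangentSpace (𝓡 2) x →L[ℝ] TangentSpace (𝓡 2) x →L[ℝ] TangentSpace (𝓡 2) x
  contMDiff : ContMDiff (𝓡 2) ((𝓡 2).prod 𝓘(ℝ, Plane →L[ℝ] Plane →L[ℝ] Plane)) ∞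
    (fun x => Bundle.TotalSpace.mk' (Plane →L[ℝ] Plane →L[ℝ] Plane)
      (E := fun x => TangentSpace (𝓡 2) x →L[ℝ] TangentSpace (𝓡 2) x →L[ℝ]
        TangentSpace (𝓡 2) x) x (toFun x))

/-- A pair `(g, φ)` of a Riemannian metric and a 1-form. -/
structure WeylPair where
  /-- the metric -/
  g : Metric M
  /-- the 1-form -/
  φ : OneForm M

variable {M}

/-- Local coordinates: a chart of the maximal smooth atlas. -/
def IsCoord (e : OpenPartialHomeomorph M Plane) : Prop :=
  e ∈ IsManifold.maximalAtlas (𝓡 2) ∞ M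

/-- The coordinate vector `∂_i` at the point with coordinates `y`. -/
def coordVec (e : OpenPartialHomeomorph M Plane) (y : Plane) (i : Fin 2) :
    TangentSpace (𝓡 2) (e.symm y) :=
  mfderiv (𝓡 2) (𝓡 2) e.symm y (EuclideanSpace.single i (1 : ℝ) : Plane)

/-- The components `g_{ij}` of a metric in the coordinates `e`. -/
def Metric.coord (g : Metric M) (e : OpenPartialHomeomorph M Plane) (y : Plane) : Mat2 :=
  Matrix.of fun i j => g.inner (e.symm y) (coordVec e y i) (coordVec e y j)

/-- The components `φ_i` of a 1-form in the coordinates `e`. -/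
def OneForm.coord (φ : OneForm M) (e : OpenPartialHomeomorph M Plane) (y : Plane) : Vec :=
  fun i => φ.toFun (e.symm y) (coordVec e y i)

/-- The components `Ŝ_{ij}^k` of a (1,2)-tensor field in the coordinates `e`:
`Ŝ(∂_i, ∂_j) = ∑_k Ŝ_{ij}^k ∂_k`. -/
def Tensor12.coord (Sh : Tensor12 M) (e : OpenPartialHomeomorph M Plane) (y : Plane) : Ten3 :=
  fun i j k =>
    (show Plane from mfderiv (𝓡 2) (𝓡 2) e (e.symm y)
      (Sh.toFun (e.symm y) (coordVec e y i) (coordVec e y j))) k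

/-- The components of `S = g Ŝ` in the coordinates `e`. -/
def Tensor12.coordLower (Sh : Tensor12 M) (g : Metric M) (e : OpenPartialHomeomorph M Plane)
    (y : Plane) : Ten3 :=
  lower (g.coord e y) (Sh.coord e y)

/-- A function on `M` in the coordinates `e`. -/
def coordFun (t : C^∞⟮𝓡 2, M; ℝ⟯) (e : OpenPartialHomeomorph M Plane) (y : Plane) : ℝ :=
  t (e.symm y)

/-- `h = Ω² g` with `Ω` nowhere vanishing. -/
def Metric.IsRescaling (Ω : C^∞⟮𝓡 2, M; ℝ⟯) (g h : Metric M) : Prop :=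
  (∀ x, Ω x ≠ 0) ∧ ∀ x (v w : TangentSpace (𝓡 2) x), h.inner x v w = Ω x ^ 2 * g.inner x v w

/-- The metric is flat: its Riemann curvature tensor vanishes. -/
def Metric.IsFlat (g : Metric M) : Prop :=
  ∀ e : OpenPartialHomeomorph M Plane, IsCoord e → ∀ y ∈ e.target, ∀ l k i j,
    curv (christoffel (g.coord e)) y l k i j = 0

/-- The conformal class of `g` contains a flat metric. -/
def Metric.IsConformallyFlat (g : Metric M) : Prop :=
  ∃ (h : Metric M) (Ω : C^∞⟮𝓡 2, M; ℝ⟯), Metric.IsRescaling Ω g h ∧ h.IsFlat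

/-- The differential of a real-valued function on `M`. -/
def differential (f : M → ℝ) (x : M) : TangentSpace (𝓡 2) x →L[ℝ] ℝ :=
  mfderiv (𝓡 2) 𝓘(ℝ, ℝ) f x

/-- `(g', φ') = (Ω² g, φ - d ln|Ω|)`. -/
def WeylPair.IsRescaling (Ω : C^∞⟮𝓡 2, M; ℝ⟯) (p q : WeylPair M) : Prop :=
  Metric.IsRescaling Ω p.g q.g ∧ ∀ x (v : TangentSpace (𝓡 2) x),
    q.φ.toFun x v = p.φ.toFun x v - differential (fun x => Real.log |Ω x|) x v

set_option linter.unusedSectionVars false in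
theorem mdiff_log {Ω : C^∞⟮𝓡 2, M; ℝ⟯} (h : ∀ x, Ω x ≠ 0) (x : M) :
    MDifferentiableAt (𝓡 2) 𝓘(ℝ, ℝ) (fun x => Real.log |Ω x|) x := by
  have h1 : (fun x => Real.log |Ω x|) = Real.log ∘ Ω := funext fun x => Real.log_abs _
  rw [h1]
  exact ((Real.differentiableAt_log (h x)).mdifferentiableAt).comp x
    (Ω.contMDiff.mdifferentiableAt (by simp))

/-- Conformal equivalence of pairs. -/
instance weylSetoid : Setoid (WeylPair M) where
  r p q := ∃ Ω : C^∞⟮𝓡 2, M; ℝ⟯, WeylPair.IsRescaling Ω p q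
  iseqv := by
    refine ⟨fun p => ⟨1, ⟨⟨by simp, by simp⟩, ?_⟩⟩, ?_, ?_⟩
    · intro x v
      have : (fun x : M => Real.log |(1 : C^∞⟮𝓡 2, M; ℝ⟯) x|) = fun _ => 0 := by
        funext x; simp
      have h2 : differential (fun _ : M => (0 : ℝ)) x = 0 := mfderiv_const
      rw [this, h2]
      simp
    · rintro p q ⟨Ω, ⟨h0, hg⟩, hφ⟩
      refine ⟨⟨fun x => (Ω x)⁻¹, ?_⟩, ⟨?_, ?_⟩, ?_⟩
      · exact Ω.contMDiff.inv₀ h0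
      · exact fun x => inv_ne_zero (h0 x)
      · intro x v w
        have := h0 x
        rw [hg]
        change _ = (Ω x)⁻¹ ^ 2 * _
        field_simp
      · intro x v
        have : (fun x : M => Real.log |(Ω x)⁻¹|) = -fun x => Real.log |Ω x| := by
          funext x; simp
        have h2 : differential (-fun x : M => Real.log |Ω x|) x =
            -differential (fun x => Real.log |Ω x|) x := mfderiv_neg
        change _ = _ - differential (fun x => Real.log |(Ω x)⁻¹|) x v
        rw [this, h2, hφ]
        simp
    · rintro p q r ⟨Ω, ⟨h0, hg⟩, hφ⟩ ⟨Ω', ⟨h0', hg'⟩, hφ'⟩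
      refine ⟨Ω * Ω', ⟨?_, ?_⟩, ?_⟩
      · exact fun x => mul_ne_zero (h0 x) (h0' x)
      · intro x v w
        rw [hg', hg]
        change _ = (Ω x * Ω' x) ^ 2 * _
        ring
      · intro x v
        have : (fun x : M => Real.log |(Ω * Ω') x|) =
            (fun x => Real.log |Ω x|) + fun x => Real.log |Ω' x| := by
          funext x
          change Real.log |Ω x * Ω' x| = Real.log |Ω x| + Real.log |Ω' x|
          rw [abs_mul, Real.log_mul (abs_ne_zero.2 (h0 x)) (abs_ne_zero.2 (h0' x))]
        have h2 : differential ((fun x : M => Real.log |Ω x|) + fun x => Real.log |Ω' x|) x =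
            differential (fun x => Real.log |Ω x|) x + differential (fun x => Real.log |Ω' x|) x :=
          mfderiv_add (mdiff_log h0 x) (mdiff_log h0' x)
        rw [this, h2, hφ', hφ]
        simp [sub_sub]

variable (M) in
/-- A Weylian metric: a conformal equivalence class of pairs `(g, φ)`. -/
def WeylianMetric : Type _ := Quotient (weylSetoid (M := M))

/-- The pair represents the Weylian metric. -/
def WeylPair.Represents (p : WeylPair M) (Φ : WeylianMetric M) : Prop :=
  Quotient.mk weylSetoid p = Φ

/-- The Weylian metric is flat: it has a representative `(g, φ)` with `g` flat. -/
def WeylianMetric.IsFlat (Φ : WeylianMetric M) : Prop :=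
  ∃ p : WeylPair M, p.Represents Φ ∧ p.g.IsFlat

/-- `S = g Ŝ` is totally symmetric and trace-free. -/
def Tensor12.IsSymTraceFree (Sh : Tensor12 M) (g : Metric M) : Prop :=
  ∀ e : OpenPartialHomeomorph M Plane, IsCoord e → ∀ y ∈ e.target,
    IsSymTraceFree3 (g.coord e y) (Sh.coordLower g e y)

/-- `(S, t)`, with `S = g Ŝ`, is an abundant structure on the surface `(M, g)`. -/
structure IsAbundantStructure (g : Metric M) (Sh : Tensor12 M) (t : C^∞⟮𝓡 2, M; ℝ⟯) :
    Prop where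
  conformallyFlat : g.IsConformallyFlat
  symTraceFree : Sh.IsSymTraceFree g
  equations : ∀ e : OpenPartialHomeomorph M Plane, IsCoord e → ∀ y ∈ e.target,
    StructuralEquations (g.coord e) (Sh.coordLower g e) (coordFun t e) y

/-- `dt = 3 φ`. -/
def OneForm.IsPotential (φ : OneForm M) (t : C^∞⟮𝓡 2, M; ℝ⟯) : Prop :=
  ∀ x (v : TangentSpace (𝓡 2) x), differential t x v = 3 * φ.toFun x v

/-- `(M, Φ, Ŝ)` is a (natural) abundant Weylian structure. -/
def WeylianMetric.IsAbundant (Φ : WeylianMetric M) (Sh : Tensor12 M) : Prop :=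
  ∀ p : WeylPair M, p.Represents Φ →
    ∃ t : C^∞⟮𝓡 2, M; ℝ⟯, p.φ.IsPotential t ∧ IsAbundantStructure p.g Sh t

/-- The equation `D_X Ŝ = 𝔷(·, ·, X)`. -/
def EqS (p : WeylPair M) (Sh : Tensor12 M) (t : C^∞⟮𝓡 2, M; ℝ⟯) : Prop :=
  ∀ e : OpenPartialHomeomorph M Plane, IsCoord e → ∀ y ∈ e.target, ∀ l i j k,
    cov12 (weylConn (p.g.coord e) (p.φ.coord e)) (Sh.coord e) y l i j k =
      zTensor (p.g.coord e) (Sh.coordLower p.g e) (coordFun t e) y i j l k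

/-- The equation `D_X Ξ = (|S|²/3) S(X, ·, ·) + (4/3) 𝔟(·, ·, X)`. -/
def EqXi (p : WeylPair M) (Sh : Tensor12 M) (t : C^∞⟮𝓡 2, M; ℝ⟯) : Prop :=
  ∀ e : OpenPartialHomeomorph M Plane, IsCoord e → ∀ y ∈ e.target, ∀ l i j,
    cov2 (weylConn (p.g.coord e) (p.φ.coord e))
        (Xi (p.g.coord e) (Sh.coordLower p.g e) (coordFun t e)) y l i j =
      normSq3 (p.g.coord e y) (Sh.coordLower p.g e y) / 3 * Sh.coordLower p.g e y l i j
        + 4 / 3 * bTensor (p.g.coord e) (Sh.coordLower p.g e) (coordFun t e) y i j l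

/-- The equation `𝓛^{2D} = |S|²/3`. -/
def EqL (p : WeylPair M) (Sh : Tensor12 M) (t : C^∞⟮𝓡 2, M; ℝ⟯) : Prop :=
  ∀ e : OpenPartialHomeomorph M Plane, IsCoord e → ∀ y ∈ e.target,
    L2D (p.g.coord e) (coordFun t e) y =
      1 / 3 * normSq3 (p.g.coord e y) (Sh.coordLower p.g e y)

end Manifold

end WeylAbundant

end

namespace WeylAbundant

/-! ### Partial derivatives -/

section PartialDerivatives

variable {U : Set Plane} {y : Plane} {f h : Plane → ℝ}

/-! Everything is expressed through the Weyl connection D, which does not depend on the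
representative of Φ.

With φ = dt/3, three facts relate the two systems. (a) Writing D as ∇ plus terms linear in φ turns
the D-equations for Ŝ and Ξ into the structural equations. The leftover terms vanish by algebraic
identities for trace-free tensors that are special to dimension two (`symTraceFree3_identity`,
`symTraceFree2_identity`). (b) The definition of τ makes the trace-free part of the Hessian equation
a tautology. Its trace is 𝓛 = |S|²/3 (`LocalMetric.eqL_iff`). (c) The equation for the divergence of
τ follows from the others. The third derivatives of t are removed by the Bochner formula and by
differentiating 𝓛 = |S|²/3, and the divergence of Ξ and the differential of |S|² come from the
structural equations (`LocalMetric.div_tau`).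

Abundance also requires S to be totally symmetric and trace-free, which the D-equations do not
assume. The right side of the first equation is a projection, so each trace of S is a D-parallel
covector and is annihilated by the curvature of D. In dimension two with φ closed, this curvature
has one component κ. Where κ ≠ 0 the three traces vanish, which in dimension two forces S to be
totally symmetric. Where κ = 0, 𝓛 vanishes, because it is -3/2 times the scalar curvature of D
(`LocalMetric.L2D_eq`). Then |S|² = 0 and S = 0.

Conformal behaviour comes from the same descriptions. 𝓛 is the trace of an invariant Ricci tensor
with g⁻¹, so it has weight -2. For S totally symmetric and trace-free, Ξ is the D-divergence of Ŝ
(`LocalMetric.Xi_eq_divergence`) and is therefore invariant; the remaining powers of Ω cancel.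
Invariance carries the equations from one representative to all others, and flatness of Φ supplies
conformal flatness. -/

theorem pd_add (hf : DifferentiableAt ℝ f y) (hh : DifferentiableAt ℝ h y) (i : Fin 2) :
    pd i (fun z => f z + h z) y = pd i f y + pd i h y := by
  simp [pd, fderiv_fun_add hf hh]

theorem pd_sub (hf : DifferentiableAt ℝ f y) (hh : DifferentiableAt ℝ h y) (i : Fin 2) :
    pd i (fun z => f z - h z) y = pd i f y - pd i h y := by
  simp [pd, fderiv_fun_sub hf hh]

theorem pd_mul (hf : DifferentiableAt ℝ f y) (hh : DifferentiableAt ℝ h y) (i : Fin 2) :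
    pd i (fun z => f z * h z) y = pd i f y * h y + f y * pd i h y := by
  simp [pd, fderiv_fun_mul hf hh]; ring

theorem pd_const_mul (c : ℝ) (hf : DifferentiableAt ℝ f y) (i : Fin 2) :
    pd i (fun z => c * f z) y = c * pd i f y := by
  simp [pd, fderiv_const_mul hf]

theorem pd_const (c : ℝ) (i : Fin 2) : pd i (fun _ => c) y = 0 := by
  simp [pd]

theorem pd_sum {ι : Type*} (s : Finset ι) {F : ι → Plane → ℝ}
    (hF : ∀ a ∈ s, DifferentiableAt ℝ (F a) y) (i : Fin 2) :
    pd i (fun z => ∑ a ∈ s, F a z) y = ∑ a ∈ s, pd i (F a) y := by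
  simp [pd, fderiv_fun_sum hF]

theorem pd_congr (hU : IsOpen U) (hy : y ∈ U) (hfh : ∀ z ∈ U, f z = h z) (i : Fin 2) :
    pd i f y = pd i h y := by
  have : f =ᶠ[𝓝 y] h := Filter.eventuallyEq_of_mem (hU.mem_nhds hy) hfh
  simp [pd, this.fderiv_eq]

theorem pd_eq_zero (hU : IsOpen U) (hy : y ∈ U) (hf : ∀ z ∈ U, f z = 0) (i : Fin 2) :
    pd i f y = 0 := by
  rw [pd_congr hU hy (h := fun _ => 0) hf, pd_const]

theorem differentiableAt_of_contDiffOn (hU : IsOpen U) (hy : y ∈ U) (hf : ContDiffOn ℝ ∞ f U) :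
    DifferentiableAt ℝ f y :=
  (hf.contDiffAt (hU.mem_nhds hy)).differentiableAt (by simp)

theorem contDiffOn_pd (hU : IsOpen U) (hf : ContDiffOn ℝ ∞ f U) (i : Fin 2) :
    ContDiffOn ℝ ∞ (pd i f) U :=
  (hf.fderiv_of_isOpen hU (m := ∞) (by simp)).clm_apply contDiffOn_const

theorem two_le_infty : (2 : WithTop ℕ∞) ≤ ∞ := 
  WithTop.coe_le_coe.2 (le_top : (2 : ℕ∞) ≤ ⊤)

theorem pd_comm (hU : IsOpen U) (hy : y ∈ U) (hf : ContDiffOn ℝ ∞ f U) (i j : Fin 2) :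
    pd i (pd j f) y = pd j (pd i f) y := by
  have hc := hf.contDiffAt (hU.mem_nhds hy)
  have hs : IsSymmSndFDerivAt ℝ f y := hc.isSymmSndFDerivAt (by simpa using two_le_infty)
  have hd : DifferentiableAt ℝ (fderiv ℝ f) y :=
    (hc.fderiv_right (m := 1) (by simpa [one_add_one_eq_two] using two_le_infty)).differentiableAt
      (by simp)
  have key : ∀ i j, pd i (pd j f) y =
      fderiv ℝ (fderiv ℝ f) y (EuclideanSpace.single i 1) (EuclideanSpace.single j 1) := by
    intro i j
    simp only [pd]
    change fderiv ℝ (fun z => fderiv ℝ f z (EuclideanSpace.single j 1)) y _ = _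
    rw [fderiv_clm_apply hd (by fun_prop)]
    simp
  rw [key, key, hs.eq]

end PartialDerivatives

/-! ### Local metrics -/

/-- Components of a smooth Riemannian metric on an open subset of the plane. -/
structure LocalMetric (U : Set Plane) (g : Plane → Mat2) : Prop where
  isOpen : IsOpen U
  symm : ∀ z i j, g z i j = g z j i
  pos : ∀ z ∈ U, 0 < g z 0 0
  det_pos : ∀ z ∈ U, 0 < (g z).det
  smooth : ∀ i j, ContDiffOn ℝ ∞ (fun z => g z i j) U

theorem inv_apply_two (G : Mat2) : G⁻¹ 0 0 = G 1 1 / G.det ∧ G⁻¹ 0 1 = -G 0 1 / G.det ∧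
    G⁻¹ 1 0 = -G 1 0 / G.det ∧ G⁻¹ 1 1 = G 0 0 / G.det := by
  rw [Matrix.inv_def, Matrix.adjugate_fin_two, Ring.inverse_eq_inv]
  simp; ring_nf; simp

theorem inv_symm {G : Mat2} (h : ∀ i j, G i j = G j i) (i j : Fin 2) : G⁻¹ i j = G⁻¹ j i := by
  obtain ⟨h1, h2, h3, h4⟩ := inv_apply_two G
  fin_cases i <;> fin_cases j <;> simp [h2, h3, h 0 1]

theorem sum_inv_mul {G : Mat2} (h : G.det ≠ 0) (i j : Fin 2) :
    ∑ a, G⁻¹ i a * G a j = if i = j then 1 else 0 := by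
  have := congrFun (congrFun (Matrix.nonsing_inv_mul G h.isUnit) i) j
  rwa [Matrix.mul_apply, Matrix.one_apply] at this

theorem sum_mul_inv {G : Mat2} (h : G.det ≠ 0) (i j : Fin 2) :
    ∑ a, G i a * G⁻¹ a j = if i = j then 1 else 0 := by
  have := congrFun (congrFun (Matrix.mul_nonsing_inv G h.isUnit) i) j
  rwa [Matrix.mul_apply, Matrix.one_apply] at this

theorem sum_mul_raise {G : Mat2} (h : G.det ≠ 0) (α : Vec) (i : Fin 2) :
    ∑ a, G i a * raise G α a = α i := by
  have := congrFun (congrArg (fun A => A *ᵥ α) (Matrix.mul_nonsing_inv _ h.isUnit)) i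
  simp only [← Matrix.mulVec_mulVec, Matrix.one_mulVec] at this
  exact this

/-! ### Smoothness of the derived coefficients, and first derivatives of g and g⁻¹. -/

namespace LocalMetric

variable {U : Set Plane} {g : Plane → Mat2} {y : Plane} (hg : LocalMetric U g)
include hg

theorem det_ne (hy : y ∈ U) : (g y).det ≠ 0 := (hg.det_pos y hy).ne'

theorem smooth_det : ContDiffOn ℝ ∞ (fun z => (g z).det) U := by
  simp only [Matrix.det_fin_two]
  exact ((hg.smooth 0 0).mul (hg.smooth 1 1)).sub ((hg.smooth 0 1).mul (hg.smooth 1 0))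

theorem smooth_inv (i j : Fin 2) : ContDiffOn ℝ ∞ (fun z => (g z)⁻¹ i j) U := by
  have hd := hg.smooth_det
  have hn : ∀ z ∈ U, (g z).det ≠ 0 := fun z hz => hg.det_ne hz
  fin_cases i <;> fin_cases j <;> simp only [Fin.zero_eta, Fin.mk_one, inv_apply_two]
  · exact (hg.smooth 1 1).div hd hn
  · exact (hg.smooth 0 1).neg.div hd hn
  · exact (hg.smooth 1 0).neg.div hd hn
  · exact (hg.smooth 0 0).div hd hn

theorem diff_metric (hy : y ∈ U) (i j : Fin 2) : DifferentiableAt ℝ (fun z => g z i j) y :=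
  differentiableAt_of_contDiffOn hg.isOpen hy (hg.smooth i j)

theorem diff_inv (hy : y ∈ U) (i j : Fin 2) : DifferentiableAt ℝ (fun z => (g z)⁻¹ i j) y :=
  differentiableAt_of_contDiffOn hg.isOpen hy (hg.smooth_inv i j)

theorem smooth_christoffel (k i j : Fin 2) : ContDiffOn ℝ ∞ (fun z => christoffel g z k i j) U := by
  unfold christoffel
  exact contDiffOn_const.mul (ContDiffOn.sum fun l _ => (hg.smooth_inv k l).mul
    (((contDiffOn_pd hg.isOpen (hg.smooth j l) i).add
      (contDiffOn_pd hg.isOpen (hg.smooth i l) j)).sub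
      (contDiffOn_pd hg.isOpen (hg.smooth i j) l)))

theorem smooth_raise {φ : Plane → Vec} (hφ : ∀ i, ContDiffOn ℝ ∞ (fun z => φ z i) U)
    (k : Fin 2) : ContDiffOn ℝ ∞ (fun z => raise (g z) (φ z) k) U := by
  unfold raise
  exact ContDiffOn.sum fun l _ => (hg.smooth_inv k l).mul (hφ l)

theorem smooth_weylConn {φ : Plane → Vec} (hφ : ∀ i, ContDiffOn ℝ ∞ (fun z => φ z i) U)
    (k i j : Fin 2) : ContDiffOn ℝ ∞ (fun z => weylConn g φ z k i j) U := by
  unfold weylConn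
  refine (((hg.smooth_christoffel k i j).add ?_).add ?_).sub
    ((hg.smooth i j).mul (hg.smooth_raise hφ k))
  · split_ifs
    exacts [hφ i, contDiffOn_const]
  · split_ifs
    exacts [hφ j, contDiffOn_const]

theorem pd_metric (φ : Plane → Vec) (hy : y ∈ U) (l i j : Fin 2) :
    pd l (fun z => g z i j) y =
      ∑ a, (weylConn g φ y a l i * g y a j + weylConn g φ y a l j * g y i a)
        - 2 * φ y l * g y i j := by
  have := weylConn_metric g φ y hg.symm (hg.det_ne hy).isUnit l i j
  unfold cov2 at this
  linarith

/-- Dual form of D g = -2φ ⊗ g, namely D g⁻¹ = 2φ ⊗ g⁻¹. The form φ is arbitrary, so φ = 0 gives the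
Levi-Civita case. -/
theorem pd_inv (φ : Plane → Vec) (hy : y ∈ U) (l i j : Fin 2) :
    pd l (fun z => (g z)⁻¹ i j) y =
      -∑ a, (weylConn g φ y i l a * (g y)⁻¹ a j + weylConn g φ y j l a * (g y)⁻¹ i a)
        + 2 * φ y l * (g y)⁻¹ i j := by
  set W : Mat2 := Matrix.of fun a i => weylConn g φ y a l i with hW
  set dG : Mat2 := Matrix.of fun i j => pd l (fun z => g z i j) y with hdG
  set dH : Mat2 := Matrix.of fun i j => pd l (fun z => (g z)⁻¹ i j) y with hdH
  have hu := (hg.det_ne hy).isUnit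
  have e1 : dG = Wᵀ * g y + g y * W - (2 * φ y l) • g y := by
    ext i j
    simp only [hdG, hW, Matrix.of_apply, hg.pd_metric φ hy, Matrix.sub_apply, Matrix.add_apply,
      Matrix.mul_apply, Matrix.transpose_apply, Matrix.smul_apply, smul_eq_mul,
      Finset.sum_add_distrib]
    congr 2
    exact Finset.sum_congr rfl fun a _ => by ring
  -- Derivative of g⁻¹ g = 1, an identity valid on all of U.
  have e2 : dH * g y + (g y)⁻¹ * dG = 0 := by
    ext i j
    have h0 : pd l (fun z => ∑ a, (g z)⁻¹ i a * g z a j) y = 0 := by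
      rw [pd_congr hg.isOpen hy (h := fun _ => if i = j then 1 else 0)
        (fun z hz => sum_inv_mul (hg.det_ne hz) i j), pd_const]
    rw [pd_sum (F := fun a z => (g z)⁻¹ i a * g z a j) _
      (fun a _ => (hg.diff_inv hy i a).fun_mul (hg.diff_metric hy a j))] at h0
    simp only [pd_mul (hg.diff_inv hy i _) (hg.diff_metric hy _ j), Finset.sum_add_distrib] at h0
    simpa [hdG, hdH, Matrix.mul_apply] using h0
  have e3 : dH = -((g y)⁻¹ * Wᵀ + W * (g y)⁻¹) + (2 * φ y l) • (g y)⁻¹ := by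
    have h1 : dH = dH * g y * (g y)⁻¹ := by
      rw [Matrix.mul_assoc, Matrix.mul_nonsing_inv _ hu, Matrix.mul_one]
    rw [h1, eq_neg_of_add_eq_zero_left e2, e1]
    simp only [Matrix.mul_add, Matrix.mul_sub, Matrix.add_mul, Matrix.sub_mul, Matrix.neg_mul,
      Matrix.mul_assoc, Matrix.mul_nonsing_inv _ hu, Matrix.mul_one, Matrix.mul_smul,
      Matrix.smul_mul]
    rw [← Matrix.mul_assoc (g y)⁻¹ (g y), Matrix.nonsing_inv_mul _ hu, Matrix.one_mul]
    abel
  have := congrFun (congrFun e3 i) j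
  simp only [hdH, hW, Matrix.of_apply, Matrix.add_apply, Matrix.neg_apply,
      Matrix.mul_apply, Matrix.transpose_apply, Matrix.smul_apply, smul_eq_mul] at this
  rw [this, Finset.sum_add_distrib, add_comm (∑ a, (g y)⁻¹ i a * _)]
  congr 3
  exact Finset.sum_congr rfl fun a _ => by ring

end LocalMetric

/-! ### The Weyl connection -/

/-- Lets statements proved for D be specialised to the Levi-Civita connection. -/
theorem weylConn_zero (g : Plane → Mat2) : weylConn g (fun _ _ => 0) = christoffel g := by
  funext y k i j
  simp [weylConn, raise]

theorem cov3_weylConn (g : Plane → Mat2) (φ : Plane → Vec) (S : Plane → Ten3) (y : Plane)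
    (l i j k : Fin 2) :
    cov3 (weylConn g φ) S y l i j k = cov3 (christoffel g) S y l i j k
      - (3 * φ y l * S y i j k + φ y i * S y l j k + φ y j * S y i l k + φ y k * S y i j l)
      + ∑ a, raise (g y) (φ y) a *
        (g y l i * S y a j k + g y l j * S y i a k + g y l k * S y i j a) := by
  simp only [cov3, weylConn, add_mul, sub_mul, mul_add, ite_mul, zero_mul, Finset.sum_add_distrib,
    Finset.sum_sub_distrib, Finset.sum_ite_eq', Finset.mem_univ, if_true, Fin.sum_univ_two]
  ring

theorem cov2_weylConn (g : Plane → Mat2) (φ : Plane → Vec) (T : Plane → Ten2) (y : Plane)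
    (l i j : Fin 2) :
    cov2 (weylConn g φ) T y l i j = cov2 (christoffel g) T y l i j
      - (2 * φ y l * T y i j + φ y i * T y l j + φ y j * T y i l)
      + ∑ a, raise (g y) (φ y) a * (g y l i * T y a j + g y l j * T y i a) := by
  simp only [cov2, weylConn, add_mul, sub_mul, mul_add, ite_mul, zero_mul, Finset.sum_add_distrib,
    Finset.sum_sub_distrib, Finset.sum_ite_eq', Finset.mem_univ, if_true, Fin.sum_univ_two]
  ring

theorem inv_smul_apply {G : Mat2} {c : ℝ} (hc : c ≠ 0) (hG : G.det ≠ 0) (i j : Fin 2) :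
    (c • G)⁻¹ i j = c⁻¹ * G⁻¹ i j := by
  have : (c • G)⁻¹ = c⁻¹ • G⁻¹ := by
    refine Matrix.inv_eq_left_inv ?_
    rw [Matrix.smul_mul, Matrix.mul_smul, smul_smul, inv_mul_cancel₀ hc, one_smul,
      Matrix.nonsing_inv_mul _ hG.isUnit]
  rw [this]; rfl

/-- Invariance of D. With c = Ω² one has dc/(2c) = d ln|Ω|, and the terms which dc adds to the
Christoffel symbols are exactly those removed by the shift of φ. -/
theorem weylConn_rescale {U : Set Plane} {g g' : Plane → Mat2} {φ φ' : Plane → Vec}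
    {c : Plane → ℝ} {y : Plane} (hg : LocalMetric U g) (hy : y ∈ U)
    (hc : DifferentiableAt ℝ c y) (hc0 : c y ≠ 0) (hg' : ∀ z ∈ U, g' z = c z • g z)
    (hφ : ∀ l, φ' y l = φ y l - pd l c y / (2 * c y)) :
    weylConn g' φ' y = weylConn g φ y := by
  funext k i j
  have hpd : ∀ l i j, pd l (fun z => g' z i j) y =
      pd l c y * g y i j + c y * pd l (fun z => g z i j) y := by
    intro l i j
    rw [pd_congr hg.isOpen hy (h := fun z => c z * g z i j) (fun z hz => by rw [hg' z hz]; rfl),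
      pd_mul hc (hg.diff_metric hy i j)]
  have hinv : ∀ i j, (g' y)⁻¹ i j = (c y)⁻¹ * (g y)⁻¹ i j := by
    intro i j
    rw [hg' y hy, inv_smul_apply hc0 (hg.det_ne hy)]
  have hij : g' y i j = c y * g y i j := by rw [hg' y hy]; rfl
  have hd := sum_inv_mul (hg.det_ne hy)
  have s1 : ∀ i, ∑ l, (g y)⁻¹ k l * g y i l = if k = i then 1 else 0 := by
    intro i
    rw [← hd k i]
    exact Finset.sum_congr rfl fun l _ => by rw [hg.symm y i l]
  -- The classical conformal change of the Christoffel symbols.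
  have e : christoffel g' y k i j = christoffel g y k i j
      + (1 / (2 * c y)) * (pd i c y * (∑ l, (g y)⁻¹ k l * g y j l)
        + pd j c y * (∑ l, (g y)⁻¹ k l * g y i l) - g y i j * ∑ l, (g y)⁻¹ k l * pd l c y) := by
    simp only [christoffel, hpd, hinv, Fin.sum_univ_two]
    field_simp
    ring
  have r : g' y i j * raise (g' y) (φ' y) k = g y i j * raise (g y) (φ y) k
      - (1 / (2 * c y)) * g y i j * ∑ l, (g y)⁻¹ k l * pd l c y := by
    simp only [raise, hφ, hinv, hij, Fin.sum_univ_two]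
    field_simp
    ring
  simp only [weylConn, e, r, s1, hφ]
  split_ifs <;> ring

/-! ### Lowering an index -/

section Lower

variable {U : Set Plane} {g : Plane → Mat2} {y : Plane} {Sh : Plane → Ten3}

theorem LocalMetric.smooth_lower (hg : LocalMetric U g)
    (hSh : ∀ i j k, ContDiffOn ℝ ∞ (fun z => Sh z i j k) U) (i j k : Fin 2) :
    ContDiffOn ℝ ∞ (fun z => lower (g z) (Sh z) i j k) U := by
  unfold lower
  exact ContDiffOn.sum fun a _ => (hg.smooth k a).mul (hSh i j a)

/-- Lowering an index does not commute with D: the term 2φ ⊗ S compensates D g = -2φ ⊗ g. -/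
theorem LocalMetric.lower_cov12 (hg : LocalMetric U g) (φ : Plane → Vec) (hy : y ∈ U)
    (hSh : ∀ i j k, DifferentiableAt ℝ (fun z => Sh z i j k) y) (l i j k : Fin 2) :
    ∑ a, g y k a * cov12 (weylConn g φ) Sh y l i j a =
      cov3 (weylConn g φ) (fun z => lower (g z) (Sh z)) y l i j k
        + 2 * φ y l * lower (g y) (Sh y) i j k := by
  have h0 := hg.diff_metric hy
  have hs := hg.symm y
  have hp : pd l (fun z => lower (g z) (Sh z) i j k) y =
      ∑ a, (pd l (fun z => g z k a) y * Sh y i j a + g y k a * pd l (fun z => Sh z i j a) y) := by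
    unfold lower
    rw [pd_sum (F := fun a z => g z k a * Sh z i j a) _ (fun a _ => (h0 k a).fun_mul (hSh i j a))]
    exact Finset.sum_congr rfl fun a _ => pd_mul (h0 k a) (hSh i j a) l
  simp only [cov3, cov12]
  rw [hp]
  simp only [hg.pd_metric φ hy, lower, Fin.sum_univ_two]
  ring

theorem lower_injective {G : Mat2} (h : G.det ≠ 0) {v w : Vec}
    (hvw : ∀ k, ∑ a, G k a * v a = ∑ a, G k a * w a) : v = w := by
  have h1 : ∀ v : Vec, v = G⁻¹ *ᵥ (G *ᵥ v) := fun v => by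
    rw [Matrix.mulVec_mulVec, Matrix.nonsing_inv_mul _ h.isUnit, Matrix.one_mulVec]
  rw [h1 v, h1 w]
  congr 1
  exact funext hvw

theorem sum_mul_inv_lower {G : Mat2} (h : G.det ≠ 0) (Sh : Ten3) (i j k : Fin 2) :
    ∑ a, G⁻¹ k a * lower G Sh i j a = Sh i j k := by
  have := congrFun (congrArg (fun A => A *ᵥ Sh i j) (Matrix.nonsing_inv_mul _ h.isUnit)) k
  simp only [← Matrix.mulVec_mulVec, Matrix.one_mulVec] at this
  exact this

end Lower

/-! ### Pointwise algebra of trace-free tensors -/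

section Algebra

variable {G : Mat2}

/-- Symmetric and trace-free. -/
def IsSymTraceFree2 (G : Mat2) (X : Ten2) : Prop :=
  (∀ i j, X i j = X j i) ∧ ∑ a, ∑ b, G⁻¹ a b * X a b = 0

/-- The trace condition with the determinant cleared. It makes the component X₁₁ dependent on X₀₀
and X₀₁. -/
theorem IsSymTraceFree2.trace_eq {X : Ten2} (hG : ∀ i j, G i j = G j i) (hd : G.det ≠ 0)
    (hX : IsSymTraceFree2 G X) : G 1 1 * X 0 0 - 2 * G 0 1 * X 0 1 + G 0 0 * X 1 1 = 0 := by
  have h := hX.2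
  obtain ⟨h1, h2, h3, h4⟩ := inv_apply_two G
  simp only [Fin.sum_univ_two, h1, h2, h3, h4, hX.1 1 0, hG 1 0] at h
  field_simp at h
  linarith

theorem IsSymTraceFree3.slice {S : Ten3} (hS : IsSymTraceFree3 G S) (k : Fin 2) :
    IsSymTraceFree2 G (S k) :=
  ⟨fun i j => hS.2.1 k i j, by
    rw [← hS.2.2 k]
    exact Finset.sum_congr rfl fun a _ => Finset.sum_congr rfl fun b _ => by
      rw [hS.1 k a b, hS.2.1 a k b]⟩

theorem raise_eq (G : Mat2) (t : Vec) (a : Fin 2) :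
    raise G t a = G⁻¹ a 0 * t 0 + G⁻¹ a 1 * t 1 := by
  simp [raise, Fin.sum_univ_two]

theorem eq_sum_raise (hd : G.det ≠ 0) (t : Vec) (i : Fin 2) :
    t i = G i 0 * raise G t 0 + G i 1 * raise G t 1 := by
  rw [← sum_mul_raise hd t i, Fin.sum_univ_two]

/-- In dimension two, `t_{(i} S_{jk)l} - g_{(ij} S_{k)lt} = t_l S_{ijk} - g_{l(i} S_{jk)t}`. -/
theorem symTraceFree3_identity (hG : ∀ i j, G i j = G j i) (hd : G.det ≠ 0) {S : Ten3}
    (hS : IsSymTraceFree3 G S) (t : Vec) (l i j k : Fin 2) :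
    t i * S j k l + t j * S k i l + t k * S i j l
      + ∑ a, raise G t a * (G l i * S a j k + G l j * S i a k + G l k * S i j a)
      - ∑ a, raise G t a * (G i j * S k l a + G j k * S i l a + G k i * S j l a)
      = 3 * t l * S i j k := by
  have r0 := (hS.slice 0).trace_eq hG hd
  have r1 := (hS.slice 1).trace_eq hG hd
  have t0 := eq_sum_raise hd t 0
  have t1 := eq_sum_raise hd t 1
  have g10 := hG 1 0
  have s1 := hS.1 1 0 0
  have s2 := hS.2.1 0 1 0
  have s3 := hS.1 1 0 1
  have s4 := hS.2.1 1 1 0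
  -- Once t is written as G V, no inverse matrix is left, and all sixteen component identities are
  -- polynomial consequences of symmetry and the two trace relations.
  generalize raise G t = V at *
  rw [Fin.sum_univ_two, Fin.sum_univ_two]
  fin_cases i <;> fin_cases j <;> fin_cases k <;> fin_cases l <;>
    simp only [Fin.zero_eta, Fin.mk_one] <;> grind

/-- Dimension-two identity for X ⊗ t. With X = Ξ and t replaced by dt, it says that DΞ - ∇Ξ for φ =
dt/3 is -4/3 times the trace-free symmetrisation of Ξ ⊗ dt. -/
theorem symTraceFree2_identity (hG : ∀ i j, G i j = G j i) (hd : G.det ≠ 0) {X : Ten2}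
    (hX : IsSymTraceFree2 G X) (t : Vec) (l i j : Fin 2) :
    2 * t l * X i j - t i * X l j - t j * X i l
      - 3 * ∑ a, raise G t a * (G l i * X a j + G l j * X i a)
      + 2 * ∑ a, raise G t a * (G i j * X l a + G l i * X j a + G j l * X i a) = 0 := by
  have r0 := hX.trace_eq hG hd
  have t0 := eq_sum_raise hd t 0
  have t1 := eq_sum_raise hd t 1
  have g10 := hG 1 0
  have s1 := hX.1 1 0
  generalize raise G t = V at *
  rw [Fin.sum_univ_two, Fin.sum_univ_two]
  fin_cases i <;> fin_cases j <;> fin_cases l <;>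
    simp only [Fin.zero_eta, Fin.mk_one] <;> grind

theorem proj3_add (T T' : Ten3) (i j k : Fin 2) :
    proj3 G (fun i j k => T i j k + T' i j k) i j k = proj3 G T i j k + proj3 G T' i j k := by
  simp only [proj3, sym3Trace, sym3, Fin.sum_univ_two]
  ring

theorem proj3_smul (c : ℝ) (T : Ten3) (i j k : Fin 2) :
    proj3 G (fun i j k => c * T i j k) i j k = c * proj3 G T i j k := by
  simp only [proj3, sym3Trace, sym3, Fin.sum_univ_two]
  ring

theorem proj3_eq_self {S : Ten3} (hS : IsSymTraceFree3 G S) (i j k : Fin 2) :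
    proj3 G S i j k = S i j k := by
  have e : sym3 S = S := by
    funext i j k
    have h1 := hS.1
    have h2 := hS.2.1
    simp only [sym3]
    rw [h1 j i k, h2 i k j, show S j k i = S i j k by rw [h2 j k i, h1 j i k],
      show S k i j = S i j k by rw [h1 k i j, h2 i k j],
      show S k j i = S i j k by rw [h1 k j i, h2 j k i, h1 j i k]]
    ring
  have e2 : ∀ k, sym3Trace G S k = 0 := fun k => by rw [sym3Trace, e, hS.2.2 k]
  rw [proj3, e, e2, e2, e2]
  ring

theorem sum_sum_inv (hG : ∀ i j, G i j = G j i) (hd : G.det ≠ 0) :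
    ∑ a, ∑ b, G⁻¹ a b * G a b = 2 := by
  have := fun i => sum_inv_mul hd i i
  simp only [Fin.sum_univ_two, if_true] at this ⊢
  linear_combination this 0 + this 1 + (G⁻¹ 1 0 - G⁻¹ 0 1) * hG 1 0

/-- The trace of g_{ij}w_k + g_{jk}w_i + g_{ki}w_j is (2 + 1 + 1) w_k, so the coefficient 1/4
removes the whole trace of the symmetrisation. -/
theorem proj3_symTraceFree (hG : ∀ i j, G i j = G j i) (hd : G.det ≠ 0) (T : Ten3) :
    IsSymTraceFree3 G (proj3 G T) := by
  refine ⟨fun i j k => ?_, fun i j k => ?_, fun k => ?_⟩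
  · simp only [proj3, sym3, hG j i, hG k i, hG k j]
    ring
  · simp only [proj3, sym3, hG j i, hG k i, hG k j]
    ring
  · have h1 : ∑ a, ∑ b, G⁻¹ a b * sym3 T a b k = sym3Trace G T k := rfl
    have h2 := sum_sum_inv hG hd
    have h3 : ∑ a, (∑ b, G⁻¹ a b * G b k) * sym3Trace G T a = sym3Trace G T k := by
      simp [sum_inv_mul hd]
    have hs := inv_symm hG 1 0
    simp only [proj3, Fin.sum_univ_two] at *
    simp only [hG k] at *
    rw [hs] at *
    linear_combination h1 - 1 / 4 * sym3Trace G T k * h2 - 1 / 2 * h3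

/-- Since S is trace-free, only the terms in which t meets an index of S contribute to the trace of
the symmetrisation. They give 2/3 t^a S_{kla}, and 1/4 · 2/3 is the coefficient 1/6. -/
theorem proj3_mul (hG : ∀ i j, G i j = G j i) {S : Ten3} (hS : IsSymTraceFree3 G S) (t : Vec)
    (l i j k : Fin 2) :
    proj3 G (fun i j k => t i * S j k l) i j k =
      1 / 3 * (t i * S j k l + t j * S k i l + t k * S i j l)
      - 1 / 6 * ∑ a, raise G t a * (G i j * S k l a + G j k * S i l a + G k i * S j l a) := by
  have hs := inv_symm hG 1 0
  have e : ∀ k, sym3Trace G (fun i j k => t i * S j k l) k = 2 / 3 * ∑ a, raise G t a * S k l a := by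
    intro k
    have h1 := hS.2.2 l
    have h2 := hS.1
    have h3 := hS.2.1
    have c1 : ∀ a b, S a b l = S l a b := fun a b => by rw [h3 a b l, h2 a l b]
    have c2 : ∀ a b, S a l b = S l a b := fun a b => by rw [h2 a l b]
    have c3 : S l 1 0 = S l 0 1 := h3 l 1 0
    have c4 : ∀ a, S l k a = S l a k := fun a => h3 l k a
    simp only [c1, c3, Fin.sum_univ_two] at h1
    simp only [sym3Trace, sym3, raise_eq, Fin.sum_univ_two, c1, c2, c3, c4, hs] at h1 ⊢
    linear_combination 1 / 3 * t k * h1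
  rw [proj3, e, e, e]
  simp only [sym3, Fin.sum_univ_two, hS.2.1 k j l, hS.2.1 i k l, hS.1 j i l, hS.1 k i l]
  have c : S k l j = S j k l := by rw [hS.2.1 k l j, hS.1 k j l]
  linear_combination 1 / 6 * t i * c

theorem proj3_mul_symTraceFree2 (hG : ∀ i j, G i j = G j i) {X : Ten2}
    (hX : IsSymTraceFree2 G X) (t : Vec) (i j k : Fin 2) :
    proj3 G (fun i j k => X j k * t i) i j k =
      1 / 3 * (t i * X j k + t j * X k i + t k * X i j)
      - 1 / 6 * ∑ a, raise G t a * (G i j * X k a + G j k * X i a + G k i * X j a) := by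
  have hs := inv_symm hG 1 0
  have hx := hX.1
  have e : ∀ k, sym3Trace G (fun i j k => X j k * t i) k = 2 / 3 * ∑ a, raise G t a * X k a := by
    intro k
    have h1 := hX.2
    simp only [sym3Trace, sym3, raise_eq, Fin.sum_univ_two, hs, hx 1 0, hx k] at h1 ⊢
    linear_combination 1 / 3 * t k * h1
  rw [proj3, e, e, e]
  simp only [sym3, Fin.sum_univ_two, hx k j, hx i k, hx j i]
  ring

end Algebra

/-! ### Comparison of the two systems at a point -/

section Comparison

variable {U : Set Plane} {g : Plane → Mat2} {φ : Plane → Vec} {Sh : Plane → Ten3} {t : Plane → ℝ}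
  {y : Plane}

theorem raise_smul {G : Mat2} {α β : Vec} {c : ℝ} (h : ∀ i, α i = c * β i) (a : Fin 2) :
    raise G α a = c * raise G β a := by
  simp only [raise_eq, h]; ring

/-- After lowering, the Weyl equation and the structural equation differ by a multiple of
`symTraceFree3_identity`, which is where total symmetry, trace-freeness and φ = dt/3 enter. -/
theorem LocalMetric.eqS_iff (hg : LocalMetric U g) (hy : y ∈ U)
    (hSh : ∀ i j k, DifferentiableAt ℝ (fun z => Sh z i j k) y)
    (hS : IsSymTraceFree3 (g y) (lower (g y) (Sh y))) (hφ : ∀ i, φ y i = 1 / 3 * diff t y i) :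
    (∀ l i j k, cov12 (weylConn g φ) Sh y l i j k =
      zTensor g (fun z => lower (g z) (Sh z)) t y i j l k) ↔
    ∀ l i j k, cov3 (christoffel g) (fun z => lower (g z) (Sh z)) y l i j k =
      proj3 (g y) (fun i j k => -(2 / 3) * lower (g y) (Sh y) i j k * diff t y l
        + 2 * diff t y i * lower (g y) (Sh y) j k l
        + Xi g (fun z => lower (g z) (Sh z)) t y i j * g y k l) i j k := by
  have hd := hg.det_ne hy
  have hG := hg.symm y
  set S : Plane → Ten3 := fun z => lower (g z) (Sh z) with hSdef
  have hS' : IsSymTraceFree3 (g y) (S y) := hS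
  have key : ∀ l i j k, ∑ a, g y k a * cov12 (weylConn g φ) Sh y l i j a
      - ∑ a, g y k a * zTensor g S t y i j l a = cov3 (christoffel g) S y l i j k -
      proj3 (g y) (fun i j k => -(2 / 3) * S y i j k * diff t y l
        + 2 * diff t y i * S y j k l + Xi g S t y i j * g y k l) i j k := by
    intro l i j k
    have hz : ∑ a, g y k a * zTensor g S t y i j l a =
        proj3 (g y) (fun i j k => Xi g S t y i j * g y k l) i j k := by
      have := congrFun (congrArg (fun A => A *ᵥ
        (proj3 (g y) (fun i j k => Xi g S t y i j * g y k l) i j)) (Matrix.mul_nonsing_inv _ hd.isUnit)) k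
      simp only [← Matrix.mulVec_mulVec, Matrix.one_mulVec] at this
      exact this
    have hp : proj3 (g y) (fun i j k => -(2 / 3) * S y i j k * diff t y l
        + 2 * diff t y i * S y j k l + Xi g S t y i j * g y k l) i j k =
        -(2 / 3) * diff t y l * S y i j k
        + 2 * proj3 (g y) (fun i j k => diff t y i * S y j k l) i j k
        + proj3 (g y) (fun i j k => Xi g S t y i j * g y k l) i j k := by
      rw [proj3_add, proj3_add, ← proj3_smul, ← proj3_eq_self hS' i j k, ← proj3_smul]
      congr 3
      · funext i j k; ring
      · funext i j k; ring
    have id := symTraceFree3_identity hG hd hS' (diff t y) l i j k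
    have hl : ∑ a, g y k a * cov12 (weylConn g φ) Sh y l i j a =
        cov3 (weylConn g φ) S y l i j k + 2 * φ y l * S y i j k := hg.lower_cov12 φ hy hSh l i j k
    rw [hl, cov3_weylConn, hz, hp, proj3_mul hG hS']
    simp only [hφ, raise_smul hφ, Fin.sum_univ_two] at id ⊢
    have c1 : S y l j k = S y j k l := by rw [hS'.1 l j k, hS'.2.1 j l k]
    have c2 : S y i l k = S y k i l := by rw [hS'.2.1 i l k, hS'.1 i k l]
    rw [c1, c2]
    linear_combination 1 / 3 * id
  constructor
  · intro h l i j k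
    have := key l i j k
    simp only [h, sub_self] at this
    linarith
  · intro h l i j
    refine fun k => congrFun (lower_injective hd (fun k => ?_)) k
    have := key l i j k
    rw [h, sub_self] at this
    linarith

theorem proj2_congr (G : Mat2) {T T' : Ten2} (h : ∀ i j, T i j = T' i j) :
    proj2 G T = proj2 G T' := by
  rw [show T = T' from funext fun i => funext fun j => h i j]

/-- The correction terms between D and ∇ combine with the projection of Ξ ⊗ dt into a multiple of
`symTraceFree2_identity`. -/
theorem LocalMetric.eqXi_iff (hg : LocalMetric U g) (hy : y ∈ U) {S : Plane → Ten3}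
    (hS : IsSymTraceFree3 (g y) (S y)) (hX : IsSymTraceFree2 (g y) (Xi g S t y))
    (hφ : ∀ i, φ y i = 1 / 3 * diff t y i) :
    (∀ l i j, cov2 (weylConn g φ) (Xi g S t) y l i j =
      normSq3 (g y) (S y) / 3 * S y l i j + 4 / 3 * bTensor g S t y i j l) ↔
    ∀ k i j, cov2 (christoffel g) (Xi g S t) y k i j =
      1 / 3 * S y i j k * normSq3 (g y) (S y)
        + 4 / 3 * proj3 (g y) (fun i j k => Xi g S t y j k * diff t y i) i j k
        + 4 / 3 * proj2 (g y) (fun i j => g y j k * beta g S t y i) i j := by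
  have hd := hg.det_ne hy
  have hG := hg.symm y
  refine forall_congr' fun l => forall_congr' fun i => forall_congr' fun j => ?_
  have hb : bTensor g S t y i j l = proj2 (g y) (fun i j => g y j l * beta g S t y i) i j := by
    unfold bTensor
    rw [proj2_congr]
    exact fun i j => mul_comm _ _
  have id := symTraceFree2_identity hG hd hX (diff t y) l i j
  have c : S y l i j = S y i j l := by rw [hS.1 l i j, hS.2.1 i l j]
  rw [cov2_weylConn, proj3_mul_symTraceFree2 hG hX, hb, c]
  simp only [hφ, raise_smul hφ, Fin.sum_univ_two] at id ⊢
  rw [hX.1 l j] at *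
  rw [hG j l] at *
  constructor <;> intro h
  · linear_combination h + 1 / 9 * id - 4 / 9 * diff t y j * hX.1 l i
  · linear_combination h - 1 / 9 * id + 4 / 9 * diff t y j * hX.1 l i

/-- Substituting the definition of τ makes the trace-free part of the Hessian equation empty; what
remains is a multiple of g. -/
theorem LocalMetric.eqL_iff (hg : LocalMetric U g) (hy : y ∈ U) (S : Plane → Ten3) :
    L2D g t y = 1 / 3 * normSq3 (g y) (S y) ↔
    ∀ i j, hess g t y i j =
      3 / 2 * (tau g S t y i j + 2 / 3 * contr1 (g y) (S y) (diff t y) i j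
        + 8 / 9 * proj2 (g y) (fun i j => diff t y i * diff t y j) i j
        - 1 / 3 * Xi g S t y i j)
      + 1 / 2 * g y i j * (1 / 3 * normSq3 (g y) (S y) + 3 / 2 * scal g y) := by
  have key : ∀ i j, 3 / 2 * (tau g S t y i j + 2 / 3 * contr1 (g y) (S y) (diff t y) i j
        + 8 / 9 * proj2 (g y) (fun i j => diff t y i * diff t y j) i j
        - 1 / 3 * Xi g S t y i j)
      + 1 / 2 * g y i j * (1 / 3 * normSq3 (g y) (S y) + 3 / 2 * scal g y) - hess g t y i j =
      1 / 2 * g y i j * (1 / 3 * normSq3 (g y) (S y) - L2D g t y) := by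
    intro i j
    simp only [tau, proj2, L2D, raise, Fin.sum_univ_two]
    ring
  constructor
  · intro h i j
    have := key i j
    rw [h] at this
    linarith
  · intro h
    -- One component suffices, because g₀₀ > 0.
    have := key 0 0
    rw [← h, sub_self] at this
    have h0 := hg.pos y hy
    rcases mul_eq_zero.1 this.symm with h1 | h1
    · linarith
    · linarith

end Comparison

/-! ### Traces and covariant derivatives -/

section Traces

variable {U : Set Plane} {g : Plane → Mat2} {φ : Plane → Vec} {y : Plane}

theorem LocalMetric.pd_trace2 (hg : LocalMetric U g) (φ : Plane → Vec) (hy : y ∈ U)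
    {T : Plane → Ten2} (hT : ∀ i j, DifferentiableAt ℝ (fun z => T z i j) y) (l : Fin 2) :
    pd l (fun z => ∑ a, ∑ b, (g z)⁻¹ a b * T z a b) y =
      ∑ a, ∑ b, (g y)⁻¹ a b * (cov2 (weylConn g φ) T y l a b + 2 * φ y l * T y a b) := by
  have h0 := hg.diff_inv hy
  have h1 : ∀ a b, DifferentiableAt ℝ (fun z => (g z)⁻¹ a b * T z a b) y :=
    fun a b => (h0 a b).fun_mul (hT a b)
  simp only [Fin.sum_univ_two]
  rw [pd_add ((h1 0 0).fun_add (h1 0 1)) ((h1 1 0).fun_add (h1 1 1)), pd_add (h1 0 0) (h1 0 1),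
    pd_add (h1 1 0) (h1 1 1)]
  simp only [pd_mul (h0 _ _) (hT _ _), hg.pd_inv φ hy, cov2, Fin.sum_univ_two]
  ring

/-- The extra 2φ ⊗ T comes from D g⁻¹ = 2φ ⊗ g⁻¹. It is the same term as in
`LocalMetric.lower_cov12`, so a trace of S is D-parallel as soon as the corresponding trace of the
lowered DŜ vanishes. -/
theorem LocalMetric.cov1_trace3 (hg : LocalMetric U g) (φ : Plane → Vec) (hy : y ∈ U)
    {T : Plane → Ten3} (hT : ∀ i j k, DifferentiableAt ℝ (fun z => T z i j k) y) (l k : Fin 2) :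
    cov1 (weylConn g φ) (fun z k => ∑ a, ∑ b, (g z)⁻¹ a b * T z a b k) y l k =
      ∑ a, ∑ b, (g y)⁻¹ a b * (cov3 (weylConn g φ) T y l a b k + 2 * φ y l * T y a b k) := by
  have := hg.pd_trace2 φ hy (T := fun z a b => T z a b k) (fun i j => hT i j k) l
  simp only [cov1]
  rw [this]
  simp only [cov2, cov3, Fin.sum_univ_two]
  ring

theorem LocalMetric.smooth_trace3 (hg : LocalMetric U g)
    {T : Plane → Ten3} (hT : ∀ i j k, ContDiffOn ℝ ∞ (fun z => T z i j k) U) (k : Fin 2) :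
    ContDiffOn ℝ ∞ (fun z => ∑ a, ∑ b, (g z)⁻¹ a b * T z a b k) U :=
  ContDiffOn.sum fun a _ => ContDiffOn.sum fun b _ => (hg.smooth_inv a b).mul (hT a b k)

/-- Index symmetries and traces are preserved by ∇ because ∇g = 0. The hypothesis is needed on the
open set U, since it is differentiated. -/
theorem cov3_symTraceFree (hg : LocalMetric U g) (hy : y ∈ U) {S : Plane → Ten3}
    (hS : ∀ z ∈ U, IsSymTraceFree3 (g z) (S z))
    (hd : ∀ i j k, DifferentiableAt ℝ (fun z => S z i j k) y) (l : Fin 2) :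
    IsSymTraceFree3 (g y) (cov3 (christoffel g) S y l) := by
  refine ⟨fun i j k => ?_, fun i j k => ?_, fun k => ?_⟩
  · have := pd_congr hg.isOpen hy (fun z hz => (hS z hz).1 i j k) l
    have h := (hS y hy).1
    simp only [cov3, Fin.sum_univ_two, h j _ k, h _ i k, h j i _] at this ⊢
    rw [this]
    simp only [h _ j k, h i _ k]
    ring
  · have := pd_congr hg.isOpen hy (fun z hz => (hS z hz).2.1 i j k) l
    have h := (hS y hy).2.1
    simp only [cov3, Fin.sum_univ_two, h i k _, h i _ j, h _ k j] at this ⊢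
    rw [this]
    simp only [h i _ k, h i j _]
    ring
  · have h1 := hg.cov1_trace3 (fun _ _ => 0) hy hd l k
    simp only [weylConn_zero] at h1
    have h2 : ∀ k, pd l (fun z => ∑ a, ∑ b, (g z)⁻¹ a b * S z a b k) y = 0 :=
      fun k => pd_eq_zero hg.isOpen hy (fun z hz => (hS z hz).2.2 k) l
    simp only [cov1, h2, (hS y hy).2.2, mul_zero, zero_mul, add_zero, Finset.sum_const_zero,
      sub_self] at h1
    exact h1.symm

theorem LocalMetric.Xi_symTraceFree (hg : LocalMetric U g) (hy : y ∈ U) {S : Plane → Ten3}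
    (hS : ∀ z ∈ U, IsSymTraceFree3 (g z) (S z))
    (hd : ∀ i j k, DifferentiableAt ℝ (fun z => S z i j k) y) (t : Plane → ℝ) :
    IsSymTraceFree2 (g y) (Xi g S t y) := by
  have h := cov3_symTraceFree hg hy hS hd
  have hs := hS y hy
  have c : ∀ l, ∑ a, ∑ b, (g y)⁻¹ a b * cov3 (christoffel g) S y l 0 a b = 0 :=
    fun l => ((h l).slice 0).2
  have c' : ∀ l, ∑ a, ∑ b, (g y)⁻¹ a b * cov3 (christoffel g) S y l 1 a b = 0 :=
    fun l => ((h l).slice 1).2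
  constructor
  · intro i j
    simp only [Xi, contr1, fun l a => (h l).2.1 a i j, hs.1 i j]
  · have r0 := hs.2.2 0
    have r1 := hs.2.2 1
    have c0 := c 0
    have c1 := c 1
    have c0' := c' 0
    have c1' := c' 1
    simp only [Xi, contr1, Fin.sum_univ_two] at *
    linear_combination (g y)⁻¹ 0 0 * c0 + (g y)⁻¹ 0 1 * c1 + (g y)⁻¹ 1 0 * c0' +
      (g y)⁻¹ 1 1 * c1' + 2 / 3 * raise (g y) (diff t y) 0 * r0
      + 2 / 3 * raise (g y) (diff t y) 1 * r1

/-- Exhibits Ξ as the divergence of Ŝ for the Weyl connection with form dt/3: the connection terms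
collapse by trace-freeness to 2/3 S_{ija} t^a. Only D and Ŝ enter the right side, which is why Ξ is
conformally invariant. -/
theorem LocalMetric.Xi_eq_divergence (hg : LocalMetric U g) (hy : y ∈ U) {Sh : Plane → Ten3}
    (hS : ∀ z ∈ U, IsSymTraceFree3 (g z) (lower (g z) (Sh z)))
    (hd : ∀ i j k, DifferentiableAt ℝ (fun z => Sh z i j k) y) (t : Plane → ℝ) (i j : Fin 2) :
    Xi g (fun z => lower (g z) (Sh z)) t y i j =
      ∑ a, cov12 (weylConn g (fun z i => 1 / 3 * diff t z i)) Sh y a i j a := by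
  have hdet := hg.det_ne hy
  have hG := hg.symm y
  have hl : ∀ i j k, DifferentiableAt ℝ (fun z => lower (g z) (Sh z) i j k) y := by
    intro i j k
    unfold lower
    exact DifferentiableAt.fun_sum fun a _ => (hg.diff_metric hy k a).fun_mul (hd i j a)
  have hlow := hg.lower_cov12 (fun z i => 1 / 3 * diff t z i) hy hd
  have hs : IsSymTraceFree3 (g y) (lower (g y) (Sh y)) := hS y hy
  have hc := cov3_symTraceFree hg hy hS hl
  have e : ∀ a, cov12 (weylConn g (fun z i => 1 / 3 * diff t z i)) Sh y a i j a =
      ∑ b, (g y)⁻¹ a b * ∑ c, g y b c *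
        cov12 (weylConn g (fun z i => 1 / 3 * diff t z i)) Sh y a i j c :=
    fun a => (sum_mul_inv_lower hdet
      (cov12 (weylConn g (fun z i => 1 / 3 * diff t z i)) Sh y a) i j a).symm
  simp only [hlow, cov3_weylConn] at e
  simp only [e]
  set S : Plane → Ten3 := fun z => lower (g z) (Sh z) with hSdef
  have hs' : IsSymTraceFree3 (g y) (S y) := hs
  change _ = ∑ a, ∑ b, (g y)⁻¹ a b * (cov3 (christoffel g) S y a i j b -
    (3 * (1 / 3 * diff t y a) * S y i j b + 1 / 3 * diff t y i * S y a j b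
      + 1 / 3 * diff t y j * S y i a b + 1 / 3 * diff t y b * S y i j a)
    + ∑ c, raise (g y) (fun i => 1 / 3 * diff t y i) c * (g y a i * S y c j b +
        g y a j * S y i c b + g y a b * S y i j c) + 2 * (1 / 3 * diff t y a) * S y i j b)
  have hr := raise_smul (G := g y) (α := fun i => 1 / 3 * diff t y i) (β := diff t y) (c := 1 / 3)
    (fun _ => rfl)
  have k1 : ∀ a b, cov3 (christoffel g) S y b a i j = cov3 (christoffel g) S y b i j a := by
    intro a b
    rw [(hc b).1 a i j, (hc b).2.1 i a j]
  have s1 := (hs'.slice i).2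
  have s2 := (hs'.slice j).2
  have m := sum_sum_inv hG hdet
  have m1 : ∀ c, ∑ a, ∑ b, (g y)⁻¹ a b * g y a i * S y c j b = S y c j i := by
    intro c
    have h2 := sum_inv_mul hdet 0 i
    have h3 := sum_inv_mul hdet 1 i
    have h4 : S y c j i = (if 0 = i then 1 else 0) * S y c j 0 + (if 1 = i then 1 else 0) * S y c j 1 := by
      fin_cases i <;> simp
    rw [h4, ← h2, ← h3]
    simp only [Fin.sum_univ_two, inv_symm hG 1 0]
    ring
  have m2 : ∀ c, ∑ a, ∑ b, (g y)⁻¹ a b * g y a j * S y i c b = S y i c j := by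
    intro c
    have h2 := sum_inv_mul hdet 0 j
    have h3 := sum_inv_mul hdet 1 j
    have h4 : S y i c j = (if 0 = j then 1 else 0) * S y i c 0 + (if 1 = j then 1 else 0) * S y i c 1 := by
      fin_cases j <;> simp
    rw [h4, ← h2, ← h3]
    simp only [Fin.sum_univ_two, inv_symm hG 1 0]
    ring
  have p1 : ∀ a b, S y a j b = S y j a b := fun a b => hs'.1 a j b
  have p2 : ∀ c, S y c j i = S y i j c := fun c => by rw [hs'.2.1 c j i, hs'.1 c i j, hs'.2.1 i c j]
  have p3 : ∀ c, S y i c j = S y i j c := fun c => hs'.2.1 i c j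
  have hi := inv_symm hG 1 0
  simp only [p2, p3] at m1 m2
  have m10 := m1 0
  have m11 := m1 1
  have m20 := m2 0
  have m21 := m2 1
  have v0 := raise_eq (g y) (diff t y) 0
  have v1 := raise_eq (g y) (diff t y) 1
  simp only [Xi, contr1, k1, hr, Fin.sum_univ_two, p1, hi] at v1 s1 s2 m m10 m11 m20 m21 ⊢
  linear_combination 1 / 3 * diff t y i * s2 + 1 / 3 * diff t y j * s1
    - 2 / 3 * S y j i 0 * v0 - 2 / 3 * S y j i 1 * v1
    - 1 / 3 * raise (g y) (diff t y) 0 * (m10 + m20 + S y j i 0 * m)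
    - 1 / 3 * raise (g y) (diff t y) 1 * (m11 + m21 + S y j i 1 * m)

/-- A tensor of rank three in dimension two, all of whose traces vanish, is totally symmetric. -/
theorem isSymTraceFree3_of_traces {G : Mat2} (hG : ∀ i j, G i j = G j i) (hd : G.det ≠ 0)
    {T : Ten3} (h1 : ∀ k, ∑ a, ∑ b, G⁻¹ a b * T a b k = 0)
    (h2 : ∀ k, ∑ a, ∑ b, G⁻¹ a b * T a k b = 0) (h3 : ∀ k, ∑ a, ∑ b, G⁻¹ a b * T k a b = 0) :
    IsSymTraceFree3 G T := by
  have hs := inv_symm hG 1 0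
  have inj : ∀ w : Vec, (∀ a, ∑ b, G⁻¹ a b * w b = 0) → w = 0 := by
    intro w hw
    have h0 : G⁻¹ *ᵥ w = 0 := funext hw
    have := congrArg (fun v => G *ᵥ v) h0
    simpa only [Matrix.mulVec_mulVec, Matrix.mul_nonsing_inv _ hd.isUnit, Matrix.one_mulVec,
      Matrix.mulVec_zero] using this
  -- In dimension two the part of T skew in its first two slots is a covector w. A difference of two
  -- traces is, up to sign, a component of w raised by g⁻¹, so w vanishes.
  have w1 : (fun k => T 0 1 k - T 1 0 k) = 0 := by
    refine inj _ fun a => ?_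
    simp only [Fin.sum_univ_two, Fin.forall_fin_two, hs] at h2 h3 ⊢
    fin_cases a
    · simp only [Fin.zero_eta]
      linear_combination h2.2 - h3.2
    · simp only [Fin.mk_one, hs]
      linear_combination h3.1 - h2.1
  have w2 : (fun k => T k 0 1 - T k 1 0) = 0 := by
    refine inj _ fun a => ?_
    simp only [Fin.sum_univ_two, Fin.forall_fin_two, hs] at h1 h2 ⊢
    fin_cases a
    · simp only [Fin.zero_eta]
      linear_combination h1.2 - h2.2
    · simp only [Fin.mk_one, hs]
      linear_combination h2.1 - h1.1
  have v1 : ∀ k, T 0 1 k = T 1 0 k := fun k => sub_eq_zero.1 (congrFun w1 k)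
  have v2 : ∀ k, T k 0 1 = T k 1 0 := fun k => sub_eq_zero.1 (congrFun w2 k)
  refine ⟨fun i j k => ?_, fun i j k => ?_, h1⟩
  · fin_cases i <;> fin_cases j <;> simp [v1]
  · fin_cases j <;> fin_cases k <;> simp [v2]

end Traces

/-! ### Curvature -/

section Curvature

variable {U : Set Plane} {g : Plane → Mat2} {φ : Plane → Vec} {Γ : Plane → Ten3} {y : Plane}

theorem pd_cov1 (hU : IsOpen U) (hy : y ∈ U)
    (hΓ : ∀ k i j, ContDiffOn ℝ ∞ (fun z => Γ z k i j) U)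
    {α : Plane → Vec} (hα : ∀ i, ContDiffOn ℝ ∞ (fun z => α z i) U) (i j k : Fin 2) :
    pd i (fun z => cov1 Γ α z j k) y = pd i (pd j fun z => α z k) y
      - ∑ a, (pd i (fun z => Γ z a j k) y * α y a + Γ y a j k * pd i (fun z => α z a) y) := by
  have d1 : ∀ a, DifferentiableAt ℝ (fun z => Γ z a j k) y :=
    fun a => differentiableAt_of_contDiffOn hU hy (hΓ a j k)
  have d2 : ∀ a, DifferentiableAt ℝ (fun z => α z a) y :=
    fun a => differentiableAt_of_contDiffOn hU hy (hα a)
  have d3 : DifferentiableAt ℝ (pd j fun z => α z k) y :=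
    differentiableAt_of_contDiffOn hU hy (contDiffOn_pd hU (hα k) j)
  have d4 : ∀ a, DifferentiableAt ℝ (fun z => Γ z a j k * α z a) y := fun a => (d1 a).fun_mul (d2 a)
  unfold cov1
  rw [pd_sub (f := pd j fun z => α z k) d3 (DifferentiableAt.fun_sum fun a _ => d4 a),
    pd_sum (F := fun a z => Γ z a j k * α z a) _ (fun a _ => d4 a)]
  simp only [pd_mul (d1 _) (d2 _)]

/-- The Ricci identity for covectors. -/
theorem ricci_identity (hU : IsOpen U) (hy : y ∈ U)
    (hΓ : ∀ k i j, ContDiffOn ℝ ∞ (fun z => Γ z k i j) U) (hs : ∀ k i j, Γ y k i j = Γ y k j i)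
    {α : Plane → Vec} (hα : ∀ i, ContDiffOn ℝ ∞ (fun z => α z i) U) (i j k : Fin 2) :
    cov2 Γ (cov1 Γ α) y i j k - cov2 Γ (cov1 Γ α) y j i k = -∑ l, curv Γ y l k i j * α y l := by
  have hc := pd_comm hU hy (hα k) i j
  simp only [cov2, pd_cov1 hU hy hΓ hα, hc]
  simp only [curv, cov1, Fin.sum_univ_two, hs _ j i]
  ring

/-- The second covariant derivatives of a covector parallel on U vanish, so the Ricci identity
leaves only the curvature term. -/
theorem curv_apply_parallel (hU : IsOpen U) (hy : y ∈ U)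
    (hΓ : ∀ k i j, ContDiffOn ℝ ∞ (fun z => Γ z k i j) U) (hs : ∀ k i j, Γ y k i j = Γ y k j i)
    {α : Plane → Vec} (hα : ∀ i, ContDiffOn ℝ ∞ (fun z => α z i) U)
    (hp : ∀ z ∈ U, ∀ l i, cov1 Γ α z l i = 0) (i j k : Fin 2) :
    ∑ l, curv Γ y l k i j * α y l = 0 := by
  have h := ricci_identity hU hy hΓ hs hα i j k
  have e : ∀ i j k, cov2 Γ (cov1 Γ α) y i j k = 0 := by
    intro i j k
    simp [cov2, hp y hy, pd_eq_zero hU hy (fun z hz => hp z hz j k)]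
  rw [e, e] at h
  linarith

/-- Commuting the second derivatives of g. As D g = -2φ ⊗ g, the symmetric part of the lowered
curvature is proportional to dφ ⊗ g, and φ is closed. -/
theorem curv_lower_antisymm (hg : LocalMetric U g) (hy : y ∈ U)
    (hφ : ∀ i, ContDiffOn ℝ ∞ (fun z => φ z i) U)
    (hc : ∀ i j, pd i (fun z => φ z j) y = pd j (fun z => φ z i) y) (i j k l : Fin 2) :
    ∑ a, (curv (weylConn g φ) y a i k l * g y a j + curv (weylConn g φ) y a j k l * g y i a)
      = 0 := by
  have hU := hg.isOpen
  have dφ : ∀ i, DifferentiableAt ℝ (fun z => φ z i) y :=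
    fun i => differentiableAt_of_contDiffOn hU hy (hφ i)
  have dW : ∀ k i j, DifferentiableAt ℝ (fun z => weylConn g φ z k i j) y :=
    fun k i j => differentiableAt_of_contDiffOn hU hy (hg.smooth_weylConn hφ k i j)
  have dg := hg.diff_metric hy
  have e : ∀ k l, pd k (pd l fun z => g z i j) y =
      ∑ a, (pd k (fun z => weylConn g φ z a l i) y * g y a j
        + weylConn g φ y a l i * pd k (fun z => g z a j) y
        + (pd k (fun z => weylConn g φ z a l j) y * g y i a
        + weylConn g φ y a l j * pd k (fun z => g z i a) y))
      - 2 * (pd k (fun z => φ z l) y * g y i j + φ y l * pd k (fun z => g z i j) y) := by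
    intro k l
    have d1 : ∀ a, DifferentiableAt ℝ
        (fun z => weylConn g φ z a l i * g z a j + weylConn g φ z a l j * g z i a) y :=
      fun a => ((dW a l i).fun_mul (dg a j)).fun_add ((dW a l j).fun_mul (dg i a))
    rw [pd_congr hU hy (h := fun z =>
      ∑ a, (weylConn g φ z a l i * g z a j + weylConn g φ z a l j * g z i a)
        - 2 * (φ z l * g z i j)) (fun z hz => by rw [hg.pd_metric φ hz]; ring),
      pd_sub (DifferentiableAt.fun_sum fun a _ => d1 a) (((dφ l).fun_mul (dg i j)).const_mul 2),
      pd_const_mul 2 ((dφ l).fun_mul (dg i j)), pd_mul (dφ l) (dg i j),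
      pd_sum (F := fun a z => weylConn g φ z a l i * g z a j + weylConn g φ z a l j * g z i a) _
        (fun a _ => d1 a)]
    congr 1
    refine Finset.sum_congr rfl fun a _ => ?_
    rw [pd_add ((dW a l i).fun_mul (dg a j)) ((dW a l j).fun_mul (dg i a)),
      pd_mul (dW a l i) (dg a j), pd_mul (dW a l j) (dg i a)]
  have h := pd_comm hU hy (hg.smooth i j) k l
  rw [e, e, hc k l] at h
  simp only [hg.pd_metric φ hy, curv, Fin.sum_univ_two] at h ⊢
  linear_combination h

/-- In dimension two the curvature has a single component. -/
theorem curv_eq (hg : LocalMetric U g) (hy : y ∈ U)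
    (hφ : ∀ i, ContDiffOn ℝ ∞ (fun z => φ z i) U)
    (hc : ∀ i j, pd i (fun z => φ z j) y = pd j (fun z => φ z i) y) :
    ∃ κ : ℝ, ∀ l, curv (weylConn g φ) y l 0 0 1 = -κ * (g y)⁻¹ l 1 ∧
      curv (weylConn g φ) y l 1 0 1 = κ * (g y)⁻¹ l 0 := by
  have h := curv_lower_antisymm hg hy hφ hc
  have h00 := h 0 0 0 1
  have h11 := h 1 1 0 1
  have h01 := h 0 1 0 1
  have hs := hg.symm y 1 0
  have hd := hg.det_ne hy
  simp only [Fin.sum_univ_two, hs] at h00 h11 h01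
  -- The witness is the lowered component R₀₁₀₁. Skewness determines the others, and raising the
  -- first index gives both formulas.
  refine ⟨g y 0 0 * curv (weylConn g φ) y 0 1 0 1 + g y 0 1 * curv (weylConn g φ) y 1 1 0 1,
    fun l => ?_⟩
  obtain ⟨i1, i2, i3, i4⟩ := inv_apply_two (g y)
  have hdet : (g y).det = g y 0 0 * g y 1 1 - g y 0 1 * g y 0 1 := by
    rw [Matrix.det_fin_two, hs]
  fin_cases l <;> simp only [Fin.zero_eta, Fin.mk_one, i1, i2, i3, i4, hs] <;>
    constructor <;> field_simp <;> rw [hdet] <;> grind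

/-- The scalar curvature and the Ricci tensor in terms of the single curvature component. -/
theorem LocalMetric.sum_inv_ricci (hg : LocalMetric U g) (hy : y ∈ U) {κ : ℝ}
    (hκ : ∀ l, curv Γ y l 0 0 1 = -κ * (g y)⁻¹ l 1 ∧ curv Γ y l 1 0 1 = κ * (g y)⁻¹ l 0) :
    ∑ j, ∑ k, (g y)⁻¹ j k * ∑ i, curv Γ y i k i j = 2 * κ / (g y).det := by
  have anti : ∀ l k, curv Γ y l k 1 0 = -curv Γ y l k 0 1 := by
    intro l k; simp only [curv, Fin.sum_univ_two]; ring
  have diag : ∀ l k i, curv Γ y l k i i = 0 := by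
    intro l k i; simp only [curv, Fin.sum_univ_two]; ring
  have hs := hg.symm y 1 0
  have hd := hg.det_ne hy
  obtain ⟨i1, i2, i3, i4⟩ := inv_apply_two (g y)
  have hdet : (g y).det = g y 0 0 * g y 1 1 - g y 0 1 * g y 0 1 := by
    rw [Matrix.det_fin_two, hs]
  simp only [Fin.sum_univ_two, anti, diag, (hκ _).1, (hκ _).2, i1, i2, i3, i4, hs]
  field_simp
  rw [hdet]
  ring

/-- `𝓛^{2D}` is, up to a factor, the scalar curvature of the Weyl connection. -/
theorem LocalMetric.L2D_eq (hg : LocalMetric U g) (hy : y ∈ U) {t : Plane → ℝ}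
    (ht : ContDiffOn ℝ ∞ t U) :
    L2D g t y = -(3 / 2) * ∑ j, ∑ k, (g y)⁻¹ j k *
      ∑ i, curv (weylConn g (fun z i => 1 / 3 * diff t z i)) y i k i j := by
  have hU := hg.isOpen
  set φ : Plane → Vec := fun z i => 1 / 3 * diff t z i with hφdef
  have hφ : ∀ i, ContDiffOn ℝ ∞ (fun z => φ z i) U :=
    fun i => contDiffOn_const.mul (contDiffOn_pd hU ht i)
  have dφ : ∀ i, DifferentiableAt ℝ (fun z => φ z i) y :=
    fun i => differentiableAt_of_contDiffOn hU hy (hφ i)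
  have dC : ∀ k i j, DifferentiableAt ℝ (fun z => christoffel g z k i j) y :=
    fun k i j => differentiableAt_of_contDiffOn hU hy (hg.smooth_christoffel k i j)
  have dv : ∀ k, DifferentiableAt ℝ (fun z => raise (g z) (φ z) k) y :=
    fun k => differentiableAt_of_contDiffOn hU hy (hg.smooth_raise hφ k)
  have dg := hg.diff_metric hy
  have mg := hg.pd_metric (fun _ _ => 0) hy
  have mi := hg.pd_inv (fun _ _ => 0) hy
  simp only [weylConn_zero, mul_zero, zero_mul, sub_zero, add_zero] at mg mi
  have hlap : laplace g t y = 3 * ∑ a, ∑ b, (g y)⁻¹ a b * cov1 (christoffel g) φ y a b := by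
    have e : ∀ a b, pd a (fun z => φ z b) y = 1 / 3 * pd a (fun z => diff t z b) y := fun a b =>
      pd_const_mul _ (differentiableAt_of_contDiffOn hU hy (contDiffOn_pd hU ht b)) a
    simp only [laplace, hess, cov1, e]
    simp only [hφdef, Fin.sum_univ_two]
    ring
  have pv : ∀ i l, pd i (fun z => raise (g z) (φ z) l) y =
      ∑ b, (g y)⁻¹ l b * cov1 (christoffel g) φ y i b
        - ∑ a, christoffel g y l i a * raise (g y) (φ y) a := by
    intro i l
    have d0 := hg.diff_inv hy
    have : pd i (fun z => raise (g z) (φ z) l) y = ∑ b, (pd i (fun z => (g z)⁻¹ l b) y * φ y b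
        + (g y)⁻¹ l b * pd i (fun z => φ z b) y) := by
      unfold raise
      rw [pd_sum (F := fun b z => (g z)⁻¹ l b * φ z b) _ (fun b _ => (d0 l b).fun_mul (dφ b))]
      exact Finset.sum_congr rfl fun b _ => pd_mul (d0 l b) (dφ b) i
    rw [this]
    simp only [mi, cov1, raise, Fin.sum_univ_two]
    ring
  -- Derivatives of φ are rewritten through ∇φ, so that the curvature of D separates into the
  -- curvature of g, terms linear in ∇φ and terms quadratic in φ.
  have pW : ∀ i l j k, pd i (fun z => weylConn g φ z l j k) y =
      pd i (fun z => christoffel g z l j k) y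
      + (if l = k then cov1 (christoffel g) φ y i j + ∑ a, christoffel g y a i j * φ y a else 0)
      + (if l = j then cov1 (christoffel g) φ y i k + ∑ a, christoffel g y a i k * φ y a else 0)
      - (pd i (fun z => g z j k) y * raise (g y) (φ y) l
        + g y j k * pd i (fun z => raise (g z) (φ z) l) y) := by
    intro i l j k
    unfold weylConn
    have d1 : ∀ (p : Prop) [Decidable p] j, DifferentiableAt ℝ (fun z => if p then φ z j else 0) y := by
      intro p _ j
      split_ifs
      exacts [dφ j, differentiableAt_const _]
    have e1 : ∀ (p : Prop) [Decidable p] j, pd i (fun z => if p then φ z j else 0) y =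
        if p then cov1 (christoffel g) φ y i j + ∑ a, christoffel g y a i j * φ y a else 0 := by
      intro p _ j
      split_ifs
      · simp [cov1]
      · exact pd_const _ _
    rw [pd_sub (((dC l j k).fun_add (d1 _ _)).fun_add (d1 _ _)) ((dg j k).fun_mul (dv l)),
      pd_add ((dC l j k).fun_add (d1 _ _)) (d1 _ _), pd_add (dC l j k) (d1 _ _),
      pd_mul (dg j k) (dv l), e1, e1]
  have hφv := eq_sum_raise (hg.det_ne hy) (φ y)
  have hs := hg.symm y 1 0
  have hd := hg.det_ne hy
  obtain ⟨i1, i2, i3, i4⟩ := inv_apply_two (g y)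
  have hdet : (g y).det = g y 0 0 * g y 1 1 - g y 0 1 * g y 0 1 := by
    rw [Matrix.det_fin_two, hs]
  have hcs : ∀ k, christoffel g y k 1 0 = christoffel g y k 0 1 := fun k => by
    rw [← weylConn_zero, weylConn_symm g _ y hg.symm]
  rw [L2D, hlap]
  simp only [scal, ricci, curv, Fin.sum_univ_two]
  simp only [pW, pv, mg]
  simp only [weylConn]
  simp only [Fin.sum_univ_two, if_true, if_false, Fin.isValue, one_ne_zero, zero_ne_one, hs, hcs]
  -- In dimension n the scalar curvature of D is R - 2(n-1) div φ - (n-1)(n-2)|φ|². For n = 2 the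
  -- quadratic term cancels, and 3 div φ = Δt.
  generalize raise (g y) (φ y) = V at *
  simp only [hφv, i1, i2, i3, i4, hs]
  field_simp
  rw [hdet]
  ring

end Curvature

/-! ### Inner products of tensors -/

section Inner

variable {G : Mat2}

/-- The inner product of tensors of rank two. -/
noncomputable def inner2 (G : Mat2) (X Y : Ten2) : ℝ :=
  ∑ a, ∑ b, ∑ c, ∑ d, X a b * G⁻¹ a c * G⁻¹ b d * Y c d

/-- The inner product of tensors of rank three. -/
noncomputable def inner3 (G : Mat2) (S T : Ten3) : ℝ :=
  ∑ i, ∑ j, ∑ k, ∑ a, ∑ b, ∑ c, G⁻¹ i a * G⁻¹ j b * G⁻¹ k c * S i j k * T a b c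

theorem normSq3_eq_inner3 (G : Mat2) (S : Ten3) : normSq3 G S = inner3 G S S := rfl

theorem inner3_eq_sum_inner2 (S T : Ten3) :
    inner3 G S T = ∑ i, ∑ a, G⁻¹ i a * inner2 G (S i) (T a) := by
  simp only [inner3, inner2, Fin.sum_univ_two]
  ring

/-- A symmetric trace-free tensor has the two free components X₀₀ and X₀₁; X₁₁ is eliminated by
dividing the trace relation by G₀₀. -/
theorem inner2_eq (hG : ∀ i j, G i j = G j i) (hd : G.det ≠ 0) (h0 : G 0 0 ≠ 0) {X Y : Ten2}
    (hX : IsSymTraceFree2 G X) (hY : IsSymTraceFree2 G Y) :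
    inner2 G X Y = 2 * (G 1 1 * X 0 0 * Y 0 0 - G 0 1 * (X 0 0 * Y 0 1 + X 0 1 * Y 0 0)
      + G 0 0 * X 0 1 * Y 0 1) / (G 0 0 * G.det) := by
  have hs := hG 1 0
  obtain ⟨i1, i2, i3, i4⟩ := inv_apply_two G
  have hdet : G.det = G 0 0 * G 1 1 - G 0 1 * G 0 1 := by
    rw [Matrix.det_fin_two, hs]
  have hx : X 1 1 = (2 * G 0 1 * X 0 1 - G 1 1 * X 0 0) / G 0 0 := by
    rw [eq_div_iff h0]
    linarith [hX.trace_eq hG hd]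
  have hy : Y 1 1 = (2 * G 0 1 * Y 0 1 - G 1 1 * Y 0 0) / G 0 0 := by
    rw [eq_div_iff h0]
    linarith [hY.trace_eq hG hd]
  simp only [inner2, Fin.sum_univ_two, i1, i2, i3, i4, hX.1 1 0, hY.1 1 0, hx, hy, hs]
  field_simp
  rw [hdet]
  ring

/-- Here the free components are S₀₀₀ and S₀₀₁. The pairing is the sum of the pairings of the
slices, contracted with G⁻¹. -/
theorem inner3_eq (hG : ∀ i j, G i j = G j i) (hd : G.det ≠ 0) (h0 : G 0 0 ≠ 0) {S T : Ten3}
    (hS : IsSymTraceFree3 G S) (hT : IsSymTraceFree3 G T) :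
    inner3 G S T = 4 * (G 1 1 * S 0 0 0 * T 0 0 0 - G 0 1 * (S 0 0 0 * T 0 0 1 + S 0 0 1 * T 0 0 0)
      + G 0 0 * S 0 0 1 * T 0 0 1) / (G 0 0 ^ 2 * G.det) := by
  have hs := hG 1 0
  obtain ⟨i1, i2, i3, i4⟩ := inv_apply_two G
  have hdet : G.det = G 0 0 * G 1 1 - G 0 1 * G 0 1 := by
    rw [Matrix.det_fin_two, hs]
  have hx : S 0 1 1 = (2 * G 0 1 * S 0 0 1 - G 1 1 * S 0 0 0) / G 0 0 := by
    rw [eq_div_iff h0]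
    linarith [(hS.slice 0).trace_eq hG hd]
  have hy : T 0 1 1 = (2 * G 0 1 * T 0 0 1 - G 1 1 * T 0 0 0) / G 0 0 := by
    rw [eq_div_iff h0]
    linarith [(hT.slice 0).trace_eq hG hd]
  simp only [inner3_eq_sum_inner2, inner2_eq hG hd h0 (hS.slice _) (hT.slice _), Fin.sum_univ_two,
    i1, i2, i3, i4, hS.1 1 0, hT.1 1 0, hS.2.1 0 1 0, hT.2.1 0 1 0, hx, hy, hs]
  field_simp
  rw [hdet]
  ring

/-- In dimension two v ↦ S(v, ·, ·) is a conformal map into the trace-free symmetric forms, so the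
contraction of S with itself in two slots is pure trace. The factor 1/2 is fixed by taking the
trace. -/
theorem inner2_slice (hG : ∀ i j, G i j = G j i) (hd : G.det ≠ 0) (h0 : G 0 0 ≠ 0) {S : Ten3}
    (hS : IsSymTraceFree3 G S) (i a : Fin 2) :
    inner2 G (S i) (S a) = 1 / 2 * normSq3 G S * G i a := by
  have hs := hG 1 0
  have hdet : G.det = G 0 0 * G 1 1 - G 0 1 * G 0 1 := by
    rw [Matrix.det_fin_two, hs]
  have hx : S 0 1 1 = (2 * G 0 1 * S 0 0 1 - G 1 1 * S 0 0 0) / G 0 0 := by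
    rw [eq_div_iff h0]
    linarith [(hS.slice 0).trace_eq hG hd]
  rw [normSq3_eq_inner3, inner3_eq hG hd h0 hS hS, inner2_eq hG hd h0 (hS.slice _) (hS.slice _)]
  fin_cases i <;> fin_cases a <;>
    simp only [Fin.zero_eta, Fin.mk_one, hS.1 1 0, hS.2.1 0 1 0, hx, hs] <;> field_simp <;> ring

theorem contr2_contr1 (hG : ∀ i j, G i j = G j i) (hd : G.det ≠ 0) (h0 : G 0 0 ≠ 0) {S : Ten3}
    (hS : IsSymTraceFree3 G S) (t : Vec) (k : Fin 2) :
    contr2 G S (contr1 G S t) k = 1 / 2 * normSq3 G S * t k := by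
  have s1 := hS.1 1 0
  have s2 := hS.2.1 0 1 0
  have s3 := hS.2.1 1 1 0
  have e : contr2 G S (contr1 G S t) k = ∑ a, raise G t a * inner2 G (S k) (S a) := by
    fin_cases k <;> simp only [contr2, contr1, inner2, Fin.sum_univ_two, Fin.zero_eta, Fin.mk_one,
      s1, s2, s3] <;> ring
  rw [e, eq_sum_raise hd t k]
  simp only [inner2_slice hG hd h0 hS, Fin.sum_univ_two]
  ring

theorem contr2_metric (hG : ∀ i j, G i j = G j i) (hd : G.det ≠ 0) {S : Ten3}
    (hS : IsSymTraceFree3 G S) (k : Fin 2) : contr2 G S (fun i j => G i j) k = 0 := by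
  have h := (hS.slice k).2
  have e : ∀ a b, ∑ c, ∑ d, S k a b * G⁻¹ a c * G⁻¹ b d * G c d = G⁻¹ a b * S k a b := by
    intro a b
    have h1 : ∑ c, G⁻¹ a c * ∑ d, G c d * G⁻¹ d b = G⁻¹ a b := by
      simp [sum_mul_inv hd]
    rw [← h1]
    simp only [Fin.sum_univ_two, inv_symm hG b]
    ring
  simp only [contr2, e]
  exact h

theorem contr2_mul (S : Ten3) (t : Vec) (k : Fin 2) :
    contr2 G S (fun i j => t i * t j) k = ∑ a, ∑ b, S k a b * raise G t a * raise G t b := by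
  simp only [contr2, raise, Fin.sum_univ_two]
  ring

theorem inner3_sub_mul (S T T' : Ten3) (c : ℝ) :
    inner3 G S (fun i j k => T i j k - c * T' i j k) = inner3 G S T - c * inner3 G S T' := by
  simp only [inner3, Finset.mul_sum, ← Finset.sum_sub_distrib]
  refine Finset.sum_congr rfl fun _ _ => Finset.sum_congr rfl fun _ _ => Finset.sum_congr rfl
    fun _ _ => Finset.sum_congr rfl fun _ _ => Finset.sum_congr rfl fun _ _ =>
    Finset.sum_congr rfl fun _ _ => ?_
  ring

theorem inner3_sym3 (hG : ∀ i j, G i j = G j i) {S : Ten3} (hS : IsSymTraceFree3 G S) (T : Ten3) :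
    inner3 G S (sym3 T) = inner3 G S T := by
  have hs := inv_symm hG 1 0
  have s1 := hS.1 1 0
  have s2 := hS.2.1 0 1 0
  have s3 := hS.2.1 1 1 0
  simp only [inner3, sym3, Fin.sum_univ_two, hs, s1, s2, s3]
  ring

/-- The projection is orthogonal: what it discards is a symmetrised g ⊗ w, and this pairs to zero
with a trace-free S. -/
theorem inner3_proj3 (hG : ∀ i j, G i j = G j i) (hd : G.det ≠ 0) {S : Ten3}
    (hS : IsSymTraceFree3 G S) (T : Ten3) : inner3 G S (proj3 G T) = inner3 G S T := by
  have hz : ∀ w : Vec, inner3 G S (fun i j k => G i j * w k) = 0 := by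
    intro w
    have h := contr2_metric hG hd hS
    have s1 := hS.1 1 0
    have s2 := hS.2.1 0 1 0
    have s3 := hS.2.1 1 1 0
    have e : inner3 G S (fun i j k => G i j * w k) =
        ∑ k, raise G w k * contr2 G S (fun i j => G i j) k := by
      simp only [inner3, contr2, raise, Fin.sum_univ_two, s1, s2, s3]
      ring
    rw [e]
    simp [h]
  -- The three trace terms together are three times one symmetrisation, hence 3/4.
  have e : inner3 G S (proj3 G T) =
      inner3 G S (sym3 T) - 3 / 4 * inner3 G S (sym3 fun i j k => G i j * sym3Trace G T k) := by
    have : proj3 G T = fun i j k => sym3 T i j k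
        - 3 / 4 * sym3 (fun i j k => G i j * sym3Trace G T k) i j k := by
      funext i j k
      simp only [proj3, sym3, hG j i, hG k i, hG k j]
      ring
    rw [this]
    exact inner3_sub_mul _ _ _ _
  rw [e, inner3_sym3 hG hS, inner3_sym3 hG hS, hz]
  ring

theorem inner3_mul (hG : ∀ i j, G i j = G j i) {S : Ten3} (hS : IsSymTraceFree3 G S) (t : Vec)
    (l : Fin 2) :
    inner3 G S (fun i j k => t i * S j k l) = contr2 G S (contr1 G S t) l := by
  have hs := inv_symm hG 1 0
  have c : ∀ i j, S i j l = S l i j := fun i j => by rw [hS.2.1 i j l, hS.1 i l j]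
  have s1 := hS.1 1 0
  have s2 := hS.2.1 0 1 0
  have s3 := hS.2.1 1 1 0
  have s5 := hS.2.1 l 1 0
  simp only [inner3, contr2, contr1, raise, Fin.sum_univ_two, c, s1, s2, s3, s5, hs]
  ring

theorem inner3_mul_metric (hd : G.det ≠ 0) {S : Ten3}
    (hS : IsSymTraceFree3 G S) (X : Ten2) (l : Fin 2) :
    inner3 G S (fun i j k => X i j * G k l) = contr2 G S X l := by
  have s1 := hS.1 1 0
  have s2 := hS.2.1 0 1 0
  have s3 := hS.2.1 1 1 0
  have e : inner3 G S (fun i j k => X i j * G k l) =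
      ∑ k, (∑ c, G⁻¹ k c * G c l) * contr2 G S X k := by
    simp only [inner3, contr2, Fin.sum_univ_two, s1, s2, s3]
    ring
  rw [e]
  simp [sum_inv_mul hd]

/-- The squared norm is positive definite. -/
theorem eq_zero_of_normSq3 (hG : ∀ i j, G i j = G j i) (hd : 0 < G.det) (h0 : 0 < G 0 0)
    {S : Ten3} (hS : normSq3 G S = 0) : S = 0 := by
  have hs := hG 1 0
  obtain ⟨i1, i2, i3, i4⟩ := inv_apply_two G
  have hdet : G.det = G 0 0 * G 1 1 - G 0 1 * G 0 1 := by
    rw [Matrix.det_fin_two, hs]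
  have hA : 0 < G⁻¹ 0 0 := by
    rw [i1]
    refine div_pos ?_ hd
    nlinarith [mul_self_nonneg (G 0 1)]
  have hD : G⁻¹ 0 0 * G⁻¹ 1 1 - G⁻¹ 0 1 * G⁻¹ 0 1 = G.det⁻¹ := by
    rw [i1, i2, i4]
    field_simp
    rw [hdet]; ring
  -- Cholesky factorisation G⁻¹ = LᵀL with L upper triangular. In the frame given by L the norm is a
  -- sum of squares of components; S need not be symmetric.
  obtain ⟨p, q, r, hp, hr, h00, h01, h11⟩ : ∃ p q r : ℝ, p ≠ 0 ∧ r ≠ 0 ∧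
      G⁻¹ 0 0 = p * p ∧ G⁻¹ 0 1 = p * q ∧ G⁻¹ 1 1 = q * q + r * r := by
    have e1 := Real.mul_self_sqrt hA.le
    have e2 := Real.sqrt_pos.2 hA
    have hB : 0 < G.det⁻¹ / G⁻¹ 0 0 := div_pos (inv_pos.2 hd) hA
    refine ⟨√(G⁻¹ 0 0), G⁻¹ 0 1 / √(G⁻¹ 0 0), √(G.det⁻¹ / G⁻¹ 0 0), e2.ne',
      (Real.sqrt_pos.2 hB).ne', e1.symm, by field_simp, ?_⟩
    rw [Real.mul_self_sqrt hB.le, ← hD, div_mul_div_comm, e1]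
    field_simp
    ring
  have h10 : G⁻¹ 1 0 = p * q := by rw [inv_symm hG 1 0, h01]
  set L : Ten2 := ![![p, q], ![0, r]] with hL
  have inj : ∀ v : Vec, (∀ m, ∑ i, L m i * v i = 0) → ∀ i, v i = 0 := by
    intro v hv
    have v0 := hv 0
    have v1 := hv 1
    simp only [hL, Fin.sum_univ_two, Matrix.cons_val_zero, Matrix.cons_val_one] at v0 v1
    have w1 : v 1 = 0 := by
      have : r * v 1 = 0 := by linarith
      exact (mul_eq_zero.1 this).resolve_left hr
    have w0 : v 0 = 0 := by
      have : p * v 0 = 0 := by rw [w1] at v0; linarith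
      exact (mul_eq_zero.1 this).resolve_left hp
    intro i
    fin_cases i
    exacts [w0, w1]
  have key : normSq3 G S = ∑ m, ∑ n, ∑ o,
      (∑ i, L m i * ∑ j, L n j * ∑ k, L o k * S i j k) ^ 2 := by
    simp only [normSq3, Fin.sum_univ_two, h00, h01, h10, h11, hL, Matrix.cons_val_zero,
      Matrix.cons_val_one]
    ring
  rw [key] at hS
  have z : ∀ m n o, ∑ i, L m i * ∑ j, L n j * ∑ k, L o k * S i j k = 0 := by
    intro m n o
    have p1 := (Finset.sum_eq_zero_iff_of_nonneg (fun m _ => Finset.sum_nonneg fun n _ =>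
      Finset.sum_nonneg fun o _ => sq_nonneg _)).1 hS m (Finset.mem_univ _)
    have p2 := (Finset.sum_eq_zero_iff_of_nonneg (fun n _ =>
      Finset.sum_nonneg fun o _ => sq_nonneg _)).1 p1 n (Finset.mem_univ _)
    have p3 := (Finset.sum_eq_zero_iff_of_nonneg (fun o _ => sq_nonneg _)).1 p2 o
      (Finset.mem_univ _)
    exact pow_eq_zero_iff two_ne_zero |>.1 p3
  funext i j k
  exact inj _ (fun o => inj (fun j => ∑ k, L o k * S i j k)
    (fun n => inj (fun i => ∑ j, L n j * ∑ k, L o k * S i j k) (fun m => z m n o) i) j) k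

end Inner

section Local

variable {U : Set Plane} {g : Plane → Mat2} {φ : Plane → Vec} {y : Plane} {Sh : Plane → Ten3}
  {t : Plane → ℝ}

/-! ### The equation for `Ŝ` forces `S` to be totally symmetric and trace-free -/

/-- The right side of the equation lowers to a projection, whatever Ξ is. This makes the lowered DŜ
totally symmetric and trace-free before anything is known about S. -/
theorem LocalMetric.cov3_of_eqS (hg : LocalMetric U g) (hy : y ∈ U)
    (hSh : ∀ i j k, DifferentiableAt ℝ (fun z => Sh z i j k) y)
    (hE : ∀ l i j k, cov12 (weylConn g φ) Sh y l i j k =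
      zTensor g (fun z => lower (g z) (Sh z)) t y i j l k) (l : Fin 2) :
    IsSymTraceFree3 (g y) (fun i j k =>
      cov3 (weylConn g φ) (fun z => lower (g z) (Sh z)) y l i j k
        + 2 * φ y l * lower (g y) (Sh y) i j k) := by
  have hd := hg.det_ne hy
  have e : (fun i j k => cov3 (weylConn g φ) (fun z => lower (g z) (Sh z)) y l i j k
        + 2 * φ y l * lower (g y) (Sh y) i j k) =
      proj3 (g y) (fun i j k => Xi g (fun z => lower (g z) (Sh z)) t y i j * g y k l) := by
    funext i j k
    rw [← hg.lower_cov12 φ hy hSh]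
    simp only [hE]
    have := congrFun (congrArg (fun A => A *ᵥ
      (proj3 (g y) (fun i j k => Xi g (fun z => lower (g z) (Sh z)) t y i j * g y k l) i j))
      (Matrix.mul_nonsing_inv _ hd.isUnit)) k
    simp only [← Matrix.mulVec_mulVec, Matrix.one_mulVec] at this
    exact this
  rw [e]
  exact proj3_symTraceFree (hg.symm y) hd _

/-- The hypothesis `hp` says that the trace covector is D-parallel, so the curvature kills it. With
a single nonzero component κ, the curvature acts injectively on covectors. -/
theorem LocalMetric.trace_eq_zero (hg : LocalMetric U g) (hy : y ∈ U)
    (hφ : ∀ i, ContDiffOn ℝ ∞ (fun z => φ z i) U)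
    {κ : ℝ} (hκ : ∀ l, curv (weylConn g φ) y l 0 0 1 = -κ * (g y)⁻¹ l 1 ∧
      curv (weylConn g φ) y l 1 0 1 = κ * (g y)⁻¹ l 0) (hκ0 : κ ≠ 0)
    {T : Plane → Ten3} (hT : ∀ i j k, ContDiffOn ℝ ∞ (fun z => T z i j k) U)
    (hp : ∀ z ∈ U, ∀ l k, ∑ a, ∑ b, (g z)⁻¹ a b *
      (cov3 (weylConn g φ) T z l a b k + 2 * φ z l * T z a b k) = 0) (k : Fin 2) :
    ∑ a, ∑ b, (g y)⁻¹ a b * T y a b k = 0 := by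
  have hU := hg.isOpen
  have h := curv_apply_parallel hU hy (hg.smooth_weylConn hφ)
    (fun k i j => weylConn_symm g φ y hg.symm k i j) (hg.smooth_trace3 hT)
    (fun z hz l i => by
      rw [hg.cov1_trace3 φ hz (fun i j k => differentiableAt_of_contDiffOn hU hz (hT i j k))]
      exact hp z hz l i) 0 1
  set α : Vec := fun k => ∑ a, ∑ b, (g y)⁻¹ a b * T y a b k with hα
  have h0 : ∑ l, curv (weylConn g φ) y l 0 0 1 * α l = 0 := h 0
  have h1 : ∑ l, curv (weylConn g φ) y l 1 0 1 * α l = 0 := h 1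
  simp only [(hκ _).1, (hκ _).2, Fin.sum_univ_two] at h0 h1
  have hs := inv_symm (hg.symm y) 1 0
  have r0 : raise (g y) α 0 = 0 := by
    rw [raise_eq]
    refine (mul_eq_zero.1 (?_ : κ * _ = 0)).resolve_left hκ0
    rw [hs] at h1
    linear_combination h1
  have r1 : raise (g y) α 1 = 0 := by
    rw [raise_eq]
    refine (mul_eq_zero.1 (?_ : κ * _ = 0)).resolve_left hκ0
    rw [hs]
    linear_combination -h0
  have := eq_sum_raise (hg.det_ne hy) α k
  rw [r0, r1, mul_zero, mul_zero, add_zero] at this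
  exact this

/-- The third equation ties κ to |S|²: either κ = 0 and then S = 0, or κ ≠ 0 and then all traces of
S vanish. -/
theorem LocalMetric.symTraceFree_of_eqS (hg : LocalMetric U g) (hy : y ∈ U)
    (ht : ContDiffOn ℝ ∞ t U) (hφ : ∀ z ∈ U, ∀ i, φ z i = 1 / 3 * diff t z i)
    (hSh : ∀ i j k, ContDiffOn ℝ ∞ (fun z => Sh z i j k) U)
    (hE : ∀ z ∈ U, ∀ l i j k, cov12 (weylConn g φ) Sh z l i j k =
      zTensor g (fun z => lower (g z) (Sh z)) t z i j l k)
    (hL : L2D g t y = 1 / 3 * normSq3 (g y) (lower (g y) (Sh y))) :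
    IsSymTraceFree3 (g y) (lower (g y) (Sh y)) := by
  have hU := hg.isOpen
  have hG := hg.symm y
  have hd := hg.det_ne hy
  -- On U the form φ is replaced by dt/3, which is smooth and closed by construction.
  set ψ : Plane → Vec := fun z i => 1 / 3 * diff t z i with hψ
  have sψ : ∀ i, ContDiffOn ℝ ∞ (fun z => ψ z i) U :=
    fun i => contDiffOn_const.mul (contDiffOn_pd hU ht i)
  have eψ : ∀ z ∈ U, weylConn g φ z = weylConn g ψ z := by
    intro z hz
    have : φ z = ψ z := funext fun i => hφ z hz i
    funext k i j
    simp only [weylConn, this]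
  have hE' : ∀ z ∈ U, ∀ l i j k, cov12 (weylConn g ψ) Sh z l i j k =
      zTensor g (fun z => lower (g z) (Sh z)) t z i j l k := by
    intro z hz l i j k
    rw [← hE z hz]
    simp only [cov12, eψ z hz]
  have cψ : ∀ i j, pd i (fun z => ψ z j) y = pd j (fun z => ψ z i) y := by
    have d : ∀ j, DifferentiableAt ℝ (fun z => diff t z j) y :=
      fun j => differentiableAt_of_contDiffOn hU hy (contDiffOn_pd hU ht j)
    intro i j
    simp only [hψ]
    rw [pd_const_mul _ (d j), pd_const_mul _ (d i)]
    congr 1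
    exact pd_comm hU hy ht i j
  obtain ⟨κ, hκ⟩ := curv_eq hg hy sψ cψ
  have hLκ := hg.L2D_eq hy ht
  rw [hg.sum_inv_ricci hy hκ, hL] at hLκ
  by_cases hκ0 : κ = 0
  · have h0 : normSq3 (g y) (lower (g y) (Sh y)) = 0 := by
      rw [hκ0] at hLκ
      simp only [mul_zero, zero_div] at hLκ
      linarith
    rw [eq_zero_of_normSq3 hG (hg.det_pos y hy) (hg.pos y hy) h0]
    exact ⟨fun _ _ _ => rfl, fun _ _ _ => rfl, fun _ => by simp⟩
  · have hlow := hg.smooth_lower hSh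
    have dSh : ∀ z ∈ U, ∀ i j k, DifferentiableAt ℝ (fun z => Sh z i j k) z :=
      fun z hz i j k => differentiableAt_of_contDiffOn hU hz (hSh i j k)
    have key := fun z hz => hg.cov3_of_eqS (t := t) (φ := ψ) hz (dSh z hz) (hE' z hz)
    refine isSymTraceFree3_of_traces hG hd ?_ ?_ ?_
    · exact hg.trace_eq_zero hy sψ hκ hκ0 hlow (fun z hz l k => (key z hz l).2.2 k)
    -- The traces over the other pairs of slots are first-pair traces of a tensor with permuted
    -- slots.
    · refine hg.trace_eq_zero hy sψ hκ hκ0 (T := fun z a b k => lower (g z) (Sh z) a k b)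
        (fun i j k => hlow i k j) (fun z hz l k => ?_)
      have h := (key z hz l).2.2 k
      have hs := (key z hz l).2.1
      simp only [fun a b => hs a b k] at h
      rw [← h]
      simp only [cov3, Fin.sum_univ_two]
      ring
    · refine hg.trace_eq_zero hy sψ hκ hκ0 (T := fun z a b k => lower (g z) (Sh z) k a b)
        (fun i j k => hlow k i j) (fun z hz l k => ?_)
      have h := ((key z hz l).slice k).2
      rw [← h]
      simp only [cov3, Fin.sum_univ_two]
      ring

/-! ### The divergence of `τ` -/

theorem smooth_cov1 (hU : IsOpen U) {Γ : Plane → Ten3}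
    (hΓ : ∀ k i j, ContDiffOn ℝ ∞ (fun z => Γ z k i j) U)
    {α : Plane → Vec} (hα : ∀ i, ContDiffOn ℝ ∞ (fun z => α z i) U) (l i : Fin 2) :
    ContDiffOn ℝ ∞ (fun z => cov1 Γ α z l i) U :=
  (contDiffOn_pd hU (hα i) l).sub (ContDiffOn.sum fun a _ => (hΓ a l i).mul (hα a))

theorem smooth_cov3 (hU : IsOpen U) {Γ : Plane → Ten3}
    (hΓ : ∀ k i j, ContDiffOn ℝ ∞ (fun z => Γ z k i j) U)
    {S : Plane → Ten3} (hS : ∀ i j k, ContDiffOn ℝ ∞ (fun z => S z i j k) U) (l i j k : Fin 2) :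
    ContDiffOn ℝ ∞ (fun z => cov3 Γ S z l i j k) U :=
  (contDiffOn_pd hU (hS i j k) l).sub (ContDiffOn.sum fun a _ =>
    (((hΓ a l i).mul (hS a j k)).add ((hΓ a l j).mul (hS i a k))).add ((hΓ a l k).mul (hS i j a)))

theorem LocalMetric.smooth_hess (hg : LocalMetric U g) (ht : ContDiffOn ℝ ∞ t U) (i j : Fin 2) :
    ContDiffOn ℝ ∞ (fun z => hess g t z i j) U :=
  smooth_cov1 hg.isOpen hg.smooth_christoffel (α := diff t) (fun i => contDiffOn_pd hg.isOpen ht i)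
    i j

theorem LocalMetric.smooth_laplace (hg : LocalMetric U g) (ht : ContDiffOn ℝ ∞ t U) :
    ContDiffOn ℝ ∞ (laplace g t) U :=
  ContDiffOn.sum fun a _ => ContDiffOn.sum fun b _ => (hg.smooth_inv a b).mul (hg.smooth_hess ht a b)

theorem LocalMetric.smooth_contr1 (hg : LocalMetric U g) (ht : ContDiffOn ℝ ∞ t U)
    {S : Plane → Ten3} (hS : ∀ i j k, ContDiffOn ℝ ∞ (fun z => S z i j k) U) (i j : Fin 2) :
    ContDiffOn ℝ ∞ (fun z => contr1 (g z) (S z) (diff t z) i j) U :=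
  ContDiffOn.sum fun a _ => (hS i j a).mul
    (hg.smooth_raise (φ := diff t) (fun i => contDiffOn_pd hg.isOpen ht i) a)

theorem LocalMetric.smooth_Xi (hg : LocalMetric U g) (ht : ContDiffOn ℝ ∞ t U)
    {S : Plane → Ten3} (hS : ∀ i j k, ContDiffOn ℝ ∞ (fun z => S z i j k) U) (i j : Fin 2) :
    ContDiffOn ℝ ∞ (fun z => Xi g S t z i j) U :=
  (ContDiffOn.sum fun a _ => ContDiffOn.sum fun b _ => (hg.smooth_inv a b).mul
    (smooth_cov3 hg.isOpen hg.smooth_christoffel hS b a i j)).add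
    (contDiffOn_const.mul (hg.smooth_contr1 ht hS i j))

theorem LocalMetric.hess_symm (hg : LocalMetric U g) (hy : y ∈ U) (ht : ContDiffOn ℝ ∞ t U)
    (i j : Fin 2) : hess g t y i j = hess g t y j i := by
  have h := pd_comm hg.isOpen hy ht i j
  have hc : ∀ k, christoffel g y k i j = christoffel g y k j i := fun k => by
    rw [← weylConn_zero, weylConn_symm g _ y hg.symm]
  simp only [hess, cov1, hc]
  congr 1

theorem LocalMetric.pd_normSq3 (hg : LocalMetric U g) (hy : y ∈ U) {S : Plane → Ten3}
    (hS : ∀ z ∈ U, IsSymTraceFree3 (g z) (S z))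
    (hd : ∀ i j k, DifferentiableAt ℝ (fun z => S z i j k) y) (l : Fin 2) :
    DifferentiableAt ℝ (fun z => normSq3 (g z) (S z)) y ∧
    pd l (fun z => normSq3 (g z) (S z)) y =
      2 * inner3 (g y) (S y) (cov3 (christoffel g) S y l) := by
  have hU := hg.isOpen
  have dg := hg.diff_metric hy
  have mg := hg.pd_metric (fun _ _ => 0) hy
  simp only [weylConn_zero, mul_zero, zero_mul, sub_zero] at mg
  have hG := hg.symm y
  have hdet := hg.det_ne hy
  have h0 := (hg.pos y hy).ne'
  have dN : DifferentiableAt ℝ (fun z => normSq3 (g z) (S z)) y := by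
    unfold normSq3
    exact DifferentiableAt.fun_sum fun i _ => DifferentiableAt.fun_sum fun j _ =>
      DifferentiableAt.fun_sum fun k _ => DifferentiableAt.fun_sum fun a _ =>
      DifferentiableAt.fun_sum fun b _ => DifferentiableAt.fun_sum fun c _ =>
      ((((hg.diff_inv hy i a).fun_mul (hg.diff_inv hy j b)).fun_mul
        (hg.diff_inv hy k c)).fun_mul (hd i j k)).fun_mul (hd a b c)
  refine ⟨dN, ?_⟩
  set N := fun z => normSq3 (g z) (S z) with hN
  -- The two-component formula for |S|² with denominators cleared, so that the derivative needs only
  -- the product rule.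
  have h1 : ∀ z ∈ U, N z * (g z 0 0 * g z 0 0 * (g z 0 0 * g z 1 1 - g z 0 1 * g z 0 1)) =
      4 * (g z 1 1 * (S z 0 0 0 * S z 0 0 0) - 2 * (g z 0 1 * (S z 0 0 0 * S z 0 0 1))
        + g z 0 0 * (S z 0 0 1 * S z 0 0 1)) := by
    intro z hz
    have hdz : (g z).det = g z 0 0 * g z 1 1 - g z 0 1 * g z 0 1 := by
      rw [Matrix.det_fin_two, hg.symm z 1 0]
    have hz1 := hg.det_ne hz
    have hz0 := (hg.pos z hz).ne'
    rw [hN]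
    simp only
    rw [normSq3_eq_inner3, inner3_eq (hg.symm z) hz1 hz0 (hS z hz) (hS z hz), ← hdz]
    field_simp
    ring
  have h2 := pd_congr hU hy h1 l
  have a00 := dg 0 0
  have a01 := dg 0 1
  have a11 := dg 1 1
  have b0 := hd 0 0 0
  have b1 := hd 0 0 1
  have q00 := a00.fun_mul a00
  have q01 := a01.fun_mul a01
  have q := a00.fun_mul a11
  have qs := q.fun_sub q01
  have s0 := b0.fun_mul b0
  have s1 := b0.fun_mul b1
  have s2 := b1.fun_mul b1
  have u0 := a11.fun_mul s0
  have u1 := a01.fun_mul s1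
  have u2 := a00.fun_mul s2
  rw [pd_mul dN (q00.fun_mul qs), pd_mul q00 qs, pd_mul a00 a00, pd_sub q q01, pd_mul a00 a11,
    pd_mul a01 a01, pd_const_mul 4 ((u0.fun_sub (u1.const_mul 2)).fun_add u2),
    pd_add (u0.fun_sub (u1.const_mul 2)) u2, pd_sub u0 (u1.const_mul 2), pd_const_mul 2 u1,
    pd_mul a11 s0, pd_mul a01 s1, pd_mul a00 s2, pd_mul b0 b0, pd_mul b0 b1, pd_mul b1 b1] at h2
  have hSy := hS y hy
  have hT := cov3_symTraceFree hg hy hS hd l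
  have t0 : pd l (fun z => S z 0 0 0) y = cov3 (christoffel g) S y l 0 0 0
      + 3 * (christoffel g y 0 l 0 * S y 0 0 0 + christoffel g y 1 l 0 * S y 0 0 1) := by
    simp only [cov3, Fin.sum_univ_two, hSy.1 1 0, hSy.2.1 0 1 0]
    ring
  have t1 : pd l (fun z => S z 0 0 1) y = cov3 (christoffel g) S y l 0 0 1
      + 2 * (christoffel g y 0 l 0 * S y 0 0 1 + christoffel g y 1 l 0 * S y 0 1 1)
      + christoffel g y 0 l 1 * S y 0 0 0 + christoffel g y 1 l 1 * S y 0 0 1 := by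
    simp only [cov3, Fin.sum_univ_two, hSy.1 1 0]
    ring
  have hx : S y 0 1 1 = (2 * g y 0 1 * S y 0 0 1 - g y 1 1 * S y 0 0 0) / g y 0 0 := by
    rw [eq_div_iff h0]
    linarith [(hSy.slice 0).trace_eq hG hdet]
  have hdy : (g y).det = g y 0 0 * g y 1 1 - g y 0 1 * g y 0 1 := by
    rw [Matrix.det_fin_two, hG 1 0]
  have hn := h1 y hy
  rw [← hdy] at hn
  have hny : N y = 4 * (g y 1 1 * (S y 0 0 0 * S y 0 0 0) - 2 * (g y 0 1 * (S y 0 0 0 * S y 0 0 1))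
        + g y 0 0 * (S y 0 0 1 * S y 0 0 1)) / (g y 0 0 * g y 0 0 * (g y).det) := by
    rw [eq_div_iff (mul_ne_zero (mul_ne_zero h0 h0) hdet), hn]
  rw [inner3_eq hG hdet h0 hSy hT]
  simp only [mg, Fin.sum_univ_two, t0, t1, hx, hny, hG 1 0] at h2
  rw [← hdy] at h2
  have hD : g y 0 0 * g y 0 0 * (g y).det ≠ 0 := mul_ne_zero (mul_ne_zero h0 h0) hdet
  generalize pd l N y = P at *
  clear_value N
  clear hn hny h1 dN
  rw [← mul_left_inj' hD]
  rw [← eq_sub_iff_add_eq] at h2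
  rw [h2]
  field_simp
  rw [hdy]
  ring

end Local

/-! ### Covariant derivatives of the ingredients of τ, and the divergence of the Hessian. -/

section Divergence

variable {U : Set Plane} {g : Plane → Mat2} {y : Plane} {S : Plane → Ten3} {t : Plane → ℝ}

theorem LocalMetric.pd_metric_christoffel (hg : LocalMetric U g) (hy : y ∈ U) (l i j : Fin 2) :
    pd l (fun z => g z i j) y =
      ∑ a, (christoffel g y a l i * g y a j + christoffel g y a l j * g y i a) := by
  have h := hg.pd_metric (fun _ _ => 0) hy l i j
  simpa only [weylConn_zero, mul_zero, zero_mul, sub_zero] using h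

theorem LocalMetric.pd_inv_christoffel (hg : LocalMetric U g) (hy : y ∈ U) (l i j : Fin 2) :
    pd l (fun z => (g z)⁻¹ i j) y =
      -∑ a, (christoffel g y i l a * (g y)⁻¹ a j + christoffel g y j l a * (g y)⁻¹ i a) := by
  have h := hg.pd_inv (fun _ _ => 0) hy l i j
  simpa only [weylConn_zero, mul_zero, zero_mul, add_zero] using h

theorem LocalMetric.cov2_mul_metric (hg : LocalMetric U g) (hy : y ∈ U) {f : Plane → ℝ}
    (hf : DifferentiableAt ℝ f y) (l i j : Fin 2) :
    cov2 (christoffel g) (fun z i j => f z * g z i j) y l i j = pd l f y * g y i j := by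
  simp only [cov2, pd_mul hf (hg.diff_metric hy i j), hg.pd_metric_christoffel hy,
    Fin.sum_univ_two]
  ring

theorem pd_diff (g : Plane → Mat2) (t : Plane → ℝ) (y : Plane) (i j : Fin 2) :
    pd i (fun z => diff t z j) y =
      hess g t y i j + ∑ a, christoffel g y a i j * diff t y a := by
  simp only [hess, cov1]
  ring

theorem LocalMetric.pd_raise_diff (hg : LocalMetric U g) (hy : y ∈ U) (ht : ContDiffOn ℝ ∞ t U)
    (l c : Fin 2) :
    pd l (fun z => raise (g z) (diff t z) c) y = ∑ b, (g y)⁻¹ c b * hess g t y l b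
      - ∑ a, christoffel g y c l a * raise (g y) (diff t y) a := by
  have d0 := hg.diff_inv hy
  have d1 : ∀ b, DifferentiableAt ℝ (fun z => diff t z b) y :=
    fun b => differentiableAt_of_contDiffOn hg.isOpen hy (contDiffOn_pd hg.isOpen ht b)
  have : pd l (fun z => raise (g z) (diff t z) c) y =
      ∑ b, (pd l (fun z => (g z)⁻¹ c b) y * diff t y b
        + (g y)⁻¹ c b * pd l (fun z => diff t z b) y) := by
    unfold raise
    rw [pd_sum (F := fun b z => (g z)⁻¹ c b * diff t z b) _ (fun b _ => (d0 c b).fun_mul (d1 b))]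
    exact Finset.sum_congr rfl fun b _ => pd_mul (d0 c b) (d1 b) l
  rw [this]
  simp only [hg.pd_inv_christoffel hy, pd_diff g, raise, Fin.sum_univ_two]
  ring

theorem LocalMetric.diff_raise (hg : LocalMetric U g) (hy : y ∈ U) (ht : ContDiffOn ℝ ∞ t U)
    (c : Fin 2) : DifferentiableAt ℝ (fun z => raise (g z) (diff t z) c) y :=
  differentiableAt_of_contDiffOn hg.isOpen hy
    (hg.smooth_raise (φ := diff t) (fun i => contDiffOn_pd hg.isOpen ht i) c)

theorem LocalMetric.cov2_contr1 (hg : LocalMetric U g) (hy : y ∈ U) (ht : ContDiffOn ℝ ∞ t U)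
    (hS : ∀ i j k, DifferentiableAt ℝ (fun z => S z i j k) y) (l i j : Fin 2) :
    cov2 (christoffel g) (fun z => contr1 (g z) (S z) (diff t z)) y l i j =
      contr1 (g y) (cov3 (christoffel g) S y l) (diff t y) i j
        + contr1 (g y) (S y) (hess g t y l) i j := by
  have d1 := hg.diff_raise hy ht
  have e : pd l (fun z => contr1 (g z) (S z) (diff t z) i j) y =
      ∑ a, (pd l (fun z => S z i j a) y * raise (g y) (diff t y) a
        + S y i j a * pd l (fun z => raise (g z) (diff t z) a) y) := by
    unfold contr1
    rw [pd_sum (F := fun a z => S z i j a * raise (g z) (diff t z) a) _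
      (fun a _ => (hS i j a).fun_mul (d1 a))]
    exact Finset.sum_congr rfl fun a _ => pd_mul (hS i j a) (d1 a) l
  unfold cov2
  rw [e]
  simp only [hg.pd_raise_diff hy ht, contr1, cov3, Fin.sum_univ_two]
  simp only [raise_eq (g y) (hess g t y l)]
  ring

theorem LocalMetric.cov2_mul_diff (hg : LocalMetric U g) (hy : y ∈ U) (ht : ContDiffOn ℝ ∞ t U)
    (l i j : Fin 2) :
    cov2 (christoffel g) (fun z i j => diff t z i * diff t z j) y l i j =
      hess g t y l i * diff t y j + diff t y i * hess g t y l j := by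
  have d1 : ∀ b, DifferentiableAt ℝ (fun z => diff t z b) y :=
    fun b => differentiableAt_of_contDiffOn hg.isOpen hy (contDiffOn_pd hg.isOpen ht b)
  simp only [cov2, pd_mul (d1 i) (d1 j), pd_diff g, Fin.sum_univ_two]
  ring

theorem LocalMetric.pd_normSq_diff (hg : LocalMetric U g) (hy : y ∈ U) (ht : ContDiffOn ℝ ∞ t U)
    (l : Fin 2) :
    DifferentiableAt ℝ (fun z => ∑ a, raise (g z) (diff t z) a * diff t z a) y ∧
    pd l (fun z => ∑ a, raise (g z) (diff t z) a * diff t z a) y =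
      2 * ∑ a, raise (g y) (diff t y) a * hess g t y l a := by
  have d1 := hg.diff_raise hy ht
  have d2 : ∀ b, DifferentiableAt ℝ (fun z => diff t z b) y :=
    fun b => differentiableAt_of_contDiffOn hg.isOpen hy (contDiffOn_pd hg.isOpen ht b)
  refine ⟨DifferentiableAt.fun_sum fun a _ => (d1 a).fun_mul (d2 a), ?_⟩
  rw [pd_sum (F := fun a z => raise (g z) (diff t z) a * diff t z a) _
      (fun a _ => (d1 a).fun_mul (d2 a))]
  simp only [pd_mul (d1 _) (d2 _), hg.pd_raise_diff hy ht, pd_diff g]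
  simp only [raise_eq, Fin.sum_univ_two, inv_symm (hg.symm y) 1 0]
  ring

/-- The contracted Bochner formula in dimension two. -/
theorem LocalMetric.div_hess (hg : LocalMetric U g) (hy : y ∈ U) (ht : ContDiffOn ℝ ∞ t U)
    (k : Fin 2) :
    ∑ a, ∑ b, (g y)⁻¹ a b * cov2 (christoffel g) (hess g t) y b a k =
      pd k (laplace g t) y + 1 / 2 * scal g y * diff t y k := by
  have hU := hg.isOpen
  have hC := hg.smooth_christoffel
  have hα : ∀ i, ContDiffOn ℝ ∞ (fun z => diff t z i) U := fun i => contDiffOn_pd hU ht i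
  have dh : ∀ i j, DifferentiableAt ℝ (fun z => hess g t z i j) y :=
    fun i j => differentiableAt_of_contDiffOn hU hy (hg.smooth_hess ht i j)
  have hcs : ∀ k i j, christoffel g y k i j = christoffel g y k j i := fun k i j => by
    rw [← weylConn_zero, weylConn_symm g _ y hg.symm]
  have hlap : pd k (laplace g t) y =
      ∑ a, ∑ b, (g y)⁻¹ a b * cov2 (christoffel g) (hess g t) y k b a := by
    have := hg.pd_trace2 (fun _ _ => 0) hy dh k
    simp only [weylConn_zero, mul_zero, zero_mul, add_zero] at this
    refine this.trans ?_
    rw [Finset.sum_comm]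
    exact Finset.sum_congr rfl fun a _ => Finset.sum_congr rfl fun b _ => by
      rw [inv_symm (hg.symm y) b a]
  have hsym : ∀ b a, cov2 (christoffel g) (hess g t) y b a k =
      cov2 (christoffel g) (hess g t) y b k a := by
    intro b a
    have h := pd_congr hU hy (fun z hz => hg.hess_symm hz ht a k) b
    simp only [cov2, h, hg.hess_symm hy ht k, hg.hess_symm hy ht a]
    congr 1
    exact Finset.sum_congr rfl fun _ _ => add_comm _ _
  have hR : ∀ b a, cov2 (christoffel g) (hess g t) y b k a =
      cov2 (christoffel g) (hess g t) y k b a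
        - ∑ l, curv (christoffel g) y l a b k * diff t y l := by
    intro b a
    have h := ricci_identity hU hy hC hcs hα b k a
    change cov2 (christoffel g) (hess g t) y b k a - cov2 (christoffel g) (hess g t) y k b a = _ at h
    linear_combination h
  obtain ⟨κ, hκ⟩ := curv_eq (φ := fun _ _ => 0) hg hy (fun _ => contDiffOn_const) (fun _ _ => by
    simp only [pd_const])
  rw [weylConn_zero] at hκ
  have hs : scal g y = 2 * κ / (g y).det := hg.sum_inv_ricci hy hκ
  have anti : ∀ l k, curv (christoffel g) y l k 1 0 = -curv (christoffel g) y l k 0 1 := by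
    intro l k; simp only [curv, Fin.sum_univ_two]; ring
  have diag : ∀ l k i, curv (christoffel g) y l k i i = 0 := by
    intro l k i; simp only [curv, Fin.sum_univ_two]; ring
  have hg10 := hg.symm y 1 0
  have hd := hg.det_ne hy
  obtain ⟨i1, i2, i3, i4⟩ := inv_apply_two (g y)
  have hdet : (g y).det = g y 0 0 * g y 1 1 - g y 0 1 * g y 0 1 := by
    rw [Matrix.det_fin_two, hg10]
  -- In dimension two Ric = ½ R g; the sign comes from the order of the arguments in `curv`.
  have hc : ∑ a, ∑ b, (g y)⁻¹ a b * ∑ l, curv (christoffel g) y l a b k * diff t y l =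
      -(1 / 2 * scal g y * diff t y k) := by
    rw [hs]
    fin_cases k <;> simp only [Fin.zero_eta, Fin.mk_one, Fin.sum_univ_two, anti, diag, (hκ _).1,
      (hκ _).2, i1, i2, i3, i4, hg10] <;> field_simp <;> rw [hdet] <;> ring
  simp only [hsym, hR, mul_sub, Finset.sum_sub_distrib, hc, ← hlap]
  ring

theorem LocalMetric.cov2_tau (hg : LocalMetric U g) (hy : y ∈ U) (ht : ContDiffOn ℝ ∞ t U)
    (hS : ∀ i j k, ContDiffOn ℝ ∞ (fun z => S z i j k) U) (l i j : Fin 2) :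
    cov2 (christoffel g) (tau g S t) y l i j =
      2 / 3 * (cov2 (christoffel g) (hess g t) y l i j - 1 / 2 * (pd l (laplace g t) y * g y i j))
      - 2 / 3 * (contr1 (g y) (cov3 (christoffel g) S y l) (diff t y) i j
        + contr1 (g y) (S y) (hess g t y l) i j)
      + 1 / 3 * cov2 (christoffel g) (Xi g S t) y l i j
      - 8 / 9 * (hess g t y l i * diff t y j + diff t y i * hess g t y l j
        - (∑ a, raise (g y) (diff t y) a * hess g t y l a) * g y i j) := by
  have hU := hg.isOpen
  have sm {f : Plane → ℝ} (hf : ContDiffOn ℝ ∞ f U) : DifferentiableAt ℝ f y :=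
    differentiableAt_of_contDiffOn hU hy hf
  have dS := fun i j k => sm (hS i j k)
  have dt := fun i => sm (contDiffOn_pd hU ht i)
  have hq := hg.pd_normSq_diff hy ht l
  rw [← hg.cov2_mul_metric hy (sm (hg.smooth_laplace ht)), ← hg.cov2_contr1 hy ht dS,
    ← hg.cov2_mul_diff hy ht]
  have h5 : (∑ a, raise (g y) (diff t y) a * hess g t y l a) * g y i j = 1 / 2 *
      cov2 (christoffel g) (fun z i j =>
        (∑ a, raise (g z) (diff t z) a * diff t z a) * g z i j) y l i j := by
    rw [hg.cov2_mul_metric hy hq.1, hq.2]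
    ring
  rw [h5]
  have d1 := sm (hg.smooth_hess ht i j)
  have d2 := (sm (hg.smooth_laplace ht)).fun_mul (hg.diff_metric hy i j)
  have d3 := sm (hg.smooth_contr1 ht hS i j)
  have d4 := sm (hg.smooth_Xi ht hS i j)
  have d5 : DifferentiableAt ℝ (fun z => diff t z i * diff t z j) y := (dt i).fun_mul (dt j)
  have d6 := hq.1.fun_mul (hg.diff_metric hy i j)
  have e : pd l (fun z => tau g S t z i j) y =
      2 / 3 * (pd l (fun z => hess g t z i j) y
        - 1 / 2 * pd l (fun z => laplace g t z * g z i j) y)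
      - 2 / 3 * pd l (fun z => contr1 (g z) (S z) (diff t z) i j) y
      + 1 / 3 * pd l (fun z => Xi g S t z i j) y
      - 8 / 9 * (pd l (fun z => diff t z i * diff t z j) y
        - 1 / 2 * pd l (fun z => (∑ a, raise (g z) (diff t z) a * diff t z a) * g z i j) y) := by
    have e0 : (fun z => tau g S t z i j) = fun z =>
        2 / 3 * (hess g t z i j - 1 / 2 * (laplace g t z * g z i j))
        - 2 / 3 * contr1 (g z) (S z) (diff t z) i j
        + 1 / 3 * Xi g S t z i j
        - 8 / 9 * (diff t z i * diff t z j
          - 1 / 2 * ((∑ a, raise (g z) (diff t z) a * diff t z a) * g z i j)) := by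
      funext z
      simp only [tau]
      ring
    have f1 := d1.fun_sub (d2.const_mul (1 / 2))
    have f2 := d5.fun_sub (d6.const_mul (1 / 2))
    rw [e0, pd_sub (((f1.const_mul _).fun_sub (d3.const_mul _)).fun_add (d4.const_mul _))
        (f2.const_mul _), pd_add ((f1.const_mul _).fun_sub (d3.const_mul _)) (d4.const_mul _),
      pd_sub (f1.const_mul _) (d3.const_mul _), pd_const_mul _ f1, pd_const_mul _ d3,
      pd_const_mul _ d4, pd_const_mul _ f2, pd_sub d1 (d2.const_mul _), pd_const_mul _ d2,
      pd_sub d5 (d6.const_mul _), pd_const_mul _ d6]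
  unfold cov2
  rw [e]
  simp only [tau, Fin.sum_univ_two]
  ring

end Divergence

/-! ### The divergence equation for τ. -/

section DivTau

variable {U : Set Plane} {g : Plane → Mat2} {y : Plane} {S : Plane → Ten3} {t : Plane → ℝ}

theorem contr2_tau (g : Plane → Mat2) (S : Plane → Ten3) (t : Plane → ℝ) (y : Plane) (k : Fin 2) :
    contr2 (g y) (S y) (tau g S t y) k = 2 / 3 * contr2 (g y) (S y) (hess g t y) k
      - 2 / 3 * contr2 (g y) (S y) (contr1 (g y) (S y) (diff t y)) k
      + 1 / 3 * beta g S t y k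
      - 8 / 9 * contr2 (g y) (S y) (fun i j => diff t y i * diff t y j) k
      + (4 / 9 * (∑ a, raise (g y) (diff t y) a * diff t y a) - 1 / 3 * laplace g t y)
        * contr2 (g y) (S y) (fun i j => g y i j) k := by
  unfold beta
  generalize hX : Xi g S t y = X
  generalize hC : contr1 (g y) (S y) (diff t y) = C
  generalize hQ : ∑ a, raise (g y) (diff t y) a * diff t y a = Q
  have : tau g S t y = fun i j => 2 / 3 * (hess g t y i j - 1 / 2 * laplace g t y * g y i j)
      - 2 / 3 * C i j + 1 / 3 * X i j
      - 8 / 9 * (diff t y i * diff t y j - 1 / 2 * Q * g y i j) := by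
    funext i j
    simp only [tau, hX, hC, hQ]
  rw [this]
  simp only [contr2, Fin.sum_univ_two]
  ring

/-- Pairing the equation for ∇S with S drops the projection. The coefficient 2/3 is 2(-2/3 + 2 ·
1/2), the last 1/2 coming from `contr2_contr1`. -/
theorem LocalMetric.pd_normSq3_eq (hg : LocalMetric U g) (hy : y ∈ U)
    (hS : ∀ z ∈ U, IsSymTraceFree3 (g z) (S z))
    (hd : ∀ i j k, DifferentiableAt ℝ (fun z => S z i j k) y)
    (hE : ∀ l i j k, cov3 (christoffel g) S y l i j k =
      proj3 (g y) (fun i j k => -(2 / 3) * S y i j k * diff t y l + 2 * diff t y i * S y j k l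
        + Xi g S t y i j * g y k l) i j k) (l : Fin 2) :
    pd l (fun z => normSq3 (g z) (S z)) y =
      2 / 3 * normSq3 (g y) (S y) * diff t y l + 2 * beta g S t y l := by
  have hG := hg.symm y
  have hdet := hg.det_ne hy
  have h0 := (hg.pos y hy).ne'
  have hSy := hS y hy
  rw [(hg.pd_normSq3 hy hS hd l).2]
  have e : cov3 (christoffel g) S y l = proj3 (g y) (fun i j k =>
      (Xi g S t y i j * g y k l - 2 / 3 * diff t y l * S y i j k)
        - (-2) * (diff t y i * S y j k l)) := by
    funext i j k
    rw [hE]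
    congr 1
    funext i j k
    ring
  rw [e, inner3_proj3 hG hdet hSy, inner3_sub_mul, inner3_sub_mul, inner3_mul_metric hdet hSy,
    inner3_mul hG hSy, contr2_contr1 hG hdet h0 hSy, ← normSq3_eq_inner3]
  unfold beta
  ring

/-- The first two summands of ∇Ξ are totally symmetric and trace-free, so they do not contribute.
The β-term contributes (β + 2β)/2 - β/2 = β, times 4/3. -/
theorem LocalMetric.div_Xi (hg : LocalMetric U g) (hy : y ∈ U)
    (hS : IsSymTraceFree3 (g y) (S y))
    (hE : ∀ k i j, cov2 (christoffel g) (Xi g S t) y k i j =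
      1 / 3 * S y i j k * normSq3 (g y) (S y)
        + 4 / 3 * proj3 (g y) (fun i j k => Xi g S t y j k * diff t y i) i j k
        + 4 / 3 * proj2 (g y) (fun i j => g y j k * beta g S t y i) i j) (k : Fin 2) :
    ∑ a, ∑ b, (g y)⁻¹ a b * cov2 (christoffel g) (Xi g S t) y b a k = 4 / 3 * beta g S t y k := by
  have hG := hg.symm y
  have hdet := hg.det_ne hy
  have h1 := hS.2.2 k
  have hp := proj3_symTraceFree hG hdet (fun i j k => Xi g S t y j k * diff t y i)
  have h2 := hp.2.2 k
  simp only [fun a b => hS.2.1 a b k] at h1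
  simp only [fun a b => hp.2.1 a b k] at h2
  have h3 : ∑ a, ∑ b, (g y)⁻¹ a b * proj2 (g y) (fun i j => g y j b * beta g S t y i) a k =
      beta g S t y k := by
    have e1 : ∀ b, ∑ c, ∑ d, (g y)⁻¹ c d * (g y d b * beta g S t y c) = beta g S t y b := by
      intro b
      have : ∀ c, ∑ d, (g y)⁻¹ c d * (g y d b * beta g S t y c) =
          (if c = b then 1 else 0) * beta g S t y c := by
        intro c
        rw [← sum_inv_mul hdet c b, Finset.sum_mul]
        exact Finset.sum_congr rfl fun d _ => by ring
      simp [this]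
    have e2 : ∑ a, (∑ b, (g y)⁻¹ a b * g y b k) * beta g S t y a = beta g S t y k := by
      simp [sum_inv_mul hdet]
    have e3 := sum_sum_inv hG hdet
    have hs := inv_symm hG 1 0
    have hk : ∀ b, g y k b = g y b k := fun b => hG k b
    simp only [proj2, e1]
    simp only [Fin.sum_univ_two, hs, hk, hG 1 0] at e2 e3 ⊢
    linear_combination 1 / 2 * beta g S t y k * e3
  simp only [hE, mul_add, Finset.sum_add_distrib]
  have f1 : ∑ a, ∑ b, (g y)⁻¹ a b * (1 / 3 * S y a k b * normSq3 (g y) (S y)) = 0 := by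
    have : ∑ a, ∑ b, (g y)⁻¹ a b * (1 / 3 * S y a k b * normSq3 (g y) (S y)) =
        1 / 3 * normSq3 (g y) (S y) * ∑ a, ∑ b, (g y)⁻¹ a b * S y a k b := by
      simp only [Fin.sum_univ_two]; ring
    rw [this, h1, mul_zero]
  have pull : ∀ F : Fin 2 → Fin 2 → ℝ, ∑ a, ∑ b, (g y)⁻¹ a b * (4 / 3 * F a b) =
      4 / 3 * ∑ a, ∑ b, (g y)⁻¹ a b * F a b := by
    intro F
    simp only [Fin.sum_univ_two]; ring
  rw [f1, pull, pull, h2, h3]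
  ring

/-- The equation for `∇^a τ_{ak}` follows from the other structural equations. -/
theorem LocalMetric.div_tau (hg : LocalMetric U g) (hy : y ∈ U) (ht : ContDiffOn ℝ ∞ t U)
    (hsm : ∀ i j k, ContDiffOn ℝ ∞ (fun z => S z i j k) U)
    (hS : ∀ z ∈ U, IsSymTraceFree3 (g z) (S z))
    (hE : ∀ l i j k, cov3 (christoffel g) S y l i j k =
      proj3 (g y) (fun i j k => -(2 / 3) * S y i j k * diff t y l + 2 * diff t y i * S y j k l
        + Xi g S t y i j * g y k l) i j k)
    (hX : ∀ k i j, cov2 (christoffel g) (Xi g S t) y k i j =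
      1 / 3 * S y i j k * normSq3 (g y) (S y)
        + 4 / 3 * proj3 (g y) (fun i j k => Xi g S t y j k * diff t y i) i j k
        + 4 / 3 * proj2 (g y) (fun i j => g y j k * beta g S t y i) i j)
    (hL : ∀ z ∈ U, L2D g t z = 1 / 3 * normSq3 (g z) (S z)) (k : Fin 2) :
    ∑ a, ∑ b, (g y)⁻¹ a b * cov2 (christoffel g) (tau g S t) y b a k =
      -contr2 (g y) (S y) (tau g S t y) k + beta g S t y k
        - 2 / 3 * (∑ a, Xi g S t y k a * raise (g y) (diff t y) a)
        - 4 / 9 * (∑ a, ∑ b, S y k a b * raise (g y) (diff t y) a * raise (g y) (diff t y) b)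
        - 5 / 9 * normSq3 (g y) (S y) * diff t y k
        + 1 / 2 * pd k (scal g) y - scal g y * diff t y k := by
  have hU := hg.isOpen
  have hG := hg.symm y
  have hdet := hg.det_ne hy
  have h0 := (hg.pos y hy).ne'
  have hSy := hS y hy
  have hd : ∀ i j k, DifferentiableAt ℝ (fun z => S z i j k) y :=
    fun i j k => differentiableAt_of_contDiffOn hU hy (hsm i j k)
  have hs := inv_symm hG 1 0
  have hh := hg.hess_symm hy ht
  have hN := hg.pd_normSq3_eq hy hS hd hE k
  -- Differentiating 𝓛 = |S|²/3, valid on all of U, removes the third derivatives of t.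
  have hP : pd k (laplace g t) y = 1 / 3 * pd k (fun z => normSq3 (g z) (S z)) y
      + 3 / 2 * pd k (scal g) y := by
    have dl := differentiableAt_of_contDiffOn hU hy (hg.smooth_laplace ht)
    have dN := (hg.pd_normSq3 hy hS hd k).1
    have : pd k (scal g) y = pd k (fun z => 2 / 3 * laplace g t z
        - 2 / 9 * normSq3 (g z) (S z)) y := by
      refine pd_congr hU hy (fun z hz => ?_) k
      have := hL z hz
      simp only [L2D] at this
      linarith
    rw [this, pd_sub (dl.const_mul _) (dN.const_mul _), pd_const_mul _ dl, pd_const_mul _ dN]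
    ring
  have hLy := hL y hy
  simp only [L2D] at hLy
  have A1 := hg.div_hess hy ht k
  have A2 : ∀ w : Vec, ∑ a, ∑ b, (g y)⁻¹ a b * (w b * g y a k) = w k := by
    intro w
    have : ∑ a, ∑ b, (g y)⁻¹ a b * (w b * g y a k) =
        ∑ b, (∑ a, (g y)⁻¹ b a * g y a k) * w b := by
      simp only [Fin.sum_univ_two, hs]; ring
    rw [this]
    simp [sum_inv_mul hdet]
  have A3 : ∑ a, ∑ b, (g y)⁻¹ a b * contr1 (g y) (cov3 (christoffel g) S y b) (diff t y) a k =
      ∑ c, Xi g S t y k c * raise (g y) (diff t y) c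
        - 2 / 3 * ∑ a, ∑ b, S y k a b * raise (g y) (diff t y) a * raise (g y) (diff t y) b := by
    simp only [Xi, contr1, Fin.sum_univ_two]
    ring
  have A4 : ∑ a, ∑ b, (g y)⁻¹ a b * contr1 (g y) (S y) (hess g t y b) a k =
      contr2 (g y) (S y) (hess g t y) k := by
    simp only [contr1, contr2, raise_eq, Fin.sum_univ_two, hSy.1 _ k, hs, hh 1 0]
    ring
  have A5 := hg.div_Xi hy hSy hX k
  have A6 : ∑ a, ∑ b, (g y)⁻¹ a b * (hess g t y b a * diff t y k) =
      laplace g t y * diff t y k := by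
    simp only [laplace, Fin.sum_univ_two, hs, hh 1 0]
    ring
  -- This term is cancelled by `A8`, the contribution of the trace part of dt ⊗ dt.
  have A7 : ∑ a, ∑ b, (g y)⁻¹ a b * (diff t y a * hess g t y b k) =
      ∑ a, raise (g y) (diff t y) a * hess g t y k a := by
    simp only [raise_eq, Fin.sum_univ_two, hs, hh k]
    ring
  have A8 := A2 (fun b => ∑ a, raise (g y) (diff t y) a * hess g t y b a)
  have A9 := A2 (fun b => pd b (laplace g t) y)
  have lin : ∑ a, ∑ b, (g y)⁻¹ a b * cov2 (christoffel g) (tau g S t) y b a k =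
      2 / 3 * (∑ a, ∑ b, (g y)⁻¹ a b * cov2 (christoffel g) (hess g t) y b a k
        - 1 / 2 * ∑ a, ∑ b, (g y)⁻¹ a b * (pd b (laplace g t) y * g y a k))
      - 2 / 3 * (∑ a, ∑ b, (g y)⁻¹ a b * contr1 (g y) (cov3 (christoffel g) S y b) (diff t y) a k
        + ∑ a, ∑ b, (g y)⁻¹ a b * contr1 (g y) (S y) (hess g t y b) a k)
      + 1 / 3 * ∑ a, ∑ b, (g y)⁻¹ a b * cov2 (christoffel g) (Xi g S t) y b a k
      - 8 / 9 * (∑ a, ∑ b, (g y)⁻¹ a b * (hess g t y b a * diff t y k)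
        + ∑ a, ∑ b, (g y)⁻¹ a b * (diff t y a * hess g t y b k)
        - ∑ a, ∑ b, (g y)⁻¹ a b *
          ((∑ a, raise (g y) (diff t y) a * hess g t y b a) * g y a k)) := by
    simp only [hg.cov2_tau hy ht hsm]
    simp only [Fin.sum_univ_two]
    ring
  rw [lin, A1, A3, A4, A5, A6, A7, A8, A9, contr2_tau, contr2_metric hG hdet hSy,
    contr2_contr1 hG hdet h0 hSy, contr2_mul, hP, hN]
  -- The one remaining discrepancy is Δt · t_k, from the divergence of dt ⊗ dt; the third equation
  -- at y rewrites Δt.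
  linear_combination (-8 / 9 * diff t y k) * hLy

end DivTau

/-! ### Conformal invariance -/

section PointwiseScaling

variable {G : Mat2} {c : ℝ}

theorem smul_apply_mat (c : ℝ) (G : Mat2) (i j : Fin 2) : (c • G) i j = c * G i j := rfl

theorem proj3_smul_metric (hc : c ≠ 0) (hd : G.det ≠ 0) (T : Ten3) :
    proj3 (c • G) T = proj3 G T := by
  funext i j k
  simp only [proj3, sym3Trace, inv_smul_apply hc hd, smul_apply_mat, Fin.sum_univ_two]
  field_simp

theorem proj2_smul_metric (hc : c ≠ 0) (hd : G.det ≠ 0) (T : Ten2) :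
    proj2 (c • G) T = proj2 G T := by
  funext i j
  simp only [proj2, inv_smul_apply hc hd, smul_apply_mat, Fin.sum_univ_two]
  field_simp

theorem lower_smul (c : ℝ) (G : Mat2) (Sh : Ten3) (i j k : Fin 2) :
    lower (c • G) Sh i j k = c * lower G Sh i j k := by
  simp only [lower, smul_apply_mat, Fin.sum_univ_two]
  ring

theorem normSq3_smul (hc : c ≠ 0) (hd : G.det ≠ 0) {S S' : Ten3}
    (hS : ∀ i j k, S' i j k = c * S i j k) : normSq3 (c • G) S' = c⁻¹ * normSq3 G S := by
  simp only [normSq3, inv_smul_apply hc hd, hS, Finset.mul_sum]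
  refine Finset.sum_congr rfl fun _ _ => Finset.sum_congr rfl fun _ _ => Finset.sum_congr rfl
    fun _ _ => Finset.sum_congr rfl fun _ _ => Finset.sum_congr rfl fun _ _ =>
    Finset.sum_congr rfl fun _ _ => ?_
  field_simp

theorem contr2_smul (hc : c ≠ 0) (hd : G.det ≠ 0) {S S' : Ten3}
    (hS : ∀ i j k, S' i j k = c * S i j k) (T : Ten2) (k : Fin 2) :
    contr2 (c • G) S' T k = c⁻¹ * contr2 G S T k := by
  simp only [contr2, inv_smul_apply hc hd, hS, Fin.sum_univ_two]
  field_simp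

theorem isSymTraceFree3_smul (hc : c ≠ 0) (hd : G.det ≠ 0) {S S' : Ten3}
    (hS : ∀ i j k, S' i j k = c * S i j k) (h : IsSymTraceFree3 G S) :
    IsSymTraceFree3 (c • G) S' := by
  refine ⟨fun i j k => by rw [hS, hS, h.1], fun i j k => by rw [hS, hS, h.2.1], fun k => ?_⟩
  rw [← h.2.2 k]
  refine Finset.sum_congr rfl fun a _ => Finset.sum_congr rfl fun b _ => ?_
  rw [inv_smul_apply hc hd, hS]
  field_simp

end PointwiseScaling

/-- The data of a conformal change `(g, φ, t) ↦ (c g, φ - dc/2c, t - 3/2 ln c)`. -/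
structure LocalRescaling (U : Set Plane) (c : Plane → ℝ) (g g' : Plane → Mat2)
    (φ φ' : Plane → Vec) (t t' : Plane → ℝ) : Prop where
  metric : LocalMetric U g
  metric' : LocalMetric U g'
  smooth : ContDiffOn ℝ ∞ c U
  ne_zero : ∀ z ∈ U, c z ≠ 0
  smooth_t : ContDiffOn ℝ ∞ t U
  smooth_t' : ContDiffOn ℝ ∞ t' U
  g_eq : ∀ z ∈ U, g' z = c z • g z
  φ_eq : ∀ z ∈ U, ∀ l, φ' z l = φ z l - pd l c z / (2 * c z)
  t_eq : ∀ z ∈ U, ∀ l, pd l t' z = pd l t z - 3 * (pd l c z / (2 * c z))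

namespace LocalRescaling

variable {U : Set Plane} {c : Plane → ℝ} {g g' : Plane → Mat2} {φ φ' : Plane → Vec}
  {t t' : Plane → ℝ} {y : Plane} {Sh : Plane → Ten3} (h : LocalRescaling U c g g' φ φ' t t')
include h

theorem weylConn_eq (hy : y ∈ U) : weylConn g' φ' y = weylConn g φ y :=
  weylConn_rescale h.metric hy (differentiableAt_of_contDiffOn h.metric.isOpen hy h.smooth)
    (h.ne_zero y hy) h.g_eq (h.φ_eq y hy)

/-- A rescaling does not assume dt = 3φ, so two Weyl connections occur: that of φ in the
derivatives, and that of dt/3 behind Ξ and 𝓛. Each is invariant separately. -/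
theorem weylConn_diff_eq (hy : y ∈ U) :
    weylConn g' (fun z i => 1 / 3 * diff t' z i) y = weylConn g (fun z i => 1 / 3 * diff t z i) y :=
  weylConn_rescale h.metric hy (differentiableAt_of_contDiffOn h.metric.isOpen hy h.smooth)
    (h.ne_zero y hy) h.g_eq fun l => by
      simp only [diff, h.t_eq y hy]
      ring

/-- Both sides come from the Ricci tensor of one and the same connection; only the g⁻¹ used for the
trace changes, by c⁻¹. -/
theorem L2D_rescale (hy : y ∈ U) : L2D g' t' y = (c y)⁻¹ * L2D g t y := by
  rw [h.metric'.L2D_eq hy h.smooth_t', h.metric.L2D_eq hy h.smooth_t]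
  have hc : ∀ l k i j, curv (weylConn g' (fun z i => 1 / 3 * diff t' z i)) y l k i j =
      curv (weylConn g (fun z i => 1 / 3 * diff t z i)) y l k i j := by
    intro l k i j
    -- Curvature differentiates the coefficients, so their equality is used on the open set U.
    have hp : ∀ i j, pd i (fun z => weylConn g' (fun z i => 1 / 3 * diff t' z i) z l j k) y =
        pd i (fun z => weylConn g (fun z i => 1 / 3 * diff t z i) z l j k) y := fun i j =>
      pd_congr h.metric.isOpen hy (fun z hz => by rw [h.weylConn_diff_eq hz]) i
    simp only [curv, hp, h.weylConn_diff_eq hy]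
  simp only [hc, h.g_eq y hy, inv_smul_apply (h.ne_zero y hy) (h.metric.det_ne hy),
    Fin.sum_univ_two]
  ring

theorem lower_eq (hy : y ∈ U) (i j k : Fin 2) :
    lower (g' y) (Sh y) i j k = c y * lower (g y) (Sh y) i j k := by
  rw [h.g_eq y hy, lower_smul]

theorem symTraceFree (hy : y ∈ U) (hS : IsSymTraceFree3 (g y) (lower (g y) (Sh y))) :
    IsSymTraceFree3 (g' y) (lower (g' y) (Sh y)) := by
  have h1 := h.lower_eq (Sh := Sh) hy
  rw [h.g_eq y hy] at h1 ⊢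
  exact isSymTraceFree3_smul (h.ne_zero y hy) (h.metric.det_ne hy) h1 hS

theorem normSq3_eq (hy : y ∈ U) :
    normSq3 (g' y) (lower (g' y) (Sh y)) = (c y)⁻¹ * normSq3 (g y) (lower (g y) (Sh y)) := by
  have h1 := h.lower_eq (Sh := Sh) hy
  rw [h.g_eq y hy] at h1 ⊢
  exact normSq3_smul (h.ne_zero y hy) (h.metric.det_ne hy) h1

theorem eqL_iff (hy : y ∈ U) :
    L2D g t y = 1 / 3 * normSq3 (g y) (lower (g y) (Sh y)) ↔
      L2D g' t' y = 1 / 3 * normSq3 (g' y) (lower (g' y) (Sh y)) := by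
  have hc := inv_ne_zero (h.ne_zero y hy)
  rw [h.L2D_rescale hy, h.normSq3_eq hy, mul_left_comm, mul_right_inj' hc]

/-- The divergence formula for Ξ applies on both sides, because S remains totally symmetric and
trace-free after scaling. -/
theorem Xi_eq (hSh : ∀ i j k, ContDiffOn ℝ ∞ (fun z => Sh z i j k) U)
    (hS : ∀ z ∈ U, IsSymTraceFree3 (g z) (lower (g z) (Sh z))) (hy : y ∈ U) :
    Xi g' (fun z => lower (g' z) (Sh z)) t' y = Xi g (fun z => lower (g z) (Sh z)) t y := by
  funext i j
  have hd : ∀ i j k, DifferentiableAt ℝ (fun z => Sh z i j k) y :=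
    fun i j k => differentiableAt_of_contDiffOn h.metric.isOpen hy (hSh i j k)
  rw [h.metric.Xi_eq_divergence hy hS hd,
    h.metric'.Xi_eq_divergence hy (fun z hz => h.symTraceFree hz (hS z hz)) hd]
  simp only [cov12, h.weylConn_diff_eq hy]

/-- On the right side, the weight of g in Ξ ⊗ g cancels that of the g⁻¹ raising the index; the
projection has weight zero. -/
theorem eqS_iff (hSh : ∀ i j k, ContDiffOn ℝ ∞ (fun z => Sh z i j k) U)
    (hS : ∀ z ∈ U, IsSymTraceFree3 (g z) (lower (g z) (Sh z))) (hy : y ∈ U) :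
    (∀ l i j k, cov12 (weylConn g φ) Sh y l i j k =
      zTensor g (fun z => lower (g z) (Sh z)) t y i j l k) ↔
    ∀ l i j k, cov12 (weylConn g' φ') Sh y l i j k =
      zTensor g' (fun z => lower (g' z) (Sh z)) t' y i j l k := by
  have hc := h.ne_zero y hy
  have hz : ∀ i j l k, zTensor g' (fun z => lower (g' z) (Sh z)) t' y i j l k =
      zTensor g (fun z => lower (g z) (Sh z)) t y i j l k := by
    intro i j l k
    unfold zTensor
    rw [h.Xi_eq hSh hS hy, h.g_eq y hy, proj3_smul_metric hc (h.metric.det_ne hy)]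
    have : (fun i' j' a' => Xi g (fun z => lower (g z) (Sh z)) t y i' j' * (c y • g y) a' l) =
        fun i' j' a' => c y * (Xi g (fun z => lower (g z) (Sh z)) t y i' j' * g y a' l) := by
      funext i' j' a'
      rw [smul_apply_mat]; ring
    simp only [this, proj3_smul, inv_smul_apply hc (h.metric.det_ne hy)]
    refine Finset.sum_congr rfl fun a _ => ?_
    field_simp
  simp only [cov12, h.weylConn_eq hy, hz]

/-- Both products on the right are invariant: |S|² and β scale by c⁻¹, while S and g scale by c. -/
theorem eqXi_iff (hSh : ∀ i j k, ContDiffOn ℝ ∞ (fun z => Sh z i j k) U)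
    (hS : ∀ z ∈ U, IsSymTraceFree3 (g z) (lower (g z) (Sh z))) (hy : y ∈ U) :
    (∀ l i j, cov2 (weylConn g φ) (Xi g (fun z => lower (g z) (Sh z)) t) y l i j =
      normSq3 (g y) (lower (g y) (Sh y)) / 3 * lower (g y) (Sh y) l i j
        + 4 / 3 * bTensor g (fun z => lower (g z) (Sh z)) t y i j l) ↔
    ∀ l i j, cov2 (weylConn g' φ') (Xi g' (fun z => lower (g' z) (Sh z)) t') y l i j =
      normSq3 (g' y) (lower (g' y) (Sh y)) / 3 * lower (g' y) (Sh y) l i j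
        + 4 / 3 * bTensor g' (fun z => lower (g' z) (Sh z)) t' y i j l := by
  have hc := h.ne_zero y hy
  have hdet := h.metric.det_ne hy
  have hb : ∀ i j l, bTensor g' (fun z => lower (g' z) (Sh z)) t' y i j l =
      bTensor g (fun z => lower (g z) (Sh z)) t y i j l := by
    intro i j l
    have h1 := h.lower_eq (Sh := Sh) hy
    unfold bTensor beta
    simp only
    rw [h.Xi_eq hSh hS hy]
    rw [h.g_eq y hy] at h1 ⊢
    rw [proj2_smul_metric hc hdet]
    congr 1
    funext i' j'
    rw [contr2_smul hc hdet h1, smul_apply_mat]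
    field_simp
  have hcov : ∀ l i j, cov2 (weylConn g' φ') (Xi g' (fun z => lower (g' z) (Sh z)) t') y l i j =
      cov2 (weylConn g φ) (Xi g (fun z => lower (g z) (Sh z)) t) y l i j := by
    intro l i j
    have hp := pd_congr h.metric.isOpen hy (fun z hz =>
      congrFun (congrFun (h.Xi_eq hSh hS hz) i) j) l
    simp only [cov2, hp, h.weylConn_eq hy, h.Xi_eq hSh hS hy]
  refine forall_congr' fun l => forall_congr' fun i => forall_congr' fun j => ?_
  rw [hcov, hb, h.normSq3_eq hy, h.lower_eq hy]
  have : (c y)⁻¹ * normSq3 (g y) (lower (g y) (Sh y)) / 3 * (c y * lower (g y) (Sh y) l i j) =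
      normSq3 (g y) (lower (g y) (Sh y)) / 3 * lower (g y) (Sh y) l i j := by
    field_simp
  rw [this]

end LocalRescaling

/-! ### Components in local coordinates -/

section Coordinates

variable {M : Type*} [TopologicalSpace M] [ChartedSpace Plane M] [IsManifold (𝓡 2) ∞ M]
  {e : OpenPartialHomeomorph M Plane} {y : Plane}

set_option linter.unusedSectionVars false in
theorem IsCoord.contMDiffOn_symm (he : IsCoord e) :
    ContMDiffOn (𝓡 2) (𝓡 2) ∞ e.symm e.target :=
  contMDiffOn_symm_of_mem_maximalAtlas he

set_option linter.unusedSectionVars false in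
theorem IsCoord.contMDiffOn (he : IsCoord e) : ContMDiffOn (𝓡 2) (𝓡 2) ∞ e e.source :=
  contMDiffOn_of_mem_maximalAtlas he

theorem IsCoord.mdifferentiableAt_symm (he : IsCoord e) (hy : y ∈ e.target) :
    MDifferentiableAt (𝓡 2) (𝓡 2) e.symm y :=
  (he.contMDiffOn_symm.contMDiffAt (e.open_target.mem_nhds hy)).mdifferentiableAt (by simp)

theorem IsCoord.mdifferentiableAt (he : IsCoord e) (hy : y ∈ e.target) :
    MDifferentiableAt (𝓡 2) (𝓡 2) e (e.symm y) :=
  (he.contMDiffOn.contMDiffAt (e.open_source.mem_nhds (e.map_target hy))).mdifferentiableAt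
    (by simp)

theorem IsCoord.mfderiv_comp_symm (he : IsCoord e) (hy : y ∈ e.target) (v : Plane) :
    mfderiv (𝓡 2) (𝓡 2) e (e.symm y) (mfderiv (𝓡 2) (𝓡 2) e.symm y v) = v := by
  have h := mfderiv_comp y (he.mdifferentiableAt hy) (he.mdifferentiableAt_symm hy)
  have h1 : mfderiv (𝓡 2) (𝓡 2) (e ∘ e.symm) y = mfderiv (𝓡 2) (𝓡 2) (id : Plane → Plane) y := by
    refine Filter.EventuallyEq.mfderiv_eq ?_
    filter_upwards [e.open_target.mem_nhds hy] with z hz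
    exact e.right_inv hz
  rw [h1, mfderiv_id] at h
  exact (congrArg (fun L : Plane →L[ℝ] Plane => L v) h).symm

/-- The field is the tangent map of the inverse chart applied to a constant section. -/
theorem IsCoord.smooth_tangent (he : IsCoord e) (v : Plane) :
    ContMDiffOn (𝓡 2) ((𝓡 2).prod (𝓡 2)) ∞
      (fun z => (⟨e.symm z, mfderiv (𝓡 2) (𝓡 2) e.symm z v⟩ : TangentBundle (𝓡 2) M)) e.target := by
  have h1 := he.contMDiffOn_symm.contMDiffOn_tangentMapWithin (m := ∞) (by simp)
    e.open_target.uniqueMDiffOn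
  have h2 : ContMDiff (𝓡 2) ((𝓡 2).prod (𝓡 2)) ∞
      (fun z : Plane => (⟨z, v⟩ : TangentBundle (𝓡 2) Plane)) :=
    contMDiff_vectorSpace_iff_contDiff.2 contDiff_const
  have h3 := h1.comp h2.contMDiffOn (s := e.target) (fun z hz => hz)
  refine h3.congr fun z hz => ?_
  simp only [Function.comp, tangentMapWithin]
  rw [mfderivWithin_of_isOpen e.open_target hz]

theorem smooth_coordVec (he : IsCoord e) (i : Fin 2) :
    ContMDiffOn (𝓡 2) ((𝓡 2).prod (𝓡 2)) ∞
      (fun z => (⟨e.symm z, coordVec e z i⟩ : TangentBundle (𝓡 2) M)) e.target :=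
  he.smooth_tangent _

theorem Metric.smooth_coord (g : Metric M) (he : IsCoord e) (i j : Fin 2) :
    ContDiffOn ℝ ∞ (fun z => g.coord e z i j) e.target := by
  rw [← contMDiffOn_iff_contDiffOn]
  have h1 : ContMDiffOn (𝓡 2) ((𝓡 2).prod 𝓘(ℝ, Plane →L[ℝ] Plane →L[ℝ] ℝ)) ∞
      (fun z => Bundle.TotalSpace.mk' (Plane →L[ℝ] Plane →L[ℝ] ℝ)
        (E := fun x : M => TangentSpace (𝓡 2) x →L[ℝ] TangentSpace (𝓡 2) x →L[ℝ] ℝ)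
        (e.symm z) (g.inner (e.symm z))) e.target :=
    g.contMDiff.comp_contMDiffOn he.contMDiffOn_symm
  have h2 : ContMDiffOn (𝓡 2) ((𝓡 2).prod 𝓘(ℝ)) ∞
      (fun z => Bundle.TotalSpace.mk' ℝ (E := Bundle.Trivial M ℝ) (e.symm z)
        (g.inner (e.symm z) (coordVec e z i) (coordVec e z j))) e.target := by
    apply ContMDiffOn.clm_bundle_apply₂ (F₁ := Plane) (F₂ := Plane)
    · exact h1
    · exact smooth_coordVec he i
    · exact smooth_coordVec he j
  intro z hz
  have h3 := h2 z hz
  simp only [Bundle.contMDiffWithinAt_totalSpace] at h3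
  exact h3.2

theorem Tensor12.smooth_coord (Sh : Tensor12 M) (he : IsCoord e) (i j k : Fin 2) :
    ContDiffOn ℝ ∞ (fun z => Sh.coord e z i j k) e.target := by
  have h1 : ContMDiffOn (𝓡 2) ((𝓡 2).prod 𝓘(ℝ, Plane →L[ℝ] Plane →L[ℝ] Plane)) ∞
      (fun z => Bundle.TotalSpace.mk' (Plane →L[ℝ] Plane →L[ℝ] Plane)
        (E := fun x : M => TangentSpace (𝓡 2) x →L[ℝ] TangentSpace (𝓡 2) x →L[ℝ]
          TangentSpace (𝓡 2) x) (e.symm z) (Sh.toFun (e.symm z))) e.target :=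
    Sh.contMDiff.comp_contMDiffOn he.contMDiffOn_symm
  have h2 : ContMDiffOn (𝓡 2) ((𝓡 2).prod (𝓡 2)) ∞
      (fun z => Bundle.TotalSpace.mk' Plane (E := fun x : M => TangentSpace (𝓡 2) x) (e.symm z)
        (Sh.toFun (e.symm z) (coordVec e z i) (coordVec e z j))) e.target := by
    apply ContMDiffOn.clm_bundle_apply₂ (F₁ := Plane) (F₂ := Plane)
    · exact h1
    · exact smooth_coordVec he i
    · exact smooth_coordVec he j
  have h3 := he.contMDiffOn.contMDiffOn_tangentMapWithin (m := ∞) (by simp)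
    e.open_source.uniqueMDiffOn
  have h4 := h3.comp h2 (fun z hz => e.map_target hz)
  -- The vector field Ŝ(∂_i, ∂_j) has been pushed forward to the plane by the chart, where the
  -- tangent bundle is trivial and the fibre part can be read off.
  have h5 := (contMDiff_snd_tangentBundle_modelSpace Plane (𝓡 2) (n := ∞)).comp_contMDiffOn h4
  have h6 := (EuclideanSpace.proj k : Plane →L[ℝ] ℝ).contDiff.comp_contDiffOn
    (contMDiffOn_iff_contDiffOn.1 h5)
  refine h6.congr fun z hz => ?_
  simp only [Function.comp, tangentMapWithin]
  rw [mfderivWithin_of_isOpen e.open_source (e.map_target hz)]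
  rfl

theorem Metric.localMetric (g : Metric M) (he : IsCoord e) : LocalMetric e.target (g.coord e) := by
  have inj : ∀ y ∈ e.target, ∀ v : Plane, v ≠ 0 →
      (mfderiv (𝓡 2) (𝓡 2) e.symm y v : TangentSpace (𝓡 2) (e.symm y)) ≠ 0 := by
    intro y hy v hv h
    apply hv
    rw [← he.mfderiv_comp_symm hy v]
    exact (congrArg _ h).trans (map_zero _)
  have hpos : ∀ y ∈ e.target, 0 < g.coord e y 0 0 := by
    intro y hy
    refine g.pos _ _ (inj y hy _ fun h => ?_)
    have := congrArg (fun v : Plane => v 0) h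
    simp at this
  refine ⟨e.open_target, fun z i j => g.symm _ _ _, hpos, fun y hy => ?_, g.smooth_coord he⟩
  set a := g.coord e y 0 0 with ha
  set b := g.coord e y 0 1 with hb
  have hb' : g.inner (e.symm y) (coordVec e y 1) (coordVec e y 0) = b := g.symm _ _ _
  have ha0 : 0 < a := hpos y hy
  -- Gram–Schmidt without normalisation: v is nonzero, and its squared length is a · det g.
  set v : Plane := a • EuclideanSpace.single 1 (1 : ℝ) - b • EuclideanSpace.single 0 (1 : ℝ) with hv
  have hv0 : v ≠ 0 := by
    intro h
    have := congrArg (fun v : Plane => v 1) h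
    simp [hv] at this
    exact ha0.ne' this
  have h1 := g.pos _ _ (inj y hy v hv0)
  have h2 : (mfderiv (𝓡 2) (𝓡 2) e.symm y v : TangentSpace (𝓡 2) (e.symm y)) =
      a • coordVec e y 1 - b • coordVec e y 0 := by
    rw [hv]
    exact (map_sub (mfderiv (𝓡 2) (𝓡 2) e.symm y) _ _).trans
      (congrArg₂ _ (map_smul _ _ _) (map_smul _ _ _))
  rw [h2] at h1
  have h3 : g.inner (e.symm y) (a • coordVec e y 1 - b • coordVec e y 0)
      (a • coordVec e y 1 - b • coordVec e y 0) = a * (g.coord e y).det := by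
    have hc : g.inner (e.symm y) (coordVec e y 0) (coordVec e y 0) = a := rfl
    have hd : g.inner (e.symm y) (coordVec e y 0) (coordVec e y 1) = b := rfl
    have hf : g.inner (e.symm y) (coordVec e y 1) (coordVec e y 1) = g.coord e y 1 1 := rfl
    have hk : g.coord e y 1 0 = b := hb'
    rw [Matrix.det_fin_two, hk, ← ha, ← hb]
    simp only [map_sub, map_smul, sub_apply, smul_apply,
      smul_eq_mul, hc, hd, hb', hf]
    ring
  rw [h3] at h1
  exact pos_of_mul_pos_right h1 ha0.le

theorem smooth_coordFun (t : C^∞⟮𝓡 2, M; ℝ⟯) (he : IsCoord e) :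
    ContDiffOn ℝ ∞ (coordFun t e) e.target :=
  contMDiffOn_iff_contDiffOn.1 (t.contMDiff.comp_contMDiffOn he.contMDiffOn_symm)

theorem pd_comp_symm (he : IsCoord e) (hy : y ∈ e.target) {f : M → ℝ}
    (hf : MDifferentiableAt (𝓡 2) 𝓘(ℝ, ℝ) f (e.symm y)) (i : Fin 2) :
    pd i (fun z => f (e.symm z)) y = differential f (e.symm y) (coordVec e y i) := by
  have h := mfderiv_comp y hf (he.mdifferentiableAt_symm hy)
  rw [mfderiv_eq_fderiv] at h
  exact congrArg (fun L : Plane →L[ℝ] ℝ => L (EuclideanSpace.single i 1)) h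

theorem pd_coordFun (t : C^∞⟮𝓡 2, M; ℝ⟯) (he : IsCoord e) (hy : y ∈ e.target) (i : Fin 2) :
    pd i (coordFun t e) y = differential t (e.symm y) (coordVec e y i) :=
  pd_comp_symm he hy (t.contMDiff.mdifferentiableAt (by simp)) i

theorem OneForm.IsPotential.coord_eq {φ : OneForm M} {t : C^∞⟮𝓡 2, M; ℝ⟯} (h : φ.IsPotential t)
    (he : IsCoord e) (hy : y ∈ e.target) (i : Fin 2) :
    φ.coord e y i = 1 / 3 * diff (coordFun t e) y i := by
  rw [diff, pd_coordFun t he hy, h]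
  simp only [OneForm.coord]
  ring

theorem pd_log_abs {f : Plane → ℝ} (hf : DifferentiableAt ℝ f y) (h0 : f y ≠ 0) (i : Fin 2) :
    pd i (fun z => Real.log |f z|) y = pd i f y / f y := by
  simp only [Real.log_abs, pd, fderiv.log hf h0]
  simp [div_eq_inv_mul]

/-- Replaces Ω by the factor c = Ω² of the metric, which makes the sign of Ω irrelevant. -/
theorem WeylPair.IsRescaling.differential_log {p q : WeylPair M} {Ω : C^∞⟮𝓡 2, M; ℝ⟯}
    (h : WeylPair.IsRescaling Ω p q) (he : IsCoord e) (hy : y ∈ e.target) (i : Fin 2) :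
    differential (fun x => Real.log |Ω x|) (e.symm y) (coordVec e y i) =
      pd i (fun z => coordFun Ω e z ^ 2) y / (2 * coordFun Ω e y ^ 2) := by
  have hd : DifferentiableAt ℝ (coordFun Ω e) y :=
    differentiableAt_of_contDiffOn e.open_target hy (smooth_coordFun Ω he)
  have h0 : coordFun Ω e y ≠ 0 := h.1.1 _
  rw [← pd_comp_symm he hy (mdiff_log h.1.1 _)]
  have h1 : pd i (fun z => Real.log |Ω (e.symm z)|) y = pd i (coordFun Ω e) y / coordFun Ω e y :=
    pd_log_abs hd h0 i
  simp only [pow_two]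
  rw [h1, pd_mul hd hd]
  field_simp
  ring

theorem WeylPair.IsRescaling.localRescaling {p q : WeylPair M} {Ω t t' : C^∞⟮𝓡 2, M; ℝ⟯}
    (h : WeylPair.IsRescaling Ω p q) (ht : ∀ x, t' x = t x - 3 * Real.log |Ω x|)
    (he : IsCoord e) :
    LocalRescaling e.target (fun z => coordFun Ω e z ^ 2) (p.g.coord e) (q.g.coord e)
      (p.φ.coord e) (q.φ.coord e) (coordFun t e) (coordFun t' e) where
  metric := p.g.localMetric he
  metric' := q.g.localMetric he
  smooth := (smooth_coordFun Ω he).pow 2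
  ne_zero := fun z _ => pow_ne_zero 2 (h.1.1 _)
  smooth_t := smooth_coordFun t he
  smooth_t' := smooth_coordFun t' he
  g_eq := fun z _ => by
    ext i j
    exact h.1.2 _ _ _
  φ_eq := fun z hz l => by
    rw [← h.differential_log he hz]
    exact h.2 _ _
  t_eq := fun z hz l => by
    rw [← h.differential_log he hz, ← pd_comp_symm he hz (mdiff_log h.1.1 _)]
    have e1 : coordFun t' e = fun z => coordFun t e z - 3 * Real.log |Ω (e.symm z)| :=
      funext fun z => ht _
    have d1 : DifferentiableAt ℝ (coordFun t e) z :=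
      differentiableAt_of_contDiffOn e.open_target hz (smooth_coordFun t he)
    have d2 : DifferentiableAt ℝ (fun z => Real.log |Ω (e.symm z)|) z := by
      simp only [Real.log_abs]
      exact (differentiableAt_of_contDiffOn e.open_target hz (smooth_coordFun Ω he)).log (h.1.1 _)
    rw [e1, pd_sub d1 (d2.const_mul 3), pd_const_mul 3 d2]

end Coordinates

/-! ### Abundant structures -/

section Abundant

variable {M : Type*} [TopologicalSpace M] [ChartedSpace Plane M] [IsManifold (𝓡 2) ∞ M]

theorem Tensor12.differentiableAt_coord (Sh : Tensor12 M) {e : OpenPartialHomeomorph M Plane}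
    (he : IsCoord e) {y : Plane} (hy : y ∈ e.target) (i j k : Fin 2) :
    DifferentiableAt ℝ (fun z => Sh.coord e z i j k) y :=
  differentiableAt_of_contDiffOn e.open_target hy (Sh.smooth_coord he i j k)

/-- For one representative, the three Weyl equations carry all the content: they imply both the
symmetry of S and the divergence equation. -/
theorem isAbundantStructure_iff {p : WeylPair M} {Sh : Tensor12 M} {t : C^∞⟮𝓡 2, M; ℝ⟯}
    (hc : p.g.IsConformallyFlat) (ht : p.φ.IsPotential t) :
    IsAbundantStructure p.g Sh t ↔ EqS p Sh t ∧ EqXi p Sh t ∧ EqL p Sh t := by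
  constructor
  · rintro ⟨-, hS, hE⟩
    refine ⟨fun e he y hy => ?_, fun e he y hy => ?_, fun e he y hy => ?_⟩ <;>
    have hg := p.g.localMetric he
    · exact (hg.eqS_iff hy (Sh.differentiableAt_coord he hy) (hS e he y hy)
        (ht.coord_eq he hy)).2 (hE e he y hy).nabla_S
    · have hX := hg.Xi_symTraceFree hy (hS e he) (fun i j k => differentiableAt_of_contDiffOn
        e.open_target hy (hg.smooth_lower (Sh.smooth_coord he) i j k)) (coordFun t e)
      exact (hg.eqXi_iff hy (hS e he y hy) hX (ht.coord_eq he hy)).2 (hE e he y hy).nabla_Xi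
    · exact (hg.eqL_iff hy (Sh.coordLower p.g e)).2 (hE e he y hy).hess_t
  · rintro ⟨hS, hX, hL⟩
    have hst : Sh.IsSymTraceFree p.g := fun e he y hy =>
      (p.g.localMetric he).symTraceFree_of_eqS hy (smooth_coordFun t he)
        (fun z hz => ht.coord_eq he hz) (Sh.smooth_coord he) (hS e he) (hL e he y hy)
    refine ⟨hc, hst, fun e he y hy => ?_⟩
    have hg := p.g.localMetric he
    have hsm := hg.smooth_lower (Sh.smooth_coord he)
    have hXi := hg.Xi_symTraceFree hy (hst e he) (fun i j k => differentiableAt_of_contDiffOn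
        e.open_target hy (hsm i j k)) (coordFun t e)
    have h1 := (hg.eqS_iff hy (Sh.differentiableAt_coord he hy) (hst e he y hy)
      (ht.coord_eq he hy)).1 (hS e he y hy)
    have h2 := (hg.eqXi_iff hy (hst e he y hy) hXi (ht.coord_eq he hy)).1 (hX e he y hy)
    exact ⟨h1, h2, hg.div_tau hy (smooth_coordFun t he) hsm (hst e he) h1 h2 (hL e he),
      (hg.eqL_iff hy (Sh.coordLower p.g e)).1 (hL e he y hy)⟩

/-! ### Transport of the equations along a global conformal change. -/

section Rescaling

variable {p q : WeylPair M} {Ω t t' : C^∞⟮𝓡 2, M; ℝ⟯} (h : WeylPair.IsRescaling Ω p q)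
  (ht : ∀ x, t' x = t x - 3 * Real.log |Ω x|) (Sh : Tensor12 M)
include h ht

theorem eqL_iff_of_isRescaling : EqL p Sh t ↔ EqL q Sh t' :=
  forall_congr' fun _ => forall_congr' fun he => forall_congr' fun _ => forall_congr' fun hy =>
    (h.localRescaling ht he).eqL_iff hy

theorem eqS_iff_of_isRescaling (hS : Sh.IsSymTraceFree p.g) : EqS p Sh t ↔ EqS q Sh t' :=
  forall_congr' fun e => forall_congr' fun he => forall_congr' fun _ => forall_congr' fun hy =>
    (h.localRescaling ht he).eqS_iff (Sh.smooth_coord he) (hS e he) hy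

theorem eqXi_iff_of_isRescaling (hS : Sh.IsSymTraceFree p.g) : EqXi p Sh t ↔ EqXi q Sh t' :=
  forall_congr' fun e => forall_congr' fun he => forall_congr' fun _ => forall_congr' fun hy =>
    (h.localRescaling ht he).eqXi_iff (Sh.smooth_coord he) (hS e he) hy

theorem isPotential_of_isRescaling (hp : p.φ.IsPotential t) : q.φ.IsPotential t' := by
  intro x v
  have e1 : (t' : M → ℝ) = (t : M → ℝ) - (3 : ℝ) • fun x => Real.log |Ω x| := by
    funext x
    simp [ht]
  have d2 := mdiff_log h.1.1 x
  have d1 : MDifferentiableAt (𝓡 2) 𝓘(ℝ, ℝ) t x := t.contMDiff.mdifferentiableAt (by simp)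
  have e2 : differential t' x = differential t x
      - (3 : ℝ) • differential (fun x => Real.log |Ω x|) x := by
    unfold differential
    rw [e1]
    exact (mfderiv_sub d1 (d2.const_smul 3)).trans
      (congrArg _ (const_smul_mfderiv d2 3))
  rw [e2, h.2, mul_sub, ← hp]
  rfl

end Rescaling

theorem exists_rescaled_potential {p q : WeylPair M} {Ω : C^∞⟮𝓡 2, M; ℝ⟯}
    (h : WeylPair.IsRescaling Ω p q) (t : C^∞⟮𝓡 2, M; ℝ⟯) :
    ∃ t' : C^∞⟮𝓡 2, M; ℝ⟯, ∀ x, t' x = t x - 3 * Real.log |Ω x| := by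
  have h1 : ContMDiff (𝓡 2) 𝓘(ℝ, ℝ) ∞ fun x => Real.log |Ω x| := by
    simp only [Real.log_abs]
    exact fun x => ((Real.contDiffAt_log.2 (h.1.1 x)).contMDiffAt).comp x (Ω.contMDiff x)
  exact ⟨⟨fun x => t x - 3 * Real.log |Ω x|, t.contMDiff.sub (contMDiff_const.mul h1)⟩,
    fun x => rfl⟩

theorem WeylPair.Represents.exists_isRescaling {p q : WeylPair M} {Φ : WeylianMetric M}
    (hp : p.Represents Φ) (hq : q.Represents Φ) :
    ∃ Ω : C^∞⟮𝓡 2, M; ℝ⟯, WeylPair.IsRescaling Ω p q :=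
  Quotient.exact (Eq.trans hp (Eq.symm hq))

/-- Flatness of Φ is needed only here: the flat representative is a rescaling of every other one. -/
theorem WeylianMetric.IsFlat.isConformallyFlat {Φ : WeylianMetric M} (hΦ : Φ.IsFlat)
    {p : WeylPair M} (hp : p.Represents Φ) : p.g.IsConformallyFlat := by
  obtain ⟨p₀, hp₀, hf⟩ := hΦ
  obtain ⟨Ω, hΩ⟩ := hp.exists_isRescaling hp₀
  exact ⟨p₀.g, Ω, hΩ.1, hf⟩

end Abundant

end WeylAbundant

/-! ### The theorem. -/

theorem mainTheorem2 {M : Type*} [TopologicalSpace M] [ChartedSpace WeylAbundant.Plane M]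
    [IsManifold (𝓡 2) ∞ M] (Φ : WeylAbundant.WeylianMetric M) (hΦ : Φ.IsFlat)
    (Sh : WeylAbundant.Tensor12 M) :
    -- the characterisation, computed in an arbitrary representative
    (∀ p : WeylAbundant.WeylPair M, p.Represents Φ →
      (Φ.IsAbundant Sh ↔ ∃ t : C^∞⟮𝓡 2, M; ℝ⟯, p.φ.IsPotential t ∧
        WeylAbundant.EqS p Sh t ∧ WeylAbundant.EqXi p Sh t ∧ WeylAbundant.EqL p Sh t)) ∧
    -- conformal behaviour under `(g, φ, t) ↦ (Ω² g, φ - d ln|Ω|, t - 3 ln|Ω|)`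
    (∀ (p q : WeylAbundant.WeylPair M) (Ω t t' : C^∞⟮𝓡 2, M; ℝ⟯),
      p.Represents Φ → WeylAbundant.WeylPair.IsRescaling Ω p q →
      (∀ x, t' x = t x - 3 * Real.log |Ω x|) →
      (∀ e : OpenPartialHomeomorph M WeylAbundant.Plane, WeylAbundant.IsCoord e →
        ∀ y ∈ e.target,
          WeylAbundant.L2D (q.g.coord e) (WeylAbundant.coordFun t' e) y =
            (Ω (e.symm y) ^ 2)⁻¹ *
              WeylAbundant.L2D (p.g.coord e) (WeylAbundant.coordFun t e) y) ∧
      (WeylAbundant.EqL p Sh t ↔ WeylAbundant.EqL q Sh t') ∧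
      (Sh.IsSymTraceFree p.g →
        (WeylAbundant.EqS p Sh t ↔ WeylAbundant.EqS q Sh t') ∧
        (WeylAbundant.EqXi p Sh t ↔ WeylAbundant.EqXi q Sh t'))) := by
  refine ⟨fun p hp => ⟨fun hA => ?_, ?_⟩, fun p q Ω t t' _ hΩ ht' => ⟨?_, ?_, fun hS => ⟨?_, ?_⟩⟩⟩
  · obtain ⟨t, ht, hs⟩ := hA p hp
    exact ⟨t, ht, (WeylAbundant.isAbundantStructure_iff (hΦ.isConformallyFlat hp) ht).1 hs⟩
  -- Abundance concerns every representative q, while the equations are given only for p. They are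
  -- carried over with t' = t - 3 ln|Ω|.
  · rintro ⟨t, ht, hE⟩ q hq
    obtain ⟨Ω, hΩ⟩ := hp.exists_isRescaling hq
    obtain ⟨t', ht'⟩ := WeylAbundant.exists_rescaled_potential hΩ t
    -- Invariance of the first two equations needs S totally symmetric and trace-free, so this is
    -- extracted at p beforehand.
    have hS := ((WeylAbundant.isAbundantStructure_iff (hΦ.isConformallyFlat hp) ht).2 hE).symTraceFree
    have hq' := WeylAbundant.isPotential_of_isRescaling hΩ ht' ht
    refine ⟨t', hq', (WeylAbundant.isAbundantStructure_iff (hΦ.isConformallyFlat hq) hq').2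
      ⟨?_, ?_, ?_⟩⟩
    · exact (WeylAbundant.eqS_iff_of_isRescaling hΩ ht' Sh hS).1 hE.1
    · exact (WeylAbundant.eqXi_iff_of_isRescaling hΩ ht' Sh hS).1 hE.2.1
    · exact (WeylAbundant.eqL_iff_of_isRescaling hΩ ht' Sh).1 hE.2.2
  · exact fun e he y hy => (hΩ.localRescaling ht' he).L2D_rescale hy
  · exact WeylAbundant.eqL_iff_of_isRescaling hΩ ht' Sh
  · exact WeylAbundant.eqS_iff_of_isRescaling hΩ ht' Sh hS
  · exact WeylAbundant.eqXi_iff_of_isRescaling hΩ ht' Sh hS
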